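/- Let $M$ be a smooth (Hausdorff, finite-dimensional) manifold, $A\to M$ a smooth real vector bundle of finite rank, $\phi:M\to M$ a diffeomorphism with pullback $\phi^*f=f\circ\phi$ on $C^\infty(M)$, and $\alpha:\Gamma(A)\to\Gamma(A)$ an invertible $\mathbb{R}$-linear map with $\alpha(fX)=\phi^*(f)\,\alpha(X)$ for $f\in C^\infty(M)$, $X\in\Gamma(A)$ (that is, $(A,\phi,\alpha)$ is a regular hom-bundle). A hom-Lie algebroid structure on $(A,\phi,\alpha)$ consists of an $\mathbb{R}$-bilinear skew-symmetric bracket $[-,-]$ on $\Gamma(A)$ and an anchor $\rho$, a vector bundle map $\rho:\phi^!A\to\phi^!TM$ between the pullback bundles, acting by $\rho(X)[f](m)=\langle d_{\phi(m)}f,\rho_m(X_{\phi(m)})\rangle$, such that for all $X,Y,Z\in\Gamma(A)$ and $f\in C^\infty(M)$: (i) $\alpha[X,Y]=[\alpha X,\alpha Y]$ and $[\alpha X,[Y,Z]]+[\alpha Y,[Z,X]]+[\alpha Z,[X,Y]]=0$; (ii) $[X,fY]=\phi^*(f)[X,Y]+\rho(X)[f]\,\alpha(Y)$; (iii) $\rho(\alpha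 X)\circ\phi^*=\phi^*\circ\rho(X)$ and $\rho([X,Y])\circ\phi^*=\rho(\alpha X)\circ\rho(Y)-\rho(\alpha Y)\circ\rho(X)$ on $C^\infty(M)$. On $\mathfrak{A}=\bigoplus_{n\ge0}\Gamma(\wedge^nA^*)$, with the wedge product, define the degree $0$ map $\hat\alpha(\xi)(x_1,\dots,x_n)=\phi^*\big(\xi(\alpha^{-1}x_1,\dots,\alpha^{-1}x_n)\big)$. An $(\hat\alpha,\hat\alpha)$-differential graded commutative algebra structure on $\mathfrak A$ means that $(\mathfrak A,\wedge)$ is a graded commutative algebra, $\hat\alpha$ is an algebra endomorphism of it, and an $\mathbb{R}$-linear operator $d:\mathfrak A\to\mathfrak A$ of degree $1$ is given with $d^2=0$, $d\hat\alpha=\hat\alpha d$ and $d(\xi\wedge\eta)=d\xi\wedge\hat\alpha(\eta)+(-1)^{|\xi|}\hat\alpha(\xi)\wedge d\eta$. Then there is a bijection between the hom-Lie algebroid structures on $(A,\phi,\alpha)$ and the $(\hat\alpha,\hat\alpha)$-differential graded commutative algebra structures on $\mathfrak A$, given as follows. To a hom-Lie algebroid structure it assigns $d=d_A$, where for $\xi\in\Gamma(\wedge^nA^*)$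 and $x_1,\dots,x_{n+1}\in\Gamma(A)$ $$(d_A\xi)(x_1,\dots,x_{n+1})=\sum_{i=1}^{n+1}(-1)^{i+1}\rho(\alpha^{-1}x_i)\big[\xi(\alpha^{-1}x_1,\dots,\widehat{\alpha^{-1}x_i},\dots,\alpha^{-1}x_{n+1})\big]$$ $$\qquad+\sum_{1\le i<j\le n+1}(-1)^{i+j}\phi^*\big(\xi(\alpha^{-2}[x_i,x_j],\alpha^{-1}x_1,\dots,\widehat{\alpha^{-1}x_i},\dots,\widehat{\alpha^{-1}x_j},\dots,\alpha^{-1}x_{n+1})\big).$$ Its inverse assigns to $d$ the anchor and the bracket determined, for all $x,y\in\Gamma(A)$, $f\in C^\infty(M)$ and $\xi\in\Gamma(A^*)$, by $$\rho(x)[f]=\langle df,\alpha(x)\rangle,$$ $$\langle[x,y],\xi\rangle=\rho(x)\big[\langle\hat\alpha^{-1}(\xi),y\rangle\big]-\rho(y)\big[\langle\hat\alpha^{-1}(\xi),x\rangle\big]-\big(d(\hat\alpha^{-1}(\xi))\big)(\alpha(x),\alpha(y)).$$ -/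

import Mathlib

open scoped Manifold ContDiff Topology Bundle DirectSum
open Bundle Filter

set_option linter.unusedSectionVars false

namespace HomLie

section HomLieAlgebra

variable {g : Type*} [AddCommGroup g] [Module ℝ g] {V : Type*} [AddCommGroup V] [Module ℝ V]

/-- `(g, [-,-], α)` is a hom-Lie algebra over `ℝ`. -/
structure IsHomLieAlgebra (bracket : g →ₗ[ℝ] g →ₗ[ℝ] g) (α : g →ₗ[ℝ] g) : Prop where
  skew : ∀ x y, bracket x y = -bracket y x
  map_bracket : ∀ x y, α (bracket x y) = bracket (α x) (α y)
  jacobi : ∀ x y z, bracket (α x) (bracket y z) + bracket (α y) (bracket z x) +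
    bracket (α z) (bracket x y) = 0

/-- `(ρ, αV)` is a representation of the hom-Lie algebra `(g, [-,-], α)` on `V`. -/
structure IsHomLieRep (bracket : g →ₗ[ℝ] g →ₗ[ℝ] g) (α : g →ₗ[ℝ] g)
    (ρ : g →ₗ[ℝ] Module.End ℝ V) (αV : V →ₗ[ℝ] V) : Prop where
  comm : ∀ x, ρ (α x) ∘ₗ αV = αV ∘ₗ ρ x
  map_bracket : ∀ x y, ρ (bracket x y) ∘ₗ αV = ρ (α x) ∘ₗ ρ y - ρ (α y) ∘ₗ ρ x

end HomLieAlgebra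

section TwistedDGCA

variable {𝔄 : ℕ → Type*} [∀ n, AddCommGroup (𝔄 n)] [∀ n, Module ℝ (𝔄 n)]

/-- The product on `⨁ n, 𝔄 n` induced by products `𝔄 p × 𝔄 q → 𝔄 (p + q)`. -/
noncomputable def totalMul (mul : ∀ p q, 𝔄 p →ₗ[ℝ] 𝔄 q →ₗ[ℝ] 𝔄 (p + q)) :
    (⨁ n, 𝔄 n) →ₗ[ℝ] (⨁ n, 𝔄 n) →ₗ[ℝ] (⨁ n, 𝔄 n) :=
  DirectSum.toModule ℝ ℕ _ fun p => LinearMap.flip <| DirectSum.toModule ℝ ℕ _ fun q =>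
    LinearMap.flip <| (mul p q).compr₂ (DirectSum.lof ℝ ℕ 𝔄 (p + q))

/-- `⨁ n, 𝔄 n` is a (unital, associative) graded commutative algebra. -/
structure IsGradedCommAlgebra (mul : ∀ p q, 𝔄 p →ₗ[ℝ] 𝔄 q →ₗ[ℝ] 𝔄 (p + q)) (one : 𝔄 0) :
    Prop where
  mul_assoc : ∀ a b c, totalMul mul (totalMul mul a b) c = totalMul mul a (totalMul mul b c)
  one_mul : ∀ a, totalMul mul (DirectSum.lof ℝ ℕ 𝔄 0 one) a = a
  mul_one : ∀ a, totalMul mul a (DirectSum.lof ℝ ℕ 𝔄 0 one) = a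
  mul_comm : ∀ p q (a : 𝔄 p) (b : 𝔄 q),
    totalMul mul (DirectSum.lof ℝ ℕ 𝔄 p a) (DirectSum.lof ℝ ℕ 𝔄 q b) =
      (-1 : ℝ) ^ (p * q) • totalMul mul (DirectSum.lof ℝ ℕ 𝔄 q b) (DirectSum.lof ℝ ℕ 𝔄 p a)

/-- The degree `0` map `σ` is an algebra endomorphism of `⨁ n, 𝔄 n`. -/
structure IsGradedEndomorphism (mul : ∀ p q, 𝔄 p →ₗ[ℝ] 𝔄 q →ₗ[ℝ] 𝔄 (p + q)) (one : 𝔄 0)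
    (σ : ∀ n, 𝔄 n →ₗ[ℝ] 𝔄 n) : Prop where
  map_mul : ∀ a b, DirectSum.lmap σ (totalMul mul a b) =
    totalMul mul (DirectSum.lmap σ a) (DirectSum.lmap σ b)
  map_one : σ 0 one = one

/-- A `(σ, τ)`-differential graded commutative algebra structure on the graded algebra
`⨁ n, 𝔄 n` with the given product, unit and degree `0` maps `σ`, `τ`. The only datum is `d`. -/
structure TwistedDGCA (mul : ∀ p q, 𝔄 p →ₗ[ℝ] 𝔄 q →ₗ[ℝ] 𝔄 (p + q)) (one : 𝔄 0)
    (σ τ : ∀ n, 𝔄 n →ₗ[ℝ] 𝔄 n) where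
  isGradedCommAlgebra : IsGradedCommAlgebra mul one
  isEndomorphism_left : IsGradedEndomorphism mul one σ
  isEndomorphism_right : IsGradedEndomorphism mul one τ
  /-- the differential -/
  d : (⨁ n, 𝔄 n) →ₗ[ℝ] (⨁ n, 𝔄 n)
  degree_one : ∀ n (a : 𝔄 n), ∃ b : 𝔄 (n + 1),
    d (DirectSum.lof ℝ ℕ 𝔄 n a) = DirectSum.lof ℝ ℕ 𝔄 (n + 1) b
  sq_zero : d ∘ₗ d = 0
  comm_left : d ∘ₗ DirectSum.lmap σ = DirectSum.lmap σ ∘ₗ d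
  comm_right : d ∘ₗ DirectSum.lmap τ = DirectSum.lmap τ ∘ₗ d
  leibniz : ∀ p (a : 𝔄 p) (b : ⨁ n, 𝔄 n),
    d (totalMul mul (DirectSum.lof ℝ ℕ 𝔄 p a) b) =
      totalMul mul (d (DirectSum.lof ℝ ℕ 𝔄 p a)) (DirectSum.lmap τ b) +
      (-1 : ℝ) ^ p • totalMul mul (DirectSum.lmap σ (DirectSum.lof ℝ ℕ 𝔄 p a)) (d b)

end TwistedDGCA

section HomBundle
variable {E : Type*} [NormedAddCommGroup E] [NormedSpace ℝ E]
  {M : Type*} [TopologicalSpace M] [ChartedSpace E M]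
  {F : Type*} [NormedAddCommGroup F] [NormedSpace ℝ F]
  {A : M → Type*} [∀ m, AddCommGroup (A m)] [∀ m, Module ℝ (A m)] [∀ m, TopologicalSpace (A m)]
  [TopologicalSpace (TotalSpace F A)] [FiberBundle F A] [VectorBundle ℝ F A]

variable (E F A) in
/-- `Γ(A)`: smooth sections of the vector bundle `A → M` (typical fibre `F`). -/
abbrev Sec := Cₛ^∞⟮𝓘(ℝ, E); F, A⟯
variable (E M) in
/-- `C^∞(M)`. -/
abbrev Fn := C^∞⟮𝓘(ℝ, E), M; ℝ⟯

variable (E F A) in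
/-- `Γ(∧ⁿ A*)`: smooth sections of the bundle of alternating `n`-linear forms on the fibres of `A`. -/
abbrev Form (n : ℕ) :=
  Cₛ^∞⟮𝓘(ℝ, E); F [⋀^Fin n]→L[ℝ] ℝ, fun m : M => A m [⋀^Fin n]→L[ℝ] Bundle.Trivial M ℝ m⟯

/-- The `C^∞(M)`-module structure on `Γ(A)`. -/
noncomputable def fmul (f : Fn E M) (X : Sec E F A) : Sec E F A :=
  ⟨fun m => f m • X m, f.contMDiff.smul_section X.contMDiff⟩

variable [FiniteDimensional ℝ E] [FiniteDimensional ℝ F] [T2Space M] [IsManifold 𝓘(ℝ, E) ∞ M]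
  [ContMDiffVectorBundle ∞ F A 𝓘(ℝ, E)]

/-- Extending local sections by a cut-off function. -/
theorem exists_sec (m : M) (s : ∀ x, A x) (u : Set M) (hu : IsOpen u) (hm : m ∈ u)
    (hs : ContMDiffOn 𝓘(ℝ, E) (𝓘(ℝ, E).prod 𝓘(ℝ, F)) ∞ (fun x => TotalSpace.mk' F x (s x)) u) :
    ∃ (f : Fn E M) (X : Sec E F A), (∀ᶠ x in 𝓝 m, f x = 1) ∧ (∀ x, X x = f x • s x) := by
  obtain ⟨ψ, -, hψ⟩ := (SmoothBumpFunction.nhds_basis_tsupport (I := 𝓘(ℝ, E)) m).mem_iff.1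
    (hu.mem_nhds hm)
  exact ⟨⟨ψ, ψ.contMDiff⟩, ⟨fun x => ψ x • s x,
    ContMDiffOn.smul_section_of_tsupport ψ.contMDiff.contMDiffOn hu hψ hs⟩,
    ψ.eventuallyEq_one, fun _ => rfl⟩

/-- The trivializations of the bundle of alternating forms. -/
theorem triv_apply {n : ℕ} (η : ∀ m : M, A m [⋀^Fin n]→L[ℝ] Bundle.Trivial M ℝ m) (m₀ m : M)
    (v : Fin n → F) :
    (trivializationAt (F [⋀^Fin n]→L[ℝ] ℝ)
      (fun m : M => A m [⋀^Fin n]→L[ℝ] Bundle.Trivial M ℝ m) m₀ ⟨m, η m⟩).2 v =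
      (η m (fun i => (trivializationAt F A m₀).symmL ℝ m (v i)) : ℝ) := by
  rw [FiberBundle.trivializationAt_continuousAlternatingMap_apply]
  simp [ContinuousAlternatingMap.inCoordinates, Function.comp_def]

theorem eval_smooth {n : ℕ} (ξ : Form E F A n) (X : Fin n → Sec E F A) :
   ContMDiff 𝓘(ℝ, E) 𝓘(ℝ, ℝ) ∞ (fun m => (ξ m (fun i => X i m) : ℝ)) := by
  intro m0
  have h := (contMDiffAt_section m0).1 (ξ.contMDiff m0)
  have hX := fun i => (contMDiffAt_section m0).1 ((X i).contMDiff m0)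
  let b := Module.finBasis ℝ F
  have key : ∀ᶠ m in 𝓝 m0, (ξ m (fun i => X i m) : ℝ) = ∑ r : Fin n → Fin (Module.finrank ℝ F),
      (∏ i, (b.coord (r i)).toContinuousLinearMap (trivializationAt F A m0 ⟨m, X i m⟩).2) *
       (ContinuousAlternatingMap.apply ℝ F ℝ (fun i => b (r i))
        (trivializationAt (F [⋀^Fin n]→L[ℝ] ℝ)
          (fun m : M => A m [⋀^Fin n]→L[ℝ] Bundle.Trivial M ℝ m) m0 ⟨m, ξ m⟩).2) := by
    filter_upwards [(trivializationAt F A m0).open_baseSet.mem_nhds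
      (FiberBundle.mem_baseSet_trivializationAt' m0)] with m hm
    have hx : ∀ i, X i m = ∑ j, b.coord j (trivializationAt F A m0 ⟨m, X i m⟩).2 •
        (trivializationAt F A m0).symmL ℝ m (b j) := by
      intro i
      have e0 := (trivializationAt F A m0).symmL_continuousLinearMapAt (R := ℝ) hm (X i m)
      rw [Trivialization.continuousLinearMapAt_apply_of_mem _ _ hm] at e0
      conv_lhs => rw [← e0]
      conv_lhs => rw [← b.sum_repr (trivializationAt F A m0 ⟨m, X i m⟩).2]
      rw [map_sum]
      simp
    have hy : (fun i => X i m) = fun i => ∑ j, b.coord j (trivializationAt F A m0 ⟨m, X i m⟩).2 •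
        (trivializationAt F A m0).symmL ℝ m (b j) := funext hx
    rw [hy]
    have e1 := (ξ m).toMultilinearMap.map_sum
      (fun i j => b.coord j (trivializationAt F A m0 ⟨m, X i m⟩).2 •
        (trivializationAt F A m0).symmL ℝ m (b j))
    refine Eq.trans e1 (Finset.sum_congr rfl fun r _ => ?_)
    refine Eq.trans ((ξ m).toMultilinearMap.map_smul_univ _ _) ?_
    have := triv_apply (fun m => ξ m) m0 m (fun i => b (r i))
    simp only [ContinuousAlternatingMap.apply_apply, this]
    rfl
  refine ContMDiffAt.congr_of_eventuallyEq ?_ key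
  refine ContMDiffAt.sum fun r _ => ContMDiffAt.mul (ContMDiffAt.prod fun i _ => ?_) ?_
  · exact (ContinuousLinearMap.contMDiff _).contMDiffAt.comp m0 (hX i)
  · exact (ContinuousLinearMap.contMDiff _).contMDiffAt.comp m0 h

/-- A family of alternating forms on the fibres is smooth once its values on smooth sections are. -/
theorem form_smooth {n : ℕ} (η : ∀ m : M, A m [⋀^Fin n]→L[ℝ] Bundle.Trivial M ℝ m)
    (hη : ∀ X : Fin n → Sec E F A,
      ContMDiff 𝓘(ℝ, E) 𝓘(ℝ, ℝ) ∞ (fun m => (η m (fun i => X i m) : ℝ))) :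
    ContMDiff 𝓘(ℝ, E) (𝓘(ℝ, E).prod 𝓘(ℝ, F [⋀^Fin n]→L[ℝ] ℝ)) ∞
      (fun m => TotalSpace.mk' (F [⋀^Fin n]→L[ℝ] ℝ) m (η m)) := by
  intro m0
  rw [contMDiffAt_section]
  let b := Module.finBasis ℝ F
  let Φ : (F [⋀^Fin n]→L[ℝ] ℝ) →ₗ[ℝ] ((Fin n → Fin (Module.finrank ℝ F)) → ℝ) :=
    { toFun := fun f r => f (fun i => b (r i))
      map_add' := fun _ _ => rfl
      map_smul' := fun _ _ => rfl }
  have hΦ : LinearMap.ker Φ = ⊥ := by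
    rw [LinearMap.ker_eq_bot]
    intro f g hfg
    apply ContinuousAlternatingMap.toAlternatingMap_injective
    apply AlternatingMap.coe_multilinearMap_injective
    exact Module.Basis.ext_multilinear (fun _ => b) fun r => congrFun hfg r
  obtain ⟨L, hL⟩ := Φ.exists_leftInverse_of_injective hΦ
  have hrec : (fun m => (trivializationAt (F [⋀^Fin n]→L[ℝ] ℝ)
      (fun m : M => A m [⋀^Fin n]→L[ℝ] Bundle.Trivial M ℝ m) m0 ⟨m, η m⟩).2) =
      fun m => L.toContinuousLinearMap (fun r : Fin n → Fin (Module.finrank ℝ F) =>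
        (η m (fun i => (trivializationAt F A m0).symmL ℝ m (b (r i))) : ℝ)) := by
    funext m
    have h1 : (fun r : Fin n → Fin (Module.finrank ℝ F) =>
        (η m (fun i => (trivializationAt F A m0).symmL ℝ m (b (r i))) : ℝ)) =
        Φ (trivializationAt (F [⋀^Fin n]→L[ℝ] ℝ)
      (fun m : M => A m [⋀^Fin n]→L[ℝ] Bundle.Trivial M ℝ m) m0 ⟨m, η m⟩).2 :=
      funext fun r => (triv_apply η m0 m _).symm
    rw [h1]
    exact (LinearMap.congr_fun hL _).symm
  rw [hrec]
  refine (ContinuousLinearMap.contMDiff _).contMDiffAt.comp m0 ?_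
  rw [contMDiffAt_pi_space]
  intro r
  have hm0 := FiberBundle.mem_baseSet_trivializationAt' (F := F) (E := A) m0
  choose f X hf hX using fun i : Fin n => exists_sec (E := E) (F := F) m0
    ((trivializationAt F A m0).localFrame b (r i)) _ (trivializationAt F A m0).open_baseSet hm0
    (Trivialization.contMDiffOn_localFrame_baseSet (I := 𝓘(ℝ, E)) ∞ _ b (r i))
  refine ((hη X) m0).congr_of_eventuallyEq ?_
  filter_upwards [Filter.eventually_all.2 hf, (trivializationAt F A m0).open_baseSet.mem_nhds
      hm0] with m h1 h2
  congr 1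
  funext i
  rw [hX, h1, one_smul, Trivialization.localFrame_apply_of_mem_baseSet _ _ h2]
  simp only [Trivialization.basisAt]
  exact Trivialization.symmL_apply (R := ℝ) _ h2 _

/-- The function `ξ(X₁, …, Xₙ)`. -/
noncomputable def ev {n : ℕ} (ξ : Form E F A n) (X : Fin n → Sec E F A) : Fn E M :=
  ⟨fun m => ξ m (fun i => X i m), eval_smooth ξ X⟩

theorem exists_sec_through (m : M) (v : A m) : ∃ X : Sec E F A, X m = v := by
  let b := Module.finBasis ℝ F
  have hm := FiberBundle.mem_baseSet_trivializationAt' (F := F) (E := A) m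
  choose f X hf hX using fun i => exists_sec (E := E) (F := F) m
    ((trivializationAt F A m).localFrame b i) _ (trivializationAt F A m).open_baseSet hm
    (Trivialization.contMDiffOn_localFrame_baseSet (I := 𝓘(ℝ, E)) ∞ _ b i)
  let c := (trivializationAt F A m).basisAt b hm
  refine ⟨∑ i, c.repr v i • X i, ?_⟩
  have h : (⇑(∑ i, c.repr v i • X i) : ∀ x, A x) m = ∑ i, c.repr v i • X i m := by
    rw [← ContMDiffSection.coeAddHom_apply, map_sum, Finset.sum_apply]
    rfl
  rw [h]
  conv_rhs => rw [← c.sum_repr v]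
  refine Finset.sum_congr rfl fun i _ => ?_
  rw [hX, (hf i).self_of_nhds, one_smul, Trivialization.localFrame_apply_of_mem_baseSet _ _ hm]

theorem form_ext {n : ℕ} {ξ η : Form E F A n} (h : ∀ X, ev ξ X = ev η X) : ξ = η := by
  ext m v
  choose X hX using fun i => exists_sec_through (E := E) (F := F) m (v i)
  have := DFunLike.congr_fun (h X) m
  have hv : v = fun i => X i m := funext fun i => (hX i).symm
  rw [hv]
  exact this

/-- A section vanishing at `m` is a finite combination `∑ fᵢ Xᵢ` with `fᵢ m = 0`. -/
theorem exists_decomp (m : M) (X : Sec E F A) (hX : X m = 0) :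
    ∃ (k : ℕ) (f : Fin k → Fn E M) (Y : Fin k → Sec E F A), (∀ i, f i m = 0) ∧
      X = ∑ i, fmul (f i) (Y i) := by
  let b := Module.finBasis ℝ F
  let e := trivializationAt F A m
  have hm : m ∈ e.baseSet := FiberBundle.mem_baseSet_trivializationAt' (F := F) (E := A) m
  obtain ⟨ψ, -, hψ⟩ := (SmoothBumpFunction.nhds_basis_tsupport (I := 𝓘(ℝ, E)) m).mem_iff.1
    (e.open_baseSet.mem_nhds hm)
  let Y : Fin (Module.finrank ℝ F) → Sec E F A := fun i => ⟨fun x => ψ x • e.localFrame b i x,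
    ContMDiffOn.smul_section_of_tsupport ψ.contMDiff.contMDiffOn e.open_baseSet hψ
      (Trivialization.contMDiffOn_localFrame_baseSet (I := 𝓘(ℝ, E)) ∞ _ b i)⟩
  let c : Fin (Module.finrank ℝ F) → Fn E M := fun i =>
    ⟨fun x => ψ x • e.localFrameCoeff 𝓘(ℝ, E) b i x (X x), by
      refine contMDiff_of_tsupport fun x hx => ?_
      have hx' : x ∈ e.baseSet := hψ (closure_mono (fun y hy => ?_) hx)
      · exact ψ.contMDiff.contMDiffAt.smul
          (contMDiffAt_localFrameCoeff b hx' (X.contMDiff x) i)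
      · intro h
        apply hy
        simp [h]⟩
  refine ⟨Module.finrank ℝ F + 1, Fin.cons ⟨fun x => 1 - ψ x * ψ x, by
    exact contMDiff_const.sub (ψ.contMDiff.mul ψ.contMDiff)⟩ c, Fin.cons X Y, ?_, ?_⟩
  · intro i
    refine Fin.cases ?_ (fun i => ?_) i
    · change 1 - ψ m * ψ m = 0
      rw [ψ.eq_one]; norm_num
    · change ψ m • e.localFrameCoeff 𝓘(ℝ, E) b i m (X m) = 0
      rw [hX, map_zero, smul_zero]
  · ext x
    have h : (⇑(∑ i : Fin (Module.finrank ℝ F + 1), fmul ((Fin.cons ⟨fun x => 1 - ψ x * ψ x, by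
    exact contMDiff_const.sub (ψ.contMDiff.mul ψ.contMDiff)⟩ c : Fin (Module.finrank ℝ F + 1) → Fn E M) i)
      ((Fin.cons X Y : Fin (Module.finrank ℝ F + 1) → Sec E F A) i)) : ∀ x, A x) x =
        (1 - ψ x * ψ x) • X x + ∑ i, (ψ x • e.localFrameCoeff 𝓘(ℝ, E) b i x (X x)) •
          (ψ x • e.localFrame b i x) := by
      rw [← ContMDiffSection.coeAddHom_apply, map_sum, Finset.sum_apply, Fin.sum_univ_succ]
      rfl
    rw [h]
    by_cases hx : x ∈ e.baseSet
    · have h2 := e.eq_sum_localFrameCoeff_smul (I := 𝓘(ℝ, E)) (s := fun x => X x) (b := b) hx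
      have h3 : ∑ i, (ψ x • e.localFrameCoeff 𝓘(ℝ, E) b i x (X x)) •
          (ψ x • e.localFrame b i x) = (ψ x * ψ x) • X x := by
        conv_rhs => rw [h2, Finset.smul_sum]
        refine Finset.sum_congr rfl fun i _ => ?_
        simp only [smul_smul, smul_eq_mul]
        congr 1
        ring
      rw [h3, ← add_smul]
      simp
    · have : ψ x = 0 := by
        by_contra h0
        exact hx (hψ (subset_tsupport _ h0))
      simp [this]

/-- `φ* : C^∞(M) → C^∞(M)`, `f ↦ f ∘ φ`. -/
noncomputable def pull (φ : C^∞⟮𝓘(ℝ, E), M; 𝓘(ℝ, E), M⟯) : Fn E M →ₗ[ℝ] Fn E M where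
  toFun f := f.comp φ
  map_add' _ _ := rfl
  map_smul' _ _ := rfl

/-- `(A, φ, α)` is a hom-bundle: `α (f X) = φ*(f) α(X)`. -/
def IsHomBundle (φ : C^∞⟮𝓘(ℝ, E), M; 𝓘(ℝ, E), M⟯) (α : Sec E F A →ₗ[ℝ] Sec E F A) : Prop :=
  ∀ (f : Fn E M) (X : Sec E F A), α (fmul f X) = fmul (pull φ f) (α X)

theorem IsHomBundle.symm {φ : M ≃ₘ^∞⟮𝓘(ℝ, E), 𝓘(ℝ, E)⟯ M} {α : Sec E F A ≃ₗ[ℝ] Sec E F A}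
    (h : IsHomBundle (φ : C^∞⟮𝓘(ℝ, E), M; 𝓘(ℝ, E), M⟯) (α : Sec E F A →ₗ[ℝ] Sec E F A)) :
    IsHomBundle (φ.symm : C^∞⟮𝓘(ℝ, E), M; 𝓘(ℝ, E), M⟯)
      (α.symm : Sec E F A →ₗ[ℝ] Sec E F A) := by
  intro f X
  apply α.injective
  have h1 := h (pull (φ.symm : C^∞⟮𝓘(ℝ, E), M; 𝓘(ℝ, E), M⟯) f) (α.symm X)
  simp only [LinearEquiv.coe_coe, LinearEquiv.apply_symm_apply] at h1 ⊢
  rw [h1]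
  ext m
  change f m • X m = f (φ.symm (φ m)) • X m
  rw [φ.symm_apply_apply]

theorem IsHomBundle.apply_eq_zero {ψ : C^∞⟮𝓘(ℝ, E), M; 𝓘(ℝ, E), M⟯}
    {β : Sec E F A →ₗ[ℝ] Sec E F A} (h : IsHomBundle ψ β) {y m : M} (hy : ψ y = m)
    {X : Sec E F A} (hX : X m = 0) : β X y = 0 := by
  obtain ⟨k, f, Y, hf, rfl⟩ := exists_decomp m X hX
  rw [map_sum, ← ContMDiffSection.coeAddHom_apply, map_sum, Finset.sum_apply]
  refine Finset.sum_eq_zero fun i _ => ?_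
  rw [ContMDiffSection.coeAddHom_apply, h]
  change f i (ψ y) • β (Y i) y = 0
  rw [hy, hf, zero_smul]

/-- For a hom-bundle `(A, ψ, β)`, the map `A_{ψ y} → A_y` with `X (ψ y) ↦ (β X) y`. -/
noncomputable def fiberMap {ψ : C^∞⟮𝓘(ℝ, E), M; 𝓘(ℝ, E), M⟯} {β : Sec E F A →ₗ[ℝ] Sec E F A}
    (h : IsHomBundle ψ β) {y m : M} (hy : ψ y = m) : A m →L[ℝ] A y :=
  have : T2Space (A m) := FiberBundle.t2Space F A m
  have : FiniteDimensional ℝ (A m) := VectorBundle.finiteDimensional ℝ F A m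
  have (x : M) : IsTopologicalAddGroup (A x) :=
    (VectorBundle.continuousLinearEquivAt ℝ F A x).toContinuousAddEquiv.isTopologicalAddGroup
  have (x : M) : ContinuousSMul ℝ (A x) :=
    (VectorBundle.continuousLinearEquivAt ℝ F A x).continuousSMul
  LinearMap.toContinuousLinearMap
    { toFun := fun v => β (exists_sec_through (E := E) (F := F) m v).choose y
      map_add' := fun v w => by
        have h0 := h.apply_eq_zero hy (X := (exists_sec_through (E := E) (F := F) m (v + w)).choose -
          ((exists_sec_through (E := E) (F := F) m v).choose +
            (exists_sec_through (E := E) (F := F) m w).choose)) (by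
          simp [(exists_sec_through (E := E) (F := F) m _).choose_spec])
        rw [map_sub, map_add] at h0
        exact sub_eq_zero.1 h0
      map_smul' := fun c v => by
        have h0 := h.apply_eq_zero hy (X := (exists_sec_through (E := E) (F := F) m (c • v)).choose -
          c • (exists_sec_through (E := E) (F := F) m v).choose) (by
          simp [(exists_sec_through (E := E) (F := F) m _).choose_spec])
        rw [map_sub, map_smul] at h0
        exact sub_eq_zero.1 h0 }

theorem fiberMap_apply {ψ : C^∞⟮𝓘(ℝ, E), M; 𝓘(ℝ, E), M⟯} {β : Sec E F A →ₗ[ℝ] Sec E F A}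
    (h : IsHomBundle ψ β) {y m : M} (hy : ψ y = m) (X : Sec E F A) :
    fiberMap h hy (X m) = β X y := by
  have h0 := h.apply_eq_zero hy (X := (exists_sec_through (E := E) (F := F) m (X m)).choose - X) (by
    simp [(exists_sec_through (E := E) (F := F) m _).choose_spec])
  rw [map_sub] at h0
  exact sub_eq_zero.1 h0

section Hat
theorem coe_symm_apply (φ : M ≃ₘ^∞⟮𝓘(ℝ, E), 𝓘(ℝ, E)⟯ M) (m : M) :
    (φ.symm : C^∞⟮𝓘(ℝ, E), M; 𝓘(ℝ, E), M⟯) (φ m) = m := φ.symm_apply_apply m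

variable {φ : M ≃ₘ^∞⟮𝓘(ℝ, E), 𝓘(ℝ, E)⟯ M} {α : Sec E F A ≃ₗ[ℝ] Sec E F A}

theorem hat_eval (h : IsHomBundle (φ : C^∞⟮𝓘(ℝ, E), M; 𝓘(ℝ, E), M⟯)
      (α : Sec E F A →ₗ[ℝ] Sec E F A)) {n : ℕ} (ξ : Form E F A n) (X : Fin n → Sec E F A) (m : M) :
    (((ξ (φ m)).compContinuousLinearMap (fiberMap h.symm (coe_symm_apply φ m))) (fun i => X i m) : ℝ) =
      ev ξ (fun i => α.symm (X i)) (φ m) := by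
  change (ξ (φ m)) (fun i => fiberMap h.symm (coe_symm_apply φ m) (X i m)) = _
  simp only [fiberMap_apply]
  rfl

/-- The map `α̂` as a linear map; its defining formula is `ev_hatMap`. -/
noncomputable def hatMap (h : IsHomBundle (φ : C^∞⟮𝓘(ℝ, E), M; 𝓘(ℝ, E), M⟯)
      (α : Sec E F A →ₗ[ℝ] Sec E F A)) (n : ℕ) : Form E F A n →ₗ[ℝ] Form E F A n where
  toFun ξ := ⟨fun m => (ξ (φ m)).compContinuousLinearMap
      (fiberMap h.symm (coe_symm_apply φ m)), form_smooth _ fun X => by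
        exact ((ev ξ fun i => α.symm (X i)).contMDiff.comp φ.contMDiff).congr
          fun m => hat_eval h ξ X m⟩
  map_add' _ _ := rfl
  map_smul' _ _ := rfl

/-- `α̂(ξ)(X₁, …, Xₙ) = φ*(ξ(α⁻¹ X₁, …, α⁻¹ Xₙ))`. -/
theorem ev_hatMap (h : IsHomBundle (φ : C^∞⟮𝓘(ℝ, E), M; 𝓘(ℝ, E), M⟯)
      (α : Sec E F A →ₗ[ℝ] Sec E F A)) {n : ℕ} (ξ : Form E F A n) (X : Fin n → Sec E F A) :
    ev (hatMap h n ξ) X = pull φ (ev ξ fun i => α.symm (X i)) := by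
  ext m
  exact hat_eval h ξ X m

/-- `α̂` on `Γ(∧ⁿ A*)`, for a regular hom-bundle, with inverse given by `φ⁻¹` and `α⁻¹`. -/
noncomputable def hat (h : IsHomBundle (φ : C^∞⟮𝓘(ℝ, E), M; 𝓘(ℝ, E), M⟯)
      (α : Sec E F A →ₗ[ℝ] Sec E F A)) (n : ℕ) : Form E F A n ≃ₗ[ℝ] Form E F A n :=
  LinearEquiv.ofLinearMap (hatMap h n) (hatMap h.symm n)
    (by
      refine LinearMap.ext fun ξ => form_ext fun X => ?_
      ext m
      simp only [LinearMap.comp_apply, ev_hatMap, LinearMap.id_apply]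
      change ev ξ (fun i => α (α.symm (X i))) (φ.symm (φ m)) = _
      simp)
    (by
      refine LinearMap.ext fun ξ => form_ext fun X => ?_
      ext m
      simp only [LinearMap.comp_apply, ev_hatMap, LinearMap.id_apply]
      change ev ξ (fun i => α.symm (α (X i))) (φ (φ.symm m)) = _
      simp)
end Hat

section Wedge

/-- The wedge product of alternating forms, as a sum over shuffles (without factorials). -/
noncomputable def altWedgeAux {V : Type*} [AddCommGroup V] [Module ℝ V]
    {p q : ℕ} (a : V [⋀^Fin p]→ₗ[ℝ] ℝ) (b : V [⋀^Fin q]→ₗ[ℝ] ℝ) : V [⋀^Fin (p + q)]→ₗ[ℝ] ℝ :=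
  ((LinearMap.mul' ℝ ℝ).compAlternatingMap (a.domCoprod b)).domDomCongr finSumFinEquiv

theorem altWedgeAux_apply {V : Type*} [AddCommGroup V] [Module ℝ V]
    {p q : ℕ} (a : V [⋀^Fin p]→ₗ[ℝ] ℝ) (b : V [⋀^Fin q]→ₗ[ℝ] ℝ) (v : Fin (p + q) → V) :
    altWedgeAux a b v = ∑ σ : Equiv.Perm.ModSumCongr (Fin p) (Fin q),
      ((Equiv.Perm.sign σ.out : ℤ) : ℝ) *
      (a (fun i => v (finSumFinEquiv (σ.out (Sum.inl i)))) *
       b (fun j => v (finSumFinEquiv (σ.out (Sum.inr j))))) := by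
  simp only [altWedgeAux, AlternatingMap.domDomCongr_apply,
    LinearMap.compAlternatingMap_apply, AlternatingMap.domCoprod_apply, sum_apply, map_sum]
  refine Finset.sum_congr rfl fun σ _ => ?_
  conv_lhs => rw [← Quotient.out_eq' σ]
  rw [AlternatingMap.domCoprod.summand_mk'']
  rw [Units.smul_def]
  change (LinearMap.mul' ℝ ℝ) (((Equiv.Perm.sign (Quotient.out σ) : ℤˣ) : ℤ) •
    (MultilinearMap.domDomCongr (Quotient.out σ) (MultilinearMap.domCoprod a.toMultilinearMap
      b.toMultilinearMap)) (v ∘ ⇑finSumFinEquiv)) = _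
  rw [map_zsmul, zsmul_eq_mul]
  rfl

/-- The wedge product of continuous alternating forms. -/
noncomputable def altWedge {V : Type*} [AddCommGroup V] [Module ℝ V] [TopologicalSpace V]
    {p q : ℕ} (a : V [⋀^Fin p]→L[ℝ] ℝ) (b : V [⋀^Fin q]→L[ℝ] ℝ) : V [⋀^Fin (p + q)]→L[ℝ] ℝ :=
  { altWedgeAux a.toAlternatingMap b.toAlternatingMap with
    cont := by
      change Continuous fun v => altWedgeAux a.toAlternatingMap b.toAlternatingMap v
      simp only [altWedgeAux_apply]
      refine continuous_finsetSum _ fun σ _ => continuous_const.mul (Continuous.mul ?_ ?_)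
      · exact a.cont.comp (continuous_pi fun i => continuous_apply _)
      · exact b.cont.comp (continuous_pi fun i => continuous_apply _) }

/-- The fibrewise wedge product of sections. -/
noncomputable def wedgeFun {p q : ℕ} (ξ : Form E F A p) (η : Form E F A q) : Form E F A (p + q) :=
  ⟨fun m => altWedge (V := A m) (ξ m) (η m), form_smooth _ fun X => by
    have : (fun m => (altWedge (V := A m) (ξ m) (η m) (fun i => X i m) : ℝ)) = fun m =>
      ∑ σ : Equiv.Perm.ModSumCongr (Fin p) (Fin q),
      ((Equiv.Perm.sign σ.out : ℤ) : ℝ) *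
      (ev ξ (fun i => X (finSumFinEquiv (σ.out (Sum.inl i)))) m *
       ev η (fun j => X (finSumFinEquiv (σ.out (Sum.inr j)))) m) :=
      funext fun m => altWedgeAux_apply _ _ _
    exact this ▸ contMDiff_finsetSum fun σ _ =>
      contMDiff_const.mul ((ev ξ _).contMDiff.mul (ev η _).contMDiff)⟩

theorem ev_wedgeFun {p q : ℕ} (ξ : Form E F A p) (η : Form E F A q)
    (X : Fin (p + q) → Sec E F A) (m : M) :
    ev (wedgeFun ξ η) X m = ∑ σ : Equiv.Perm.ModSumCongr (Fin p) (Fin q),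
      ((Equiv.Perm.sign σ.out : ℤ) : ℝ) *
      (ev ξ (fun i => X (finSumFinEquiv (σ.out (Sum.inl i)))) m *
       ev η (fun j => X (finSumFinEquiv (σ.out (Sum.inr j)))) m) :=
  altWedgeAux_apply _ _ _

/-- The wedge product `Γ(∧ᵖ A*) × Γ(∧^q A*) → Γ(∧^{p+q} A*)`. -/
noncomputable def wedge (p q : ℕ) : Form E F A p →ₗ[ℝ] Form E F A q →ₗ[ℝ] Form E F A (p + q) :=
  LinearMap.mk₂ ℝ wedgeFun
    (fun ξ ξ' η => form_ext fun X => by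
      ext m
      change _ = ev (wedgeFun ξ η) X m + ev (wedgeFun ξ' η) X m
      simp only [ev_wedgeFun, ← Finset.sum_add_distrib]
      refine Finset.sum_congr rfl fun σ _ => ?_
      change _ * ((ev ξ _ m + ev ξ' _ m) * _) = _
      ring)
    (fun c ξ η => form_ext fun X => by
      ext m
      change _ = c * ev (wedgeFun ξ η) X m
      simp only [ev_wedgeFun, Finset.mul_sum]
      refine Finset.sum_congr rfl fun σ _ => ?_
      change _ * ((c * ev ξ _ m) * _) = _
      ring)
    (fun ξ η η' => form_ext fun X => by
      ext m
      change _ = ev (wedgeFun ξ η) X m + ev (wedgeFun ξ η') X m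
      simp only [ev_wedgeFun, ← Finset.sum_add_distrib]
      refine Finset.sum_congr rfl fun σ _ => ?_
      change _ * (_ * (ev η _ m + ev η' _ m)) = _
      ring)
    (fun c ξ η => form_ext fun X => by
      ext m
      change _ = c * ev (wedgeFun ξ η) X m
      simp only [ev_wedgeFun, Finset.mul_sum]
      refine Finset.sum_congr rfl fun σ _ => ?_
      change _ * (_ * (c * ev η _ m)) = _
      ring)
end Wedge

section Anchor
variable (F A) in
/-- A bundle map `φ^!A → φ^!TM` over the identity of `M`: a smooth map of total spaces that is
linear on the fibres. -/
structure Anchor (φ : C^∞⟮𝓘(ℝ, E), M; 𝓘(ℝ, E), M⟯) where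
  /-- the map on fibres -/
  toFun : ∀ m : M, A (φ m) →ₗ[ℝ] TangentSpace 𝓘(ℝ, E) (φ m)
  smooth : ContMDiff (𝓘(ℝ, E).prod 𝓘(ℝ, F)) (𝓘(ℝ, E).prod 𝓘(ℝ, E)) ∞
    (fun p : TotalSpace F (φ *ᵖ A) =>
      (⟨p.1, toFun p.1 p.2⟩ : TotalSpace E (φ *ᵖ (TangentSpace 𝓘(ℝ, E) : M → Type _))))

theorem Anchor.deriv_smooth {φ : C^∞⟮𝓘(ℝ, E), M; 𝓘(ℝ, E), M⟯} (ρ : Anchor F A φ)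
    (X : Sec E F A) (f : Fn E M) : ContMDiff 𝓘(ℝ, E) 𝓘(ℝ, ℝ) ∞
    (fun m => (mfderiv 𝓘(ℝ, E) 𝓘(ℝ, ℝ) f (φ m) (ρ.toFun m (X (φ m))) : ℝ)) := by
  have h1 : ContMDiff 𝓘(ℝ, E) (𝓘(ℝ, E).prod 𝓘(ℝ, F)) ∞
      (fun m => (⟨m, X (φ m)⟩ : TotalSpace F (φ *ᵖ A))) := by
    intro m
    rw [contMDiffAt_totalSpace]
    refine ⟨contMDiffAt_id, ?_⟩
    have := (contMDiffAt_totalSpace.1 (X.contMDiff (φ m))).2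
    exact this.comp m (φ.contMDiff m)
  have h2 := ρ.smooth.comp h1
  have h3 : ContMDiff 𝓘(ℝ, E) (𝓘(ℝ, E).prod 𝓘(ℝ, E)) ∞
      (fun m => (⟨φ m, ρ.toFun m (X (φ m))⟩ : TangentBundle 𝓘(ℝ, E) M)) := by
    intro m
    rw [contMDiffAt_totalSpace]
    exact ⟨φ.contMDiff m, (contMDiffAt_totalSpace.1 (h2 m)).2⟩
  have h4 := (f.contMDiff.contMDiff_tangentMap (m := ∞) (by simp)).comp h3
  exact (contMDiff_snd_tangentBundle_modelSpace ℝ 𝓘(ℝ, ℝ)).comp h4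

/-- `ρ(X)[f] (m) = ⟨d_{φ(m)} f, ρ_m (X_{φ(m)})⟩`. -/
noncomputable def Anchor.deriv {φ : C^∞⟮𝓘(ℝ, E), M; 𝓘(ℝ, E), M⟯} (ρ : Anchor F A φ) :
    Sec E F A →ₗ[ℝ] Module.End ℝ (Fn E M) :=
  LinearMap.mk₂ ℝ (fun X f => ⟨_, ρ.deriv_smooth X f⟩)
    (fun X Y f => by
      ext m
      change mfderiv _ _ _ _ (ρ.toFun m (X (φ m) + Y (φ m))) = _
      rw [map_add, map_add]; rfl)
    (fun c X f => by
      ext m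
      change mfderiv _ _ _ _ (ρ.toFun m (c • X (φ m))) = _
      rw [map_smul, map_smul]; rfl)
    (fun X f g => by
      ext m
      change mfderiv _ _ (⇑f + ⇑g) _ _ = _
      rw [mfderiv_add (f.contMDiff.mdifferentiableAt (by simp))
        (g.contMDiff.mdifferentiableAt (by simp))]; rfl)
    (fun c X f => by
      ext m
      change mfderiv _ _ (c • ⇑f) _ _ = _
      rw [const_smul_mfderiv (f.contMDiff.mdifferentiableAt (by simp))]; rfl)
end Anchor

section Structures

variable (E F A) in
/-- A function, regarded as an element of `Γ(∧⁰ A*)`. -/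
noncomputable def ofFn (f : Fn E M) : Form E F A 0 :=
  ⟨fun m => ContinuousAlternatingMap.constOfIsEmpty ℝ (A m) (Fin 0) (f m),
    form_smooth _ fun _ => f.contMDiff⟩

/-- A hom-Lie algebroid structure on `(A, φ, α)`: a bracket on `Γ(A)` and an anchor
`φ^!A → φ^!TM`. -/
structure HomLieAlgebroid (φ : C^∞⟮𝓘(ℝ, E), M; 𝓘(ℝ, E), M⟯)
    (α : Sec E F A →ₗ[ℝ] Sec E F A) where
  /-- the bracket -/
  bracket : Sec E F A →ₗ[ℝ] Sec E F A →ₗ[ℝ] Sec E F A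
  /-- the anchor -/
  anchor : Anchor F A φ
  isHomBundle : IsHomBundle φ α
  isHomLieAlgebra : IsHomLieAlgebra bracket α
  leibniz : ∀ (X Y : Sec E F A) (f : Fn E M),
    bracket X (fmul f Y) = fmul (pull φ f) (bracket X Y) + fmul (anchor.deriv X f) (α Y)
  isHomLieRep : IsHomLieRep bracket α anchor.deriv (pull φ)

/-- The value `(d_A ξ)(x₀, …, xₙ)` of the twisted Chevalley–Eilenberg differential. Indices start
at `0`, which does not change the signs. In the second sum, `i.castSucc < j` are the two omitted
indices, and `l ↦ j.succAbove (i.succAbove l)` enumerates the others in increasing order. -/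
noncomputable def ceValue {φ : C^∞⟮𝓘(ℝ, E), M; 𝓘(ℝ, E), M⟯} {α : Sec E F A ≃ₗ[ℝ] Sec E F A}
    (𝒜 : HomLieAlgebroid φ (α : Sec E F A →ₗ[ℝ] Sec E F A)) :
    ∀ n : ℕ, Form E F A n → (Fin (n + 1) → Sec E F A) → Fn E M
  | 0, ξ, x => 𝒜.anchor.deriv (α.symm (x 0)) (ev ξ Fin.elim0)
  | k + 1, ξ, x =>
    ∑ i : Fin (k + 2), (-1 : ℝ) ^ (i : ℕ) •
      𝒜.anchor.deriv (α.symm (x i)) (ev ξ fun l => α.symm (x (i.succAbove l))) +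
    ∑ j : Fin (k + 2), ∑ i : Fin (k + 1), if i.castSucc < j then
      (-1 : ℝ) ^ ((i : ℕ) + (j : ℕ)) •
        pull φ (ev ξ (Fin.cons (α.symm (α.symm (𝒜.bracket (x i.castSucc) (x j))))
          fun l => α.symm (x (j.succAbove (i.succAbove l)))))
      else 0

end Structures

end HomBundle

end HomLie

/-! Invertibility of `α` and `φ` removes the twist on both sides. For a hom-Lie algebroid, the
bracket `α⁻¹[·,·]` and the anchor `(φ*)⁻¹ρ` form an ordinary Lie algebroid, here a Lie–Rinehart
structure on Γ(A) over C^∞(M), of which `(α, φ*)` is an automorphism (`untwistEquiv`). For a twisted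
differential `d`, the operator `α̂⁻¹d` is an ordinary square-zero derivation of degree one commuting
with `α̂` (`twistedEquiv`). What remains is an equivariant version of the classical correspondence
between Lie algebroid structures and homological derivations of the algebra of forms
(`lieRinehartEquiv`).

The classical correspondence is proved in an abstract calculus, `Contraction`, where a form of
positive degree is known through its contractions `ι_x`. Cartan's formulas `ι_y L_x = L_x ι_y -
ι_[x,y]` and `ι_x d = L_x - d ι_x` serve as recursive definitions of `L` and `d`, and identities are
checked by induction on the degree, because a form vanishes once its scalar part and all its
contractions do (`tot_ext`). Conversely, a derivation `D` gives `L_x = [ι_x, D]`, an anchor through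
its values on functions and a bracket through the Koszul formula on one-forms. The key point is
`[L_x, ι_y] = ι_[x,y]` (`defect_eq_zero`): the difference of the two sides is an antiderivation
vanishing on functions and one-forms, and these generate all forms locally. Existence of the bracket
and the local generation are supplied by `IsReflexive`.

The geometric input is that forms on `A` satisfy these axioms (`formContraction`, `wedge_isWedge`,
`formContraction_isReflexive`), and that derivations at a point are tangent vectors
(`exists_tangentDeriv`), so that an algebraic anchor is a smooth bundle map (`anchorOf`). Unrolling
the Cartan recursion yields the Chevalley–Eilenberg formula (`eval_diff_succ`); applying `α̂` to it
inserts `φ*` and the powers of `α⁻¹`. -/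

namespace HomLie

/-! ### Contraction as an antiderivation of the wedge product on a vector space. -/

section WedgeContraction

open Equiv

variable {V : Type*} [AddCommGroup V] [Module ℝ V]

/-- Expanding a signed sum over permutations of `Fin (n + 1)` along the position sent to `0`. -/
theorem sum_perm_cons {n : ℕ} (m : (Fin (n + 1) → V) → ℝ) (x : V) (v : Fin n → V) :
    ∑ σ : Perm (Fin (n + 1)), ((Perm.sign σ : ℤ) : ℝ) * m (Matrix.vecCons x v ∘ σ) =
      ∑ k : Fin (n + 1), (-1 : ℝ) ^ (k : ℕ) *
        ∑ τ : Perm (Fin n), ((Perm.sign τ : ℤ) : ℝ) * m (k.insertNth x (v ∘ τ)) := by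
  simp only [Finset.mul_sum]
  rw [← Finset.sum_product']
  -- The cycle `p.1.cycleRange` brings position k to 0 and has sign (-1)^k, so the pair (k, τ) goes
  -- to the permutation sending k to 0 and acting as τ on the other positions. Bijectivity then
  -- follows from injectivity and (n+1)·n! = (n+1)!.
  let Φ : Fin (n + 1) × Perm (Fin n) → Perm (Fin (n + 1)) :=
    fun p => Perm.decomposeFin.symm (0, p.2) * p.1.cycleRange
  have h0 : ∀ p, Φ p p.1 = 0 := fun p => by simp [Φ]
  have h1 : ∀ p i, Φ p (p.1.succAbove i) = (p.2 i).succ := fun p i => by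
    simp [Φ, Fin.cycleRange_succAbove]
  have hΦ : Function.Bijective Φ := by
    rw [Fintype.bijective_iff_injective_and_card]
    refine ⟨fun p q hpq => ?_, by simp [Fintype.card_perm, Nat.factorial_succ]⟩
    have e1 : p.1 = q.1 := (Φ p).injective (by rw [h0, hpq, h0])
    refine Prod.ext e1 (Equiv.ext fun i => Fin.succ_injective _ ?_)
    rw [← h1 p i, ← h1 q i, hpq, e1]
  symm
  refine Fintype.sum_bijective Φ hΦ _ _ fun p => ?_
  have hs : Perm.sign (Φ p) = (-1) ^ (p.1 : ℕ) * Perm.sign p.2 := by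
    simp [Φ, mul_comm]
  have hv : Matrix.vecCons x v ∘ Φ p = p.1.insertNth x (v ∘ p.2) := by
    funext l
    rcases Fin.eq_self_or_eq_succAbove p.1 l with rfl | ⟨i, rfl⟩
    · simp [h0]
    · simp [h1]
  rw [hs, hv]
  push_cast
  ring

/-- A wedge product as a sum over all permutations. -/
theorem factorial_mul_altWedgeAux {p q n : ℕ} (h : p + q = n) (a : V [⋀^Fin p]→ₗ[ℝ] ℝ)
    (b : V [⋀^Fin q]→ₗ[ℝ] ℝ) (v : Fin n → V) :
    ((p.factorial * q.factorial : ℕ) : ℝ) * altWedgeAux a b (v ∘ Fin.cast h) =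
      ∑ σ : Perm (Fin n), ((Perm.sign σ : ℤ) : ℝ) *
        (a (fun i => (v ∘ σ) (Fin.cast h (Fin.castAdd q i))) *
          b (fun j => (v ∘ σ) (Fin.cast h (Fin.natAdd p j)))) := by
  subst h
  -- The full alternatization counts every shuffle p!·q! times. Working with it avoids chosen coset
  -- representatives, at the price of a factor that has to be cancelled later.
  have h1 := MultilinearMap.domCoprod_alternization_eq a b
  have h2 := congrArg (fun f => (LinearMap.mul' ℝ ℝ) (f (v ∘ finSumFinEquiv))) h1
  simp only [Fintype.card_fin, AlternatingMap.smul_apply, map_nsmul] at h2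
  rw [nsmul_eq_mul] at h2
  change _ = _ * altWedgeAux a b v at h2
  change _ * altWedgeAux a b v = _
  rw [← h2, MultilinearMap.alternatization_apply, map_sum]
  refine Fintype.sum_equiv (Equiv.permCongr finSumFinEquiv) _ _ fun σ => ?_
  rw [Perm.sign_permCongr, Units.smul_def, map_zsmul, zsmul_eq_mul]
  simp only [MultilinearMap.domDomCongr_apply, MultilinearMap.domCoprod_apply]
  simp [Equiv.permCongr_apply]

/-- This and the next three lemmas record that an insertion into one of two consecutive blocks of
slots acts inside that block and leaves the other one unchanged. -/
theorem insertNth_castAdd {p q : ℕ} (h : p + 1 + q = p + q + 1) (i : Fin (p + 1)) (x : V)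
    (u : Fin (p + q) → V) (l : Fin (p + 1)) :
    (Fin.insertNth (α := fun _ => V) (Fin.cast h (Fin.castAdd q i)) x u : Fin (p + q + 1) → V)
      (Fin.cast h (Fin.castAdd q l)) =
      (Fin.insertNth (α := fun _ => V) i x fun l => u (Fin.castAdd q l) : Fin (p + 1) → V) l := by
  rcases Fin.eq_self_or_eq_succAbove i l with rfl | ⟨l, rfl⟩
  · simp
  · have : Fin.cast h (Fin.castAdd q (i.succAbove l)) =
        (Fin.cast h (Fin.castAdd q i)).succAbove (Fin.castAdd q l) := by
      ext
      simp only [Fin.succAbove, Fin.lt_def, Fin.val_cast, Fin.val_castAdd, Fin.val_castSucc]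
      split_ifs <;> simp
    rw [this, Fin.insertNth_apply_succAbove, Fin.insertNth_apply_succAbove]

theorem insertNth_castAdd_natAdd {p q : ℕ} (h : p + 1 + q = p + q + 1) (i : Fin (p + 1)) (x : V)
    (u : Fin (p + q) → V) (l : Fin q) :
    (Fin.insertNth (α := fun _ => V) (Fin.cast h (Fin.castAdd q i)) x u : Fin (p + q + 1) → V)
      (Fin.cast h (Fin.natAdd (p + 1) l)) = u (Fin.natAdd p l) := by
  have : Fin.cast h (Fin.natAdd (p + 1) l) =
      (Fin.cast h (Fin.castAdd q i)).succAbove (Fin.natAdd p l) := by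
    ext
    simp only [Fin.succAbove, Fin.lt_def, Fin.val_cast, Fin.val_castAdd, Fin.val_castSucc,
      Fin.val_natAdd]
    split_ifs <;> simp <;> omega
  rw [this, Fin.insertNth_apply_succAbove]

theorem insertNth_natAdd {p q : ℕ} (i : Fin (q + 1)) (x : V)
    (u : Fin (p + q) → V) (l : Fin (q + 1)) :
    (Fin.insertNth (α := fun _ => V) (n := p + q) (Fin.natAdd p i) x u : Fin (p + q + 1) → V)
      (Fin.natAdd p l) =
      (Fin.insertNth (α := fun _ => V) i x fun l => u (Fin.natAdd p l) : Fin (q + 1) → V) l := by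
  rcases Fin.eq_self_or_eq_succAbove i l with rfl | ⟨l, rfl⟩
  · exact (Fin.insertNth_apply_same (α := fun _ => V) _ _ _).trans
      (Fin.insertNth_apply_same (α := fun _ => V) _ _ _).symm
  · have : Fin.natAdd p (i.succAbove l) =
        Fin.succAbove (n := p + q) (Fin.natAdd p i) (Fin.natAdd p l) := by
      ext
      simp only [Fin.succAbove, Fin.lt_def, Fin.val_castSucc, Fin.val_natAdd]
      split_ifs <;> simp <;> omega
    rw [this]
    exact (Fin.insertNth_apply_succAbove (α := fun _ => V) _ _ _ _).trans
      (Fin.insertNth_apply_succAbove (α := fun _ => V) i x (fun l => u (Fin.natAdd p l)) l).symm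

theorem insertNth_natAdd_castAdd {p q : ℕ} (i : Fin (q + 1)) (x : V)
    (u : Fin (p + q) → V) (l : Fin p) :
    (Fin.insertNth (α := fun _ => V) (n := p + q) (Fin.natAdd p i) x u : Fin (p + q + 1) → V)
      (Fin.castAdd (q + 1) l) = u (Fin.castAdd q l) := by
  have : Fin.castAdd (q + 1) l = Fin.succAbove (n := p + q) (Fin.natAdd p i) (Fin.castAdd q l) := by
    ext
    simp only [Fin.succAbove, Fin.lt_def, Fin.val_castSucc, Fin.val_natAdd, Fin.val_castAdd]
    split_ifs <;> simp; omega
  rw [this]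
  exact Fin.insertNth_apply_succAbove (α := fun _ => V) _ _ _ _

/-- Moving `x` from slot i of `a` to the front costs (-1)^i, which cancels the sign in front of the
sum. Hence the value does not depend on i. -/
theorem sum_castAdd_block {p q n : ℕ} (h : p + 1 + q = n + 1) (h' : p + q = n)
    (a : V [⋀^Fin (p + 1)]→ₗ[ℝ] ℝ) (b : V [⋀^Fin q]→ₗ[ℝ] ℝ) (x : V) (v : Fin n → V)
    (i : Fin (p + 1)) :
    (-1 : ℝ) ^ (i : ℕ) * ∑ τ : Perm (Fin n), ((Perm.sign τ : ℤ) : ℝ) *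
      (a (fun l => (Fin.insertNth (α := fun _ => V) (Fin.cast h (Fin.castAdd q i)) x (v ∘ τ))
          (Fin.cast h (Fin.castAdd q l))) *
        b (fun l => (Fin.insertNth (α := fun _ => V) (Fin.cast h (Fin.castAdd q i)) x (v ∘ τ))
          (Fin.cast h (Fin.natAdd (p + 1) l)))) =
      ((p.factorial * q.factorial : ℕ) : ℝ) *
        altWedgeAux (a.curryLeft x) b (v ∘ Fin.cast h') := by
  refine Eq.trans ?_ (factorial_mul_altWedgeAux h' (a.curryLeft x) b v).symm
  subst h'
  rw [Finset.mul_sum]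
  refine Finset.sum_congr rfl fun τ _ => ?_
  simp only [insertNth_castAdd, insertNth_castAdd_natAdd]
  rw [a.map_insertNth]
  have : (-1 : ℝ) ^ (i : ℕ) * (-1 : ℝ) ^ (i : ℕ) = 1 := by rw [← mul_pow]; simp
  simp only [AlternatingMap.curryLeft_apply_apply, Fin.cast_refl, id, Function.comp_apply]
  linear_combination (((Perm.sign τ : ℤ) : ℝ) *
    (a (Matrix.vecCons x fun l => v (τ (Fin.castAdd q l))) *
      b (fun l => v (τ (Fin.natAdd p l))))) * this

/-- Here `x` sits in slot p + i of the product but in slot i of `b`, so only (-1)^i cancels. The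
remaining (-1)^p is the Koszul sign of the antiderivation rule. -/
theorem sum_natAdd_block {p q n : ℕ} (h : p + (q + 1) = n + 1) (h' : p + q = n)
    (a : V [⋀^Fin p]→ₗ[ℝ] ℝ) (b : V [⋀^Fin (q + 1)]→ₗ[ℝ] ℝ) (x : V) (v : Fin n → V)
    (i : Fin (q + 1)) :
    (-1 : ℝ) ^ (p + i : ℕ) * ∑ τ : Perm (Fin n), ((Perm.sign τ : ℤ) : ℝ) *
      (a (fun l => (Fin.insertNth (α := fun _ => V) (Fin.cast h (Fin.natAdd p i)) x (v ∘ τ))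
          (Fin.cast h (Fin.castAdd (q + 1) l))) *
        b (fun l => (Fin.insertNth (α := fun _ => V) (Fin.cast h (Fin.natAdd p i)) x (v ∘ τ))
          (Fin.cast h (Fin.natAdd p l)))) =
      (-1 : ℝ) ^ p * (((p.factorial * q.factorial : ℕ) : ℝ) *
        altWedgeAux a (b.curryLeft x) (v ∘ Fin.cast h')) := by
  refine Eq.trans ?_ (congrArg _ (factorial_mul_altWedgeAux h' a (b.curryLeft x) v).symm)
  subst h'
  rw [Finset.mul_sum, Finset.mul_sum]
  refine Finset.sum_congr rfl fun τ _ => ?_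
  simp only [Fin.cast_refl, id]
  simp only [insertNth_natAdd, insertNth_natAdd_castAdd]
  rw [b.map_insertNth]
  have : (-1 : ℝ) ^ (i : ℕ) * (-1 : ℝ) ^ (i : ℕ) = 1 := by rw [← mul_pow]; simp
  simp only [AlternatingMap.curryLeft_apply_apply, Function.comp_apply]
  rw [pow_add]
  linear_combination ((-1) ^ p * ((Perm.sign τ : ℤ) : ℝ) *
    (a (fun l => v (τ (Fin.castAdd q l))) *
      b (Matrix.vecCons x fun l => v (τ (Fin.natAdd p l))))) * this

theorem factorial_mul_altWedgeAux_cons {p q n : ℕ} (h : p + q = n + 1) (a : V [⋀^Fin p]→ₗ[ℝ] ℝ)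
    (b : V [⋀^Fin q]→ₗ[ℝ] ℝ) (x : V) (v : Fin n → V) :
    ((p.factorial * q.factorial : ℕ) : ℝ) * altWedgeAux a b (Matrix.vecCons x v ∘ Fin.cast h) =
      ∑ i : Fin p, (-1 : ℝ) ^ (i : ℕ) * ∑ τ : Perm (Fin n), ((Perm.sign τ : ℤ) : ℝ) *
      (a (fun l => (Fin.insertNth (α := fun _ => V) (Fin.cast h (Fin.castAdd q i)) x (v ∘ τ))
          (Fin.cast h (Fin.castAdd q l))) *
        b (fun l => (Fin.insertNth (α := fun _ => V) (Fin.cast h (Fin.castAdd q i)) x (v ∘ τ))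
          (Fin.cast h (Fin.natAdd p l)))) +
      ∑ i : Fin q, (-1 : ℝ) ^ (p + i : ℕ) * ∑ τ : Perm (Fin n), ((Perm.sign τ : ℤ) : ℝ) *
      (a (fun l => (Fin.insertNth (α := fun _ => V) (Fin.cast h (Fin.natAdd p i)) x (v ∘ τ))
          (Fin.cast h (Fin.castAdd q l))) *
        b (fun l => (Fin.insertNth (α := fun _ => V) (Fin.cast h (Fin.natAdd p i)) x (v ∘ τ))
          (Fin.cast h (Fin.natAdd p l)))) := by
  rw [factorial_mul_altWedgeAux h, sum_perm_cons fun w => a (fun i =>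
    w (Fin.cast h (Fin.castAdd _ i))) * b (fun j => w (Fin.cast h (Fin.natAdd _ j))),
    ← Equiv.sum_comp (finCongr h), Fin.sum_univ_add]
  rfl

/-- Contraction is an antiderivation of the wedge product, both factors of positive degree. -/
theorem altWedgeAux_cons_succ_succ {p q n : ℕ} (h : p + 1 + (q + 1) = n + 1) (h1 : p + (q + 1) = n)
    (h2 : p + 1 + q = n) (a : V [⋀^Fin (p + 1)]→ₗ[ℝ] ℝ) (b : V [⋀^Fin (q + 1)]→ₗ[ℝ] ℝ) (x : V)
    (v : Fin n → V) :
    altWedgeAux a b (Matrix.vecCons x v ∘ Fin.cast h) =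
      altWedgeAux (a.curryLeft x) b (v ∘ Fin.cast h1) +
      (-1 : ℝ) ^ (p + 1) * altWedgeAux a (b.curryLeft x) (v ∘ Fin.cast h2) := by
  have e := factorial_mul_altWedgeAux_cons h a b x v
  rw [Finset.sum_congr rfl fun i _ => sum_castAdd_block h h1 a b x v i,
    Finset.sum_congr rfl fun i _ => sum_natAdd_block h h2 a b x v i] at e
  -- There are p + 1 equal terms of weight p!(q+1)! and q + 1 equal terms of weight (p+1)!q!. Both
  -- totals carry the common factor (p+1)!(q+1)!.
  simp only [Finset.sum_const, Finset.card_univ, Fintype.card_fin, nsmul_eq_mul] at e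
  have h0 : (((p + 1).factorial * (q + 1).factorial : ℕ) : ℝ) ≠ 0 := by positivity
  refine mul_left_cancel₀ h0 (e.trans ?_)
  simp only [Nat.factorial_succ]
  push_cast
  ring

/-- Contraction of a wedge product with a factor of degree zero on the left. -/
theorem altWedgeAux_cons_zero_succ {q n : ℕ} (h : 0 + (q + 1) = n + 1) (h2 : 0 + q = n)
    (a : V [⋀^Fin 0]→ₗ[ℝ] ℝ) (b : V [⋀^Fin (q + 1)]→ₗ[ℝ] ℝ) (x : V) (v : Fin n → V) :
    altWedgeAux a b (Matrix.vecCons x v ∘ Fin.cast h) =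
      altWedgeAux a (b.curryLeft x) (v ∘ Fin.cast h2) := by
  have e := factorial_mul_altWedgeAux_cons h a b x v
  rw [Finset.sum_congr (s₁ := (Finset.univ : Finset (Fin (q + 1)))) rfl fun i _ =>
    sum_natAdd_block h h2 a b x v i] at e
  simp only [Finset.sum_const, Finset.card_univ, Fintype.card_fin, nsmul_eq_mul,
    Finset.univ_eq_empty, Finset.sum_empty, zero_add, pow_zero, one_mul] at e
  have h0 : ((Nat.factorial 0 * (q + 1).factorial : ℕ) : ℝ) ≠ 0 := by positivity
  refine mul_left_cancel₀ h0 (e.trans ?_)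
  simp only [Nat.factorial_succ]
  push_cast
  ring

/-- Contraction of a wedge product with a factor of degree zero on the right. -/
theorem altWedgeAux_cons_succ_zero {p n : ℕ} (h : p + 1 + 0 = n + 1) (h1 : p + 0 = n)
    (a : V [⋀^Fin (p + 1)]→ₗ[ℝ] ℝ) (b : V [⋀^Fin 0]→ₗ[ℝ] ℝ) (x : V) (v : Fin n → V) :
    altWedgeAux a b (Matrix.vecCons x v ∘ Fin.cast h) =
      altWedgeAux (a.curryLeft x) b (v ∘ Fin.cast h1) := by
  have e := factorial_mul_altWedgeAux_cons h a b x v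
  rw [Finset.sum_congr (s₁ := (Finset.univ : Finset (Fin (p + 1)))) rfl fun i _ =>
    sum_castAdd_block h h1 a b x v i] at e
  simp only [Finset.sum_const, Finset.card_univ, Fintype.card_fin, nsmul_eq_mul,
    Finset.univ_eq_empty, Finset.sum_empty, add_zero] at e
  have h0 : (((p + 1).factorial * Nat.factorial 0 : ℕ) : ℝ) ≠ 0 := by positivity
  refine mul_left_cancel₀ h0 (e.trans ?_)
  simp only [Nat.factorial_succ]
  push_cast
  ring

/-- The wedge product in degree zero is the product. -/
theorem altWedgeAux_zero_zero (a b : V [⋀^Fin 0]→ₗ[ℝ] ℝ) (v : Fin (0 + 0) → V) :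
    altWedgeAux a b v = a 0 * b 0 := by
  have ha : ∀ w, a w = a 0 := fun w => congrArg a (Subsingleton.elim _ _)
  have hb : ∀ w, b w = b 0 := fun w => congrArg b (Subsingleton.elim _ _)
  have e := factorial_mul_altWedgeAux (n := 0) rfl a b v
  rw [Fintype.sum_unique, ha, hb] at e
  simpa using e

end WedgeContraction

end HomLie

/-! ### The abstract contraction calculus and its graded algebra. -/

namespace HomLie

section Contraction

variable (R Γ : Type*) [CommRing R] [Algebra ℝ R] [AddCommGroup Γ] [Module ℝ Γ] [Module R Γ]
  [IsScalarTower ℝ R Γ] (𝔄 : ℕ → Type*) [∀ n, AddCommGroup (𝔄 n)] [∀ n, Module ℝ (𝔄 n)]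
  [∀ n, Module R (𝔄 n)] [∀ n, IsScalarTower ℝ R (𝔄 n)]

/-- The modules `𝔄 n` behave as alternating `n`-forms on the `R`-module `Γ`: `ι` is the insertion
of an element of `Γ`, and a form of positive degree is an alternating family of contractions. -/
structure Contraction where
  /-- insertion of an element into the first slot -/
  ι : ∀ n, Γ →ₗ[R] 𝔄 (n + 1) →ₗ[R] 𝔄 n
  /-- forms of degree zero are scalars -/
  e0 : 𝔄 0 ≃ₗ[R] R
  ι_ι : ∀ n x (a : 𝔄 (n + 2)), ι n x (ι (n + 1) x a) = 0
  ext : ∀ n (a : 𝔄 (n + 1)), (∀ x, ι n x a = 0) → a = 0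
  exists_zero : ∀ t : Γ →ₗ[R] 𝔄 0, ∃ a : 𝔄 1, ∀ x, ι 0 x a = t x
  exists_succ : ∀ n (t : Γ →ₗ[R] 𝔄 (n + 1)), (∀ x, ι n x (t x) = 0) →
    ∃ a : 𝔄 (n + 2), ∀ x, ι (n + 1) x a = t x

end Contraction

variable {R Γ : Type*} [CommRing R] [Algebra ℝ R] [AddCommGroup Γ] [Module ℝ Γ] [Module R Γ]
  [IsScalarTower ℝ R Γ] {𝔄 : ℕ → Type*} [∀ n, AddCommGroup (𝔄 n)] [∀ n, Module ℝ (𝔄 n)]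
  [∀ n, Module R (𝔄 n)] [∀ n, IsScalarTower ℝ R (𝔄 n)]

namespace Contraction

variable (C : Contraction R Γ 𝔄)

/-- Contraction on the direct sum. -/
noncomputable def tot (x : Γ) : (⨁ n, 𝔄 n) →ₗ[ℝ] ⨁ n, 𝔄 n :=
  DirectSum.toModule ℝ ℕ _ fun n => match n with
    | 0 => 0
    | n + 1 => DirectSum.lof ℝ ℕ 𝔄 n ∘ₗ (C.ι n x).restrictScalars ℝ

@[simp]
theorem tot_lof_zero (x : Γ) (a : 𝔄 0) : C.tot x (DirectSum.lof ℝ ℕ 𝔄 0 a) = 0 := by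
  simp [tot]

@[simp]
theorem tot_lof_succ (x : Γ) (n : ℕ) (a : 𝔄 (n + 1)) :
    C.tot x (DirectSum.lof ℝ ℕ 𝔄 (n + 1) a) = DirectSum.lof ℝ ℕ 𝔄 n (C.ι n x a) := by
  simp [tot]

/-- The component of degree zero. -/
noncomputable def ev0 : (⨁ n, 𝔄 n) →ₗ[ℝ] R :=
  (C.e0.toLinearMap.restrictScalars ℝ) ∘ₗ DirectSum.component ℝ ℕ 𝔄 0

@[simp]
theorem ev0_lof_zero (a : 𝔄 0) : C.ev0 (DirectSum.lof ℝ ℕ 𝔄 0 a) = C.e0 a := by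
  simp [ev0, DirectSum.component.lof_self]

@[simp]
theorem ev0_lof_succ (n : ℕ) (a : 𝔄 (n + 1)) : C.ev0 (DirectSum.lof ℝ ℕ 𝔄 (n + 1) a) = 0 := by
  simp [ev0, DirectSum.component.of]

theorem tot_apply (x : Γ) (a : ⨁ n, 𝔄 n) (n : ℕ) : (C.tot x a) n = C.ι n x (a (n + 1)) := by
  induction a using DirectSum.induction_on with
  | zero => simp
  | of i b =>
    change (C.tot x (DirectSum.lof ℝ ℕ 𝔄 i b)) n = C.ι n x (DirectSum.lof ℝ ℕ 𝔄 i b (n + 1))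
    cases i with
    | zero =>
      rw [tot_lof_zero, DirectSum.lof_eq_of, DirectSum.of_eq_of_ne _ _ _ (by omega)]
      simp
    | succ i =>
      rw [tot_lof_succ]
      by_cases h : i = n
      · subst h
        simp [DirectSum.lof_eq_of]
      · rw [DirectSum.lof_eq_of, DirectSum.lof_eq_of, DirectSum.of_eq_of_ne _ _ _ (by omega),
          DirectSum.of_eq_of_ne _ _ _ (by omega)]
        simp
  | add a b ha hb => simp [ha, hb]

/-- The scalar part controls degree zero, and contractions are jointly injective in positive degree.
Together with the induction principles below, this reduces an identity between operators to its
commutation with contractions. -/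
theorem tot_ext {a : ⨁ n, 𝔄 n} (h0 : C.ev0 a = 0) (h : ∀ x, C.tot x a = 0) : a = 0 := by
  refine DFinsupp.ext fun n => ?_
  cases n with
  | zero => exact C.e0.injective (h0.trans (map_zero _).symm)
  | succ n =>
    refine C.ext n _ fun x => ?_
    rw [← tot_apply, h]; rfl

theorem tot_tot (x : Γ) (a : ⨁ n, 𝔄 n) : C.tot x (C.tot x a) = 0 := by
  refine DFinsupp.ext fun n => ?_
  rw [tot_apply, tot_apply, C.ι_ι]; rfl

theorem tot_add (x y : Γ) : C.tot (x + y) = C.tot x + C.tot y := by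
  refine LinearMap.ext fun a => DFinsupp.ext fun n => ?_
  change _ = C.tot x a n + C.tot y a n
  simp [tot_apply]

theorem tot_smul (f : R) (x : Γ) (a : ⨁ n, 𝔄 n) : C.tot (f • x) a = f • C.tot x a := by
  refine DFinsupp.ext fun n => ?_
  change _ = f • C.tot x a n
  simp [tot_apply]

theorem tot_apply_smul (f : R) (x : Γ) (a : ⨁ n, 𝔄 n) : C.tot x (f • a) = f • C.tot x a := by
  refine DFinsupp.ext fun n => ?_
  change _ = f • C.tot x a n
  rw [tot_apply, tot_apply, ← map_smul]
  rfl

theorem tot_zero : C.tot 0 = 0 := by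
  refine LinearMap.ext fun a => DFinsupp.ext fun n => ?_
  rw [tot_apply, map_zero]; rfl

theorem tot_neg (x : Γ) : C.tot (-x) = - C.tot x := by
  rw [eq_neg_iff_add_eq_zero, ← tot_add, neg_add_cancel, tot_zero]

theorem tot_sub (x y : Γ) : C.tot (x - y) = C.tot x - C.tot y := by
  rw [sub_eq_add_neg, tot_add, tot_neg, sub_eq_add_neg]

theorem ev0_smul (f : R) (a : ⨁ n, 𝔄 n) : C.ev0 (f • a) = f * C.ev0 a :=
  map_smul C.e0 f (a 0)

theorem tot_anticomm (x y : Γ) (a : ⨁ n, 𝔄 n) :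
    C.tot x (C.tot y a) = - C.tot y (C.tot x a) := by
  have h := C.tot_tot (x + y) a
  simp only [tot_add, LinearMap.add_apply, map_add, tot_tot, zero_add, add_zero] at h
  exact eq_neg_of_add_eq_zero_right h

theorem tot_lof_cases (p : ℕ) (a : 𝔄 p) :
    (∀ x, C.tot x (DirectSum.lof ℝ ℕ 𝔄 p a) = 0) ∨
      ∃ p', p = p' + 1 ∧ ∀ x, ∃ a' : 𝔄 p', C.tot x (DirectSum.lof ℝ ℕ 𝔄 p a) =
        DirectSum.lof ℝ ℕ 𝔄 p' a' := by
  cases p with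
  | zero => exact Or.inl fun x => C.tot_lof_zero x a
  | succ p => exact Or.inr ⟨p, rfl, fun x => ⟨_, C.tot_lof_succ x p a⟩⟩

/-- A linear map on forms vanishes if this can be seen by induction on the degree. -/
theorem linear_induction {N : Type*} [AddCommGroup N] [Module ℝ N]
    (T : (⨁ n, 𝔄 n) →ₗ[ℝ] N)
    (h : ∀ n (a : 𝔄 n), (∀ x, T (C.tot x (DirectSum.lof ℝ ℕ 𝔄 n a)) = 0) →
      T (DirectSum.lof ℝ ℕ 𝔄 n a) = 0) : ∀ a, T a = 0 := by
  have key : ∀ n (a : 𝔄 n), T (DirectSum.lof ℝ ℕ 𝔄 n a) = 0 := by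
    intro n
    induction n with
    | zero => intro a; exact h 0 a fun x => by simp
    | succ n ih => intro a; exact h _ a fun x => by simp [ih]
  intro a
  exact LinearMap.congr_fun (DirectSum.linearMap_ext (M := 𝔄) (ψ := T) (ψ' := 0)
    ℝ fun n => LinearMap.ext fun b => key n b) a

/-- Contraction kills degree zero and otherwise lowers the degree by one, so strong induction on p +
q + r applies to each of the three hypotheses. -/
theorem trilinear_induction (T : (⨁ n, 𝔄 n) →ₗ[ℝ] (⨁ n, 𝔄 n) →ₗ[ℝ] (⨁ n, 𝔄 n) →ₗ[ℝ] ⨁ n, 𝔄 n)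
    (h : ∀ p q r (a : 𝔄 p) (b : 𝔄 q) (c : 𝔄 r),
      (∀ x, T (C.tot x (DirectSum.lof ℝ ℕ 𝔄 p a)) (DirectSum.lof ℝ ℕ 𝔄 q b)
        (DirectSum.lof ℝ ℕ 𝔄 r c) = 0) →
      (∀ x, T (DirectSum.lof ℝ ℕ 𝔄 p a) (C.tot x (DirectSum.lof ℝ ℕ 𝔄 q b))
        (DirectSum.lof ℝ ℕ 𝔄 r c) = 0) →
      (∀ x, T (DirectSum.lof ℝ ℕ 𝔄 p a) (DirectSum.lof ℝ ℕ 𝔄 q b)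
        (C.tot x (DirectSum.lof ℝ ℕ 𝔄 r c)) = 0) →
      T (DirectSum.lof ℝ ℕ 𝔄 p a) (DirectSum.lof ℝ ℕ 𝔄 q b) (DirectSum.lof ℝ ℕ 𝔄 r c) = 0) :
    ∀ a b c, T a b c = 0 := by
  have key : ∀ N p q r (_ : p + q + r = N) (a : 𝔄 p) (b : 𝔄 q) (c : 𝔄 r),
      T (DirectSum.lof ℝ ℕ 𝔄 p a) (DirectSum.lof ℝ ℕ 𝔄 q b) (DirectSum.lof ℝ ℕ 𝔄 r c) = 0 := by
    intro N
    induction N using Nat.strong_induction_on with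
    | _ N ih =>
      intro p q r hN a b c
      refine h p q r a b c (fun x => ?_) (fun x => ?_) (fun x => ?_)
      · rcases C.tot_lof_cases p a with h0 | ⟨p', rfl, h0⟩
        · simp [h0]
        · obtain ⟨a', ha⟩ := h0 x
          rw [ha]; exact ih (p' + q + r) (by omega) _ _ _ rfl _ _ _
      · rcases C.tot_lof_cases q b with h0 | ⟨p', rfl, h0⟩
        · simp [h0]
        · obtain ⟨a', ha⟩ := h0 x
          rw [ha]; exact ih (p + p' + r) (by omega) _ _ _ rfl _ _ _
      · rcases C.tot_lof_cases r c with h0 | ⟨p', rfl, h0⟩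
        · simp [h0]
        · obtain ⟨a', ha⟩ := h0 x
          rw [ha]; exact ih (p + q + p') (by omega) _ _ _ rfl _ _ _
  have : T = 0 := by
    refine DirectSum.linearMap_ext ℝ fun p => LinearMap.ext fun a =>
      DirectSum.linearMap_ext ℝ fun q => LinearMap.ext fun b =>
      DirectSum.linearMap_ext ℝ fun r => LinearMap.ext fun c => ?_
    exact key _ p q r rfl a b c
  intro a b c
  rw [this]; rfl

/-- A bilinear map on forms vanishes if this can be seen by induction on the degree. -/
theorem bilinear_induction (T : (⨁ n, 𝔄 n) →ₗ[ℝ] (⨁ n, 𝔄 n) →ₗ[ℝ] ⨁ n, 𝔄 n)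
    (h : ∀ p q (a : 𝔄 p) (b : 𝔄 q),
      (∀ x, T (C.tot x (DirectSum.lof ℝ ℕ 𝔄 p a)) (DirectSum.lof ℝ ℕ 𝔄 q b) = 0) →
      (∀ x, T (DirectSum.lof ℝ ℕ 𝔄 p a) (C.tot x (DirectSum.lof ℝ ℕ 𝔄 q b)) = 0) →
      T (DirectSum.lof ℝ ℕ 𝔄 p a) (DirectSum.lof ℝ ℕ 𝔄 q b) = 0) :
    ∀ a b, T a b = 0 := by
  have key : ∀ N p q (_ : p + q = N) (a : 𝔄 p) (b : 𝔄 q),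
      T (DirectSum.lof ℝ ℕ 𝔄 p a) (DirectSum.lof ℝ ℕ 𝔄 q b) = 0 := by
    intro N
    induction N using Nat.strong_induction_on with
    | _ N ih =>
      intro p q hN a b
      refine h p q a b (fun x => ?_) (fun x => ?_)
      · rcases C.tot_lof_cases p a with h0 | ⟨p', rfl, h0⟩
        · simp [h0]
        · obtain ⟨a', ha⟩ := h0 x
          rw [ha]; exact ih (p' + q) (by omega) _ _ rfl _ _
      · rcases C.tot_lof_cases q b with h0 | ⟨p', rfl, h0⟩
        · simp [h0]
        · obtain ⟨a', ha⟩ := h0 x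
          rw [ha]; exact ih (p + p') (by omega) _ _ rfl _ _
  have : T = 0 := by
    refine DirectSum.linearMap_ext ℝ fun p => LinearMap.ext fun a =>
      DirectSum.linearMap_ext ℝ fun q => LinearMap.ext fun b => ?_
    exact key _ p q rfl a b
  intro a b
  rw [this]; rfl

end Contraction

variable (𝔄) in
/-- The grading involution `a ↦ (-1) ^ |a| a`. -/
noncomputable def gradInv : (⨁ n, 𝔄 n) →ₗ[ℝ] ⨁ n, 𝔄 n :=
  DirectSum.lmap fun n => (-1 : ℝ) ^ n • LinearMap.id

@[simp]
theorem gradInv_lof (n : ℕ) (a : 𝔄 n) : gradInv 𝔄 (DirectSum.lof ℝ ℕ 𝔄 n a) =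
    (-1 : ℝ) ^ n • DirectSum.lof ℝ ℕ 𝔄 n a := by
  simp [gradInv]

theorem linearMap_ext_lof {N : Type*} [AddCommGroup N] [Module ℝ N] {S T : (⨁ n, 𝔄 n) →ₗ[ℝ] N}
    (h : ∀ n (a : 𝔄 n), S (DirectSum.lof ℝ ℕ 𝔄 n a) = T (DirectSum.lof ℝ ℕ 𝔄 n a)) (a : ⨁ n, 𝔄 n) :
    S a = T a :=
  LinearMap.congr_fun (DirectSum.linearMap_ext ℝ fun n => LinearMap.ext fun b => h n b) a

@[simp]
theorem gradInv_gradInv (a : ⨁ n, 𝔄 n) : gradInv 𝔄 (gradInv 𝔄 a) = a := by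
  refine linearMap_ext_lof (S := gradInv 𝔄 ∘ₗ gradInv 𝔄) (T := LinearMap.id) (fun n a => ?_) a
  simp [smul_smul, ← mul_pow]

theorem Contraction.tot_gradInv (C : Contraction R Γ 𝔄) (x : Γ) (a : ⨁ n, 𝔄 n) :
    C.tot x (gradInv 𝔄 a) = - gradInv 𝔄 (C.tot x a) := by
  refine linearMap_ext_lof (S := C.tot x ∘ₗ gradInv 𝔄) (T := - (gradInv 𝔄 ∘ₗ C.tot x))
    (fun n a => ?_) a
  cases n with
  | zero => simp
  | succ n => simp [pow_succ]

theorem gradInv_raise {D : (⨁ n, 𝔄 n) →ₗ[ℝ] ⨁ n, 𝔄 n}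
    (hD : ∀ n (a : 𝔄 n), ∃ b : 𝔄 (n + 1),
      D (DirectSum.lof ℝ ℕ 𝔄 n a) = DirectSum.lof ℝ ℕ 𝔄 (n + 1) b) (a : ⨁ n, 𝔄 n) :
    gradInv 𝔄 (D a) = - D (gradInv 𝔄 a) := by
  refine linearMap_ext_lof (S := gradInv 𝔄 ∘ₗ D) (T := - (D ∘ₗ gradInv 𝔄)) (fun n a => ?_) a
  obtain ⟨b, hb⟩ := hD n a
  simp [hb, pow_succ]

theorem Contraction.ev0_raise (C : Contraction R Γ 𝔄) {D : (⨁ n, 𝔄 n) →ₗ[ℝ] ⨁ n, 𝔄 n}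
    (hD : ∀ n (a : 𝔄 n), ∃ b : 𝔄 (n + 1),
      D (DirectSum.lof ℝ ℕ 𝔄 n a) = DirectSum.lof ℝ ℕ 𝔄 (n + 1) b) (a : ⨁ n, 𝔄 n) :
    C.ev0 (D a) = 0 := by
  refine linearMap_ext_lof (S := C.ev0 ∘ₗ D) (T := 0) (fun n a => ?_) a
  obtain ⟨b, hb⟩ := hD n a
  simp [hb]

@[simp]
theorem totalMul_lof (mul : ∀ p q, 𝔄 p →ₗ[ℝ] 𝔄 q →ₗ[ℝ] 𝔄 (p + q)) (p q : ℕ) (a : 𝔄 p) (b : 𝔄 q) :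
    totalMul mul (DirectSum.lof ℝ ℕ 𝔄 p a) (DirectSum.lof ℝ ℕ 𝔄 q b) =
      DirectSum.lof ℝ ℕ 𝔄 (p + q) (mul p q a b) := by
  simp [totalMul, LinearMap.flip_apply]

namespace Contraction

variable (C : Contraction R Γ 𝔄)

/-- The product `mul` is the wedge product: contractions are antiderivations, and in degree zero
it is the multiplication of scalars. -/
structure IsWedge (mul : ∀ p q, 𝔄 p →ₗ[ℝ] 𝔄 q →ₗ[ℝ] 𝔄 (p + q)) : Prop where
  tot_lof_mul : ∀ x p q (a : 𝔄 p) (b : 𝔄 q),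
    C.tot x (totalMul mul (DirectSum.lof ℝ ℕ 𝔄 p a) (DirectSum.lof ℝ ℕ 𝔄 q b)) =
      totalMul mul (C.tot x (DirectSum.lof ℝ ℕ 𝔄 p a)) (DirectSum.lof ℝ ℕ 𝔄 q b) +
      (-1 : ℝ) ^ p • totalMul mul (DirectSum.lof ℝ ℕ 𝔄 p a) (C.tot x (DirectSum.lof ℝ ℕ 𝔄 q b))
  e0_mul : ∀ a b : 𝔄 0, C.e0 (mul 0 0 a b) = C.e0 a * C.e0 b

variable {C} {mul : ∀ p q, 𝔄 p →ₗ[ℝ] 𝔄 q →ₗ[ℝ] 𝔄 (p + q)}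

/-- A scalar, regarded as a form of degree zero. -/
noncomputable def scalar (C : Contraction R Γ 𝔄) (f : R) : ⨁ n, 𝔄 n :=
  DirectSum.lof ℝ ℕ 𝔄 0 (C.e0.symm f)

@[simp]
theorem ev0_scalar (f : R) : C.ev0 (C.scalar f) = f := by simp [scalar]

@[simp]
theorem tot_scalar (x : Γ) (f : R) : C.tot x (C.scalar f) = 0 := by simp [scalar]

@[simp]
theorem gradInv_scalar (f : R) : gradInv 𝔄 (C.scalar f) = C.scalar f := by simp [scalar]

theorem lof_zero_eq_scalar (a : 𝔄 0) : DirectSum.lof ℝ ℕ 𝔄 0 a = C.scalar (C.e0 a) := by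
  simp [scalar]

theorem lof_smul (f : R) (n : ℕ) (a : 𝔄 n) :
    DirectSum.lof ℝ ℕ 𝔄 n (f • a) = f • DirectSum.lof ℝ ℕ 𝔄 n a :=
  map_smul (DirectSum.lof R ℕ 𝔄 n) f a

namespace IsWedge

/-- With the sign (-1)^p absorbed into `gradInv`, both sides are bilinear, so the rule extends from
homogeneous elements to the whole direct sum. -/
theorem tot_mul (hC : C.IsWedge mul) (x : Γ) (a b : ⨁ n, 𝔄 n) :
    C.tot x (totalMul mul a b) = totalMul mul (C.tot x a) b +
      totalMul mul (gradInv 𝔄 a) (C.tot x b) := by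
  revert b a
  refine fun a => linearMap_ext_lof (S := C.tot x ∘ₗ totalMul mul a)
    (T := totalMul mul (C.tot x a) + totalMul mul (gradInv 𝔄 a) ∘ₗ C.tot x) fun q b => ?_
  refine linearMap_ext_lof (S := C.tot x ∘ₗ (totalMul mul).flip (DirectSum.lof ℝ ℕ 𝔄 q b))
    (T := (totalMul mul).flip (DirectSum.lof ℝ ℕ 𝔄 q b) ∘ₗ C.tot x +
      (totalMul mul).flip (C.tot x (DirectSum.lof ℝ ℕ 𝔄 q b)) ∘ₗ gradInv 𝔄) (fun p a => ?_) a
  have := hC.tot_lof_mul x p q a b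
  simpa [-totalMul_lof, LinearMap.flip_apply] using this

theorem ev0_mul (hC : C.IsWedge mul) (a b : ⨁ n, 𝔄 n) :
    C.ev0 (totalMul mul a b) = C.ev0 a * C.ev0 b := by
  revert b a
  refine fun a => linearMap_ext_lof (S := C.ev0 ∘ₗ totalMul mul a)
    (T := LinearMap.mul ℝ R (C.ev0 a) ∘ₗ C.ev0) fun q b => ?_
  refine linearMap_ext_lof (S := C.ev0 ∘ₗ (totalMul mul).flip (DirectSum.lof ℝ ℕ 𝔄 q b))
    (T := (LinearMap.mul ℝ R).flip (C.ev0 (DirectSum.lof ℝ ℕ 𝔄 q b)) ∘ₗ C.ev0) (fun p a => ?_) a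
  simp only [LinearMap.comp_apply, LinearMap.flip_apply, totalMul_lof, LinearMap.mul_apply']
  cases p with
  | succ p =>
    rw [ev0_lof_succ, zero_mul]
    simp [ev0, DirectSum.component.of]
  | zero =>
    cases q with
    | zero =>
      have h := hC.e0_mul a b
      rw [ev0_lof_zero, ev0_lof_zero]
      exact (C.ev0_lof_zero _).trans h
    | succ q =>
      rw [ev0_lof_succ, mul_zero]
      simp [ev0, DirectSum.component.of]

/-- The product is only assumed ℝ-bilinear; linearity over `R` comes from here. Contractions kill
scalars, hence commute with both operations, and the scalar parts agree. -/
theorem scalar_mul (hC : C.IsWedge mul) (f : R) (a : ⨁ n, 𝔄 n) :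
    totalMul mul (C.scalar f) a = f • a := by
  let S : (⨁ n, 𝔄 n) →ₗ[ℝ] ⨁ n, 𝔄 n :=
    { toFun := fun a => f • a
      map_add' := smul_add f
      map_smul' := fun c a => by rw [RingHom.id_apply, smul_comm] }
  refine sub_eq_zero.1 (C.linear_induction (totalMul mul (C.scalar f) - S) (fun n a h => ?_) a)
  change totalMul mul (C.scalar f) _ - f • _ = 0
  refine C.tot_ext ?_ fun x => ?_
  · simp [hC.ev0_mul, C.ev0_smul]
  · rw [map_sub, hC.tot_mul, tot_scalar, gradInv_scalar, map_zero, LinearMap.zero_apply, zero_add,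
      tot_apply_smul]
    exact h x

theorem mul_scalar (hC : C.IsWedge mul) (f : R) (a : ⨁ n, 𝔄 n) :
    totalMul mul a (C.scalar f) = f • a := by
  let S : (⨁ n, 𝔄 n) →ₗ[ℝ] ⨁ n, 𝔄 n :=
    { toFun := fun a => f • a
      map_add' := smul_add f
      map_smul' := fun c a => by rw [RingHom.id_apply, smul_comm] }
  refine sub_eq_zero.1 (C.linear_induction ((totalMul mul).flip (C.scalar f) - S)
    (fun n a h => ?_) a)
  have e : ∀ a, ((totalMul mul).flip (C.scalar f) - S) a = totalMul mul a (C.scalar f) - f • a :=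
    fun a => by rw [LinearMap.sub_apply, LinearMap.flip_apply]; rfl
  simp only [e] at h ⊢
  refine C.tot_ext ?_ fun x => ?_
  · simp [hC.ev0_mul, C.ev0_smul, mul_comm]
  · rw [map_sub, hC.tot_mul, tot_scalar, map_zero, add_zero, tot_apply_smul]
    exact h x

theorem gradInv_mul (mul : ∀ p q, 𝔄 p →ₗ[ℝ] 𝔄 q →ₗ[ℝ] 𝔄 (p + q)) (a b : ⨁ n, 𝔄 n) :
    gradInv 𝔄 (totalMul mul a b) = totalMul mul (gradInv 𝔄 a) (gradInv 𝔄 b) := by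
  revert b a
  refine fun a => linearMap_ext_lof (S := gradInv 𝔄 ∘ₗ totalMul mul a)
    (T := totalMul mul (gradInv 𝔄 a) ∘ₗ gradInv 𝔄) fun q b => ?_
  refine linearMap_ext_lof (S := gradInv 𝔄 ∘ₗ (totalMul mul).flip (DirectSum.lof ℝ ℕ 𝔄 q b))
    (T := (totalMul mul).flip (gradInv 𝔄 (DirectSum.lof ℝ ℕ 𝔄 q b)) ∘ₗ gradInv 𝔄)
    (fun p a => ?_) a
  simp [LinearMap.flip_apply, smul_smul, pow_add, mul_comm]

/-- Contracting an associator gives, up to signs, the sum of the associators with one argument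
contracted, so induction on the total degree leaves only associativity in `R`. -/
theorem mul_assoc (hC : C.IsWedge mul) (a b c : ⨁ n, 𝔄 n) :
    totalMul mul (totalMul mul a b) c = totalMul mul a (totalMul mul b c) := by
  let μ := totalMul mul
  let S : (⨁ n, 𝔄 n) →ₗ[ℝ] (⨁ n, 𝔄 n) →ₗ[ℝ] (⨁ n, 𝔄 n) →ₗ[ℝ] ⨁ n, 𝔄 n :=
    { toFun := fun a => μ ∘ₗ μ a - μ.compr₂ (μ a)
      map_add' := fun a b => LinearMap.ext fun c => LinearMap.ext fun d => by
        simp only [map_add, LinearMap.sub_apply, LinearMap.add_apply, LinearMap.comp_apply,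
          LinearMap.compr₂_apply]
        abel
      map_smul' := fun c a => LinearMap.ext fun b => LinearMap.ext fun d => by
        simp only [map_smul, LinearMap.sub_apply, LinearMap.smul_apply, LinearMap.comp_apply,
          LinearMap.compr₂_apply, RingHom.id_apply, smul_sub] }
  have e : ∀ a b c, S a b c = μ (μ a b) c - μ a (μ b c) := fun a b c => rfl
  refine sub_eq_zero.1 ((e a b c).symm.trans (C.trilinear_induction _
    (fun p q r a b c h1 h2 h3 => ?_) a b c))
  simp only [e] at h1 h2 h3 ⊢
  refine C.tot_ext ?_ fun x => ?_
  · simp only [μ, map_sub, hC.ev0_mul]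
    ring
  · have h1' := h1 x
    have h2' := h2 x
    have h3' := h3 x
    simp only [μ, map_sub, hC.tot_mul, map_add, LinearMap.add_apply, gradInv_mul, gradInv_lof,
      map_smul, LinearMap.smul_apply] at h1' h2' h3' ⊢
    rw [sub_eq_zero] at h1' h2' h3' ⊢
    rw [h1', h2', h3']
    simp only [add_assoc]

theorem lof_mul_comm (hC : C.IsWedge mul) (p q : ℕ) (a : 𝔄 p) (b : 𝔄 q) :
    totalMul mul (DirectSum.lof ℝ ℕ 𝔄 p a) (DirectSum.lof ℝ ℕ 𝔄 q b) =
      (-1 : ℝ) ^ (p * q) •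
        totalMul mul (DirectSum.lof ℝ ℕ 𝔄 q b) (DirectSum.lof ℝ ℕ 𝔄 p a) := by
  induction hN : p + q using Nat.strong_induction_on generalizing p q with
  | _ N ih =>
    refine sub_eq_zero.1 (C.tot_ext ?_ fun x => ?_)
    · simp only [map_sub, map_smul, hC.ev0_mul]
      cases p with
      | zero => simp [mul_comm]
      | succ p => simp
    · simp only [map_sub, map_smul, hC.tot_mul, gradInv_lof, LinearMap.smul_apply]
      rw [sub_eq_zero]
      -- For p ≥ 1 the induction hypothesis provides the exponent (p-1)q, which has the parity of pq
      -- + q. For p = 0 both sides vanish.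
      have h1 : totalMul mul (C.tot x (DirectSum.lof ℝ ℕ 𝔄 p a)) (DirectSum.lof ℝ ℕ 𝔄 q b) =
          (-1 : ℝ) ^ (p * q + q) • totalMul mul (DirectSum.lof ℝ ℕ 𝔄 q b)
            (C.tot x (DirectSum.lof ℝ ℕ 𝔄 p a)) := by
        cases p with
        | zero => simp
        | succ p =>
          rw [tot_lof_succ, ih (p + q) (by omega) p q _ _ rfl]
          congr 1
          rw [show (p + 1) * q + q = p * q + (q + q) by ring, pow_add _ _ (q + q),
            Even.neg_one_pow ⟨q, rfl⟩, mul_one]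
      have h2 : totalMul mul (DirectSum.lof ℝ ℕ 𝔄 p a) (C.tot x (DirectSum.lof ℝ ℕ 𝔄 q b)) =
          (-1 : ℝ) ^ (p * q + p) • totalMul mul (C.tot x (DirectSum.lof ℝ ℕ 𝔄 q b))
            (DirectSum.lof ℝ ℕ 𝔄 p a) := by
        cases q with
        | zero => simp
        | succ q =>
          rw [tot_lof_succ, ih (p + q) (by omega) p q _ _ rfl]
          congr 1
          rw [show p * (q + 1) + p = p * q + (p + p) by ring, pow_add _ _ (p + p),
            Even.neg_one_pow ⟨p, rfl⟩, mul_one]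
      rw [h1, h2, smul_add, smul_smul, smul_smul, add_comm, ← pow_add, ← pow_add]
      congr 2
      rw [show p + (p * q + p) = p * q + (p + p) by ring, pow_add _ _ (p + p),
        Even.neg_one_pow ⟨p, rfl⟩, mul_one]

theorem isGradedCommAlgebra (hC : C.IsWedge mul) {one : 𝔄 0} (h1 : C.e0 one = 1) :
    IsGradedCommAlgebra mul one where
  mul_assoc := hC.mul_assoc
  one_mul a := by rw [lof_zero_eq_scalar (C := C), h1, hC.scalar_mul, one_smul]
  mul_one a := by rw [lof_zero_eq_scalar (C := C), h1, hC.mul_scalar, one_smul]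
  mul_comm := hC.lof_mul_comm

end IsWedge

end Contraction

end HomLie

/-! ### Cartan calculus of a Lie–Rinehart structure. -/

namespace HomLie

variable (R Γ : Type*) [CommRing R] [Algebra ℝ R] [AddCommGroup Γ] [Module ℝ Γ] [Module R Γ]

/-- A Lie–Rinehart structure on the `R`-module `Γ`. -/
structure LieRinehart where
  /-- the bracket -/
  bracket : Γ →ₗ[ℝ] Γ →ₗ[ℝ] Γ
  /-- the anchor -/
  anchor : Γ →ₗ[R] Derivation ℝ R R
  skew : ∀ x y, bracket x y = - bracket y x
  jacobi : ∀ x y z, bracket x (bracket y z) + bracket y (bracket z x) +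
    bracket z (bracket x y) = 0
  leibniz : ∀ x y (f : R), bracket x (f • y) = f • bracket x y + anchor x f • y
  anchor_bracket : ∀ x y f, anchor (bracket x y) f = anchor x (anchor y f) - anchor y (anchor x f)

variable {R Γ} [IsScalarTower ℝ R Γ] {𝔄 : ℕ → Type*} [∀ n, AddCommGroup (𝔄 n)]
  [∀ n, Module ℝ (𝔄 n)] [∀ n, Module R (𝔄 n)] [∀ n, IsScalarTower ℝ R (𝔄 n)]

namespace LieRinehart

variable (Λ : LieRinehart R Γ)

theorem bracket_self (x : Γ) : Λ.bracket x x = 0 := by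
  have h := Λ.skew x x
  have h2 : (2 : ℝ) • Λ.bracket x x = 0 := by
    rw [two_smul]; nth_rewrite 1 [h]; exact neg_add_cancel _
  exact (smul_eq_zero.1 h2).resolve_left two_ne_zero

theorem smul_bracket (x y : Γ) (f : R) :
    Λ.bracket (f • x) y = f • Λ.bracket x y - Λ.anchor y f • x := by
  rw [Λ.skew, Λ.leibniz, Λ.skew y x]
  simp only [smul_neg]; abel

end LieRinehart

namespace Contraction

variable (C : Contraction R Γ 𝔄)

open Classical in
/-- The form with prescribed contractions, if there is one. -/
noncomputable def uncurry (n : ℕ) (t : Γ → 𝔄 n) : 𝔄 (n + 1) :=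
  if h : ∃ a, ∀ x, C.ι n x a = t x then h.choose else 0

theorem ι_uncurry {n : ℕ} {t : Γ → 𝔄 n} (h : ∃ a, ∀ x, C.ι n x a = t x) (x : Γ) :
    C.ι n x (C.uncurry n t) = t x := by
  rw [uncurry, dif_pos h]; exact h.choose_spec x

theorem ext' {n : ℕ} {a b : 𝔄 (n + 1)} (h : ∀ x, C.ι n x a = C.ι n x b) : a = b :=
  sub_eq_zero.1 (C.ext n _ fun x => by rw [map_sub, h, sub_self])

variable (Λ : LieRinehart R Γ)

/-- The Lie derivative. -/
noncomputable def lieFun (x : Γ) : ∀ n, 𝔄 n → 𝔄 n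
  | 0, ξ => C.e0.symm (Λ.anchor x (C.e0 ξ))
  | n + 1, ξ => C.uncurry n fun y => lieFun x n (C.ι n y ξ) - C.ι n (Λ.bracket x y) ξ

/-- `lieFun` returns a junk value unless its prescribed contractions are `R`-linear and alternating
in y. Linearity uses the Leibniz rule one degree lower: the two terms `Λ.anchor x f • ι_y ξ`, one
from that rule and one from the bracket, cancel. The three assertions are therefore proved by a
joint induction. -/
theorem lieFun_spec (n : ℕ) :
    (∀ x (ξ η : 𝔄 n), C.lieFun Λ x n (ξ + η) = C.lieFun Λ x n ξ + C.lieFun Λ x n η) ∧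
    (∀ x (f : R) (ξ : 𝔄 n), C.lieFun Λ x n (f • ξ) = f • C.lieFun Λ x n ξ + Λ.anchor x f • ξ) ∧
    (∀ x y (ξ : 𝔄 (n + 1)), C.ι n y (C.lieFun Λ x (n + 1) ξ) =
      C.lieFun Λ x n (C.ι n y ξ) - C.ι n (Λ.bracket x y) ξ) := by
  have lin : ∀ n, (∀ x (ξ η : 𝔄 n), C.lieFun Λ x n (ξ + η) = C.lieFun Λ x n ξ + C.lieFun Λ x n η) →
      (∀ x (f : R) (ξ : 𝔄 n), C.lieFun Λ x n (f • ξ) = f • C.lieFun Λ x n ξ + Λ.anchor x f • ξ) →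
      ∀ x (ξ : 𝔄 (n + 1)), ∃ t : Γ →ₗ[R] 𝔄 n, ∀ y, t y =
        C.lieFun Λ x n (C.ι n y ξ) - C.ι n (Λ.bracket x y) ξ := by
    intro n h1 h2 x ξ
    refine ⟨{ toFun := fun y => C.lieFun Λ x n (C.ι n y ξ) - C.ι n (Λ.bracket x y) ξ
              map_add' := fun y z => ?_
              map_smul' := fun f y => ?_ }, fun y => rfl⟩
    · simp only [map_add, LinearMap.add_apply, h1]; abel
    · simp only [Λ.leibniz, map_add, map_smul, LinearMap.add_apply, LinearMap.smul_apply, h2,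
        RingHom.id_apply, smul_sub]
      abel
  induction n with
  | zero =>
    have h1 : ∀ x (ξ η : 𝔄 0), C.lieFun Λ x 0 (ξ + η) = C.lieFun Λ x 0 ξ + C.lieFun Λ x 0 η :=
      fun x ξ η => by simp [lieFun]
    have h2 : ∀ x (f : R) (ξ : 𝔄 0),
        C.lieFun Λ x 0 (f • ξ) = f • C.lieFun Λ x 0 ξ + Λ.anchor x f • ξ := fun x f ξ => by
      apply C.e0.injective
      simp [lieFun, mul_comm]
    refine ⟨h1, h2, fun x y ξ => ?_⟩
    obtain ⟨t, ht⟩ := lin 0 h1 h2 x ξ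
    obtain ⟨a, ha⟩ := C.exists_zero t
    exact C.ι_uncurry ⟨a, fun y => (ha y).trans (ht y)⟩ y
  | succ n ih =>
    obtain ⟨a1, a2, a3⟩ := ih
    have h1 : ∀ x (ξ η : 𝔄 (n + 1)),
        C.lieFun Λ x (n + 1) (ξ + η) = C.lieFun Λ x (n + 1) ξ + C.lieFun Λ x (n + 1) η :=
      fun x ξ η => C.ext' fun y => by simp only [map_add, a3, a1]; abel
    have h2 : ∀ x (f : R) (ξ : 𝔄 (n + 1)), C.lieFun Λ x (n + 1) (f • ξ) =
        f • C.lieFun Λ x (n + 1) ξ + Λ.anchor x f • ξ := fun x f ξ => C.ext' fun y => by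
      simp only [map_add, map_smul, a3, a2, smul_sub]; abel
    refine ⟨h1, h2, fun x y ξ => ?_⟩
    obtain ⟨t, ht⟩ := lin (n + 1) h1 h2 x ξ
    have h0 : C.lieFun Λ x n (0 : 𝔄 n) = 0 := by simpa using a1 x 0 0
    -- Alternation: what is left after contracting with y is `-(ι_[x,y] ι_y + ι_y ι_[x,y]) ξ`, which
    -- vanishes by polarizing `ι_ι` at y + [x,y].
    obtain ⟨a, ha⟩ := C.exists_succ n t fun y => by
      have h4 := C.ι_ι n (y + Λ.bracket x y) ξ
      simp only [map_add, LinearMap.add_apply, C.ι_ι, zero_add, add_zero] at h4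
      rw [ht, map_sub, a3, C.ι_ι, h0, zero_sub, sub_eq_add_neg, ← neg_add, h4, neg_zero]
    exact C.ι_uncurry ⟨a, fun y => (ha y).trans (ht y)⟩ y

/-- The Lie derivative as a linear map. -/
noncomputable def lie (x : Γ) (n : ℕ) : 𝔄 n →ₗ[ℝ] 𝔄 n where
  toFun := C.lieFun Λ x n
  map_add' := (C.lieFun_spec Λ n).1 x
  map_smul' c ξ := by
    rw [← algebraMap_smul R c ξ, (C.lieFun_spec Λ n).2.1, Derivation.map_algebraMap, zero_smul,
      add_zero, algebraMap_smul, RingHom.id_apply]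

theorem e0_lie (x : Γ) (ξ : 𝔄 0) : C.e0 (C.lie Λ x 0 ξ) = Λ.anchor x (C.e0 ξ) := by
  change C.e0 (C.lieFun Λ x 0 ξ) = _
  simp [lieFun]

theorem lie_smul (x : Γ) (n : ℕ) (f : R) (ξ : 𝔄 n) :
    C.lie Λ x n (f • ξ) = f • C.lie Λ x n ξ + Λ.anchor x f • ξ :=
  (C.lieFun_spec Λ n).2.1 x f ξ

theorem ι_lie (x y : Γ) (n : ℕ) (ξ : 𝔄 (n + 1)) :
    C.ι n y (C.lie Λ x (n + 1) ξ) = C.lie Λ x n (C.ι n y ξ) - C.ι n (Λ.bracket x y) ξ :=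
  (C.lieFun_spec Λ n).2.2 x y ξ

theorem lie_add (x y : Γ) (n : ℕ) (ξ : 𝔄 n) :
    C.lie Λ (x + y) n ξ = C.lie Λ x n ξ + C.lie Λ y n ξ := by
  induction n with
  | zero => apply C.e0.injective; simp [e0_lie]
  | succ n ih =>
    refine C.ext' fun z => ?_
    simp only [map_add, ι_lie, LinearMap.add_apply, ih]; abel

/-- The differential. -/
noncomputable def diffFun : ∀ n, 𝔄 n → 𝔄 (n + 1)
  | 0, ξ => C.uncurry 0 fun x => C.lie Λ x 0 ξ
  | n + 1, ξ => C.uncurry (n + 1) fun x => C.lie Λ x (n + 1) ξ - diffFun n (C.ι n x ξ)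

theorem ι_diffFun_zero (x : Γ) (ξ : 𝔄 0) : C.ι 0 x (C.diffFun Λ 0 ξ) = C.lie Λ x 0 ξ := by
  let t : Γ →ₗ[R] 𝔄 0 :=
    { toFun := fun x => C.lie Λ x 0 ξ
      map_add' := fun x y => C.lie_add Λ x y 0 ξ
      map_smul' := fun f x => C.e0.injective (by simp [e0_lie]) }
  obtain ⟨a, ha⟩ := C.exists_zero t
  exact C.ι_uncurry ⟨a, ha⟩ x

/-- As for `lieFun_spec`, the recursion is meaningful only if `L_x ξ - d ι_x ξ` is `R`-linear and
alternating in x. The middle assertion is exactly this linearity; both of its sides stand for `df ∧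
ι_x ξ`, written without a product. Alternation uses `[x,x] = 0` and the contraction formula one
degree lower. -/
theorem diffFun_spec (n : ℕ) :
    (∀ ξ η : 𝔄 n, C.diffFun Λ n (ξ + η) = C.diffFun Λ n ξ + C.diffFun Λ n η) ∧
    (∀ x (f : R) (ξ : 𝔄 (n + 1)), C.diffFun Λ n (f • C.ι n x ξ) - f • C.diffFun Λ n (C.ι n x ξ) =
      C.lie Λ (f • x) (n + 1) ξ - f • C.lie Λ x (n + 1) ξ) ∧
    (∀ x (ξ : 𝔄 (n + 1)), C.ι (n + 1) x (C.diffFun Λ (n + 1) ξ) =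
      C.lie Λ x (n + 1) ξ - C.diffFun Λ n (C.ι n x ξ)) := by
  have lin : ∀ n, (∀ ξ η : 𝔄 n, C.diffFun Λ n (ξ + η) = C.diffFun Λ n ξ + C.diffFun Λ n η) →
      (∀ x (f : R) (ξ : 𝔄 (n + 1)), C.diffFun Λ n (f • C.ι n x ξ) -
        f • C.diffFun Λ n (C.ι n x ξ) = C.lie Λ (f • x) (n + 1) ξ - f • C.lie Λ x (n + 1) ξ) →
      (∀ x (ξ : 𝔄 (n + 1)), C.ι n x (C.diffFun Λ n (C.ι n x ξ)) = C.lie Λ x n (C.ι n x ξ)) →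
      ∀ x (ξ : 𝔄 (n + 1)), C.ι (n + 1) x (C.diffFun Λ (n + 1) ξ) =
      C.lie Λ x (n + 1) ξ - C.diffFun Λ n (C.ι n x ξ) := by
    intro n h1 h2 h3 x ξ
    let t : Γ →ₗ[R] 𝔄 (n + 1) :=
      { toFun := fun x => C.lie Λ x (n + 1) ξ - C.diffFun Λ n (C.ι n x ξ)
        map_add' := fun x y => by
          simp only [lie_add, map_add, LinearMap.add_apply, h1]; abel
        map_smul' := fun f x => by
          have h := h2 x f ξ
          rw [sub_eq_sub_iff_add_eq_add] at h
          rw [map_smul, LinearMap.smul_apply, RingHom.id_apply, smul_sub,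
            sub_eq_sub_iff_add_eq_add]
          exact h.symm.trans (add_comm _ _) }
    obtain ⟨a, ha⟩ := C.exists_succ n t fun x => by
      change C.ι n x (C.lie Λ x (n + 1) ξ - C.diffFun Λ n (C.ι n x ξ)) = 0
      rw [map_sub, ι_lie, h3, Λ.bracket_self, map_zero, LinearMap.zero_apply, sub_zero, sub_self]
    exact C.ι_uncurry ⟨a, ha⟩ x
  induction n with
  | zero =>
    have h1 : ∀ ξ η : 𝔄 0, C.diffFun Λ 0 (ξ + η) = C.diffFun Λ 0 ξ + C.diffFun Λ 0 η :=
      fun ξ η => C.ext' fun x => by simp only [map_add, ι_diffFun_zero]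
    have h2 : ∀ x (f : R) (ξ : 𝔄 (0 + 1)), C.diffFun Λ 0 (f • C.ι 0 x ξ) -
        f • C.diffFun Λ 0 (C.ι 0 x ξ) = C.lie Λ (f • x) (0 + 1) ξ - f • C.lie Λ x (0 + 1) ξ :=
      fun x f ξ => C.ext' fun y => C.e0.injective (by
        simp only [map_sub, map_smul, ι_diffFun_zero, ι_lie, e0_lie, Λ.smul_bracket,
          LinearMap.sub_apply, LinearMap.smul_apply, Derivation.leibniz, smul_eq_mul,
          Derivation.smul_apply]
        ring)
    exact ⟨h1, h2, lin 0 h1 h2 fun x ξ => C.ι_diffFun_zero Λ x _⟩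
  | succ n ih =>
    obtain ⟨a1, a2, a3⟩ := ih
    have h1 : ∀ ξ η : 𝔄 (n + 1), C.diffFun Λ (n + 1) (ξ + η) =
        C.diffFun Λ (n + 1) ξ + C.diffFun Λ (n + 1) η :=
      fun ξ η => C.ext' fun x => by simp only [map_add, a3, a1]; abel
    have h0 : C.diffFun Λ n (0 : 𝔄 n) = 0 := by simpa using a1 0 0
    have hneg : ∀ ξ : 𝔄 n, C.diffFun Λ n (-ξ) = - C.diffFun Λ n ξ := fun ξ => by
      rw [eq_neg_iff_add_eq_zero, ← a1, neg_add_cancel, h0]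
    have h2 : ∀ x (f : R) (ξ : 𝔄 (n + 2)), C.diffFun Λ (n + 1) (f • C.ι (n + 1) x ξ) -
        f • C.diffFun Λ (n + 1) (C.ι (n + 1) x ξ) =
        C.lie Λ (f • x) (n + 2) ξ - f • C.lie Λ x (n + 2) ξ :=
      fun x f ξ => C.ext' fun y => by
        have h4 := C.ι_ι n (x + y) ξ
        simp only [map_add, LinearMap.add_apply, C.ι_ι, zero_add, add_zero] at h4
        have h5 : C.ι n y (C.ι (n + 1) x ξ) = - C.ι n x (C.ι (n + 1) y ξ) :=
          eq_neg_of_add_eq_zero_left h4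
        have h6 := a2 x f (C.ι (n + 1) y ξ)
        simp only [map_sub, map_smul, a3, ι_lie, Λ.smul_bracket, LinearMap.sub_apply,
          LinearMap.smul_apply, lie_smul, h5, smul_neg, hneg]
        rw [sub_eq_iff_eq_add] at h6
        rw [h6]
        simp only [smul_sub, smul_neg]
        abel
    refine ⟨h1, h2, lin (n + 1) h1 h2 fun x ξ => ?_⟩
    rw [a3, C.ι_ι, h0, sub_zero]

/-- The differential as a linear map. -/
noncomputable def diff (n : ℕ) : 𝔄 n →ₗ[ℝ] 𝔄 (n + 1) where
  toFun := C.diffFun Λ n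
  map_add' := (C.diffFun_spec Λ n).1
  map_smul' c ξ := by
    rw [RingHom.id_apply]
    induction n with
    | zero =>
      refine C.ext' fun x => ?_
      rw [← algebraMap_smul R c (C.diffFun Λ 0 ξ), map_smul, ι_diffFun_zero, ι_diffFun_zero,
        map_smul, algebraMap_smul]
    | succ n ih =>
      refine C.ext' fun x => ?_
      rw [← algebraMap_smul R c (C.diffFun Λ (n + 1) ξ), map_smul, (C.diffFun_spec Λ n).2.2,
        (C.diffFun_spec Λ n).2.2, map_smul, algebraMap_smul, smul_sub, ← ih,
        ← algebraMap_smul R c ξ, map_smul, algebraMap_smul]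

theorem ι_diff_zero (x : Γ) (ξ : 𝔄 0) : C.ι 0 x (C.diff Λ 0 ξ) = C.lie Λ x 0 ξ :=
  C.ι_diffFun_zero Λ x ξ

theorem ι_diff_succ (x : Γ) (n : ℕ) (ξ : 𝔄 (n + 1)) : C.ι (n + 1) x (C.diff Λ (n + 1) ξ) =
    C.lie Λ x (n + 1) ξ - C.diff Λ n (C.ι n x ξ) :=
  (C.diffFun_spec Λ n).2.2 x ξ

/-- The Lie derivative on all forms. -/
noncomputable def lieTot (x : Γ) : (⨁ n, 𝔄 n) →ₗ[ℝ] ⨁ n, 𝔄 n :=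
  DirectSum.lmap fun n => C.lie Λ x n

/-- The differential on all forms. -/
noncomputable def diffTot : (⨁ n, 𝔄 n) →ₗ[ℝ] ⨁ n, 𝔄 n :=
  DirectSum.toModule ℝ ℕ _ fun n => DirectSum.lof ℝ ℕ 𝔄 (n + 1) ∘ₗ C.diff Λ n

@[simp]
theorem lieTot_lof (x : Γ) (n : ℕ) (ξ : 𝔄 n) : C.lieTot Λ x (DirectSum.lof ℝ ℕ 𝔄 n ξ) =
    DirectSum.lof ℝ ℕ 𝔄 n (C.lie Λ x n ξ) := by
  simp [lieTot]

@[simp]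
theorem diffTot_lof (n : ℕ) (ξ : 𝔄 n) : C.diffTot Λ (DirectSum.lof ℝ ℕ 𝔄 n ξ) =
    DirectSum.lof ℝ ℕ 𝔄 (n + 1) (C.diff Λ n ξ) := by
  simp [diffTot]

theorem diffTot_degree_one (n : ℕ) (a : 𝔄 n) : ∃ b : 𝔄 (n + 1),
    C.diffTot Λ (DirectSum.lof ℝ ℕ 𝔄 n a) = DirectSum.lof ℝ ℕ 𝔄 (n + 1) b :=
  ⟨_, C.diffTot_lof Λ n a⟩

theorem gradInv_lieTot (x : Γ) (a : ⨁ n, 𝔄 n) :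
    gradInv 𝔄 (C.lieTot Λ x a) = C.lieTot Λ x (gradInv 𝔄 a) :=
  linearMap_ext_lof (S := gradInv 𝔄 ∘ₗ C.lieTot Λ x) (T := C.lieTot Λ x ∘ₗ gradInv 𝔄)
    (fun n a => by simp) a

theorem tot_lieTot (x y : Γ) (a : ⨁ n, 𝔄 n) :
    C.tot y (C.lieTot Λ x a) = C.lieTot Λ x (C.tot y a) - C.tot (Λ.bracket x y) a := by
  refine linearMap_ext_lof (S := C.tot y ∘ₗ C.lieTot Λ x)
    (T := C.lieTot Λ x ∘ₗ C.tot y - C.tot (Λ.bracket x y)) (fun n a => ?_) a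
  cases n with
  | zero => simp
  | succ n => simp [ι_lie]

theorem tot_diffTot (x : Γ) (a : ⨁ n, 𝔄 n) :
    C.tot x (C.diffTot Λ a) = C.lieTot Λ x a - C.diffTot Λ (C.tot x a) := by
  refine linearMap_ext_lof (S := C.tot x ∘ₗ C.diffTot Λ)
    (T := C.lieTot Λ x - C.diffTot Λ ∘ₗ C.tot x) (fun n a => ?_) a
  cases n with
  | zero => simp [ι_diff_zero]
  | succ n => simp [ι_diff_succ]

theorem ev0_lieTot (x : Γ) (a : ⨁ n, 𝔄 n) : C.ev0 (C.lieTot Λ x a) = Λ.anchor x (C.ev0 a) := by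
  refine linearMap_ext_lof (S := C.ev0 ∘ₗ C.lieTot Λ x)
    (T := (Λ.anchor x).toLinearMap ∘ₗ C.ev0) (fun n a => ?_) a
  cases n with
  | zero => simp [e0_lie]
  | succ n => simp

theorem ev0_diffTot (a : ⨁ n, 𝔄 n) : C.ev0 (C.diffTot Λ a) = 0 :=
  C.ev0_raise (C.diffTot_degree_one Λ) a

theorem gradInv_diffTot (a : ⨁ n, 𝔄 n) :
    gradInv 𝔄 (C.diffTot Λ a) = - C.diffTot Λ (gradInv 𝔄 a) :=
  gradInv_raise (C.diffTot_degree_one Λ) a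

/-- Contracting the difference with z reproduces it on `ι_z a`, up to contraction with a Jacobi
expression that vanishes. On scalars it is compatibility of the anchor with brackets. -/
theorem lieTot_comm (x y : Γ) (a : ⨁ n, 𝔄 n) :
    C.lieTot Λ x (C.lieTot Λ y a) - C.lieTot Λ y (C.lieTot Λ x a) =
      C.lieTot Λ (Λ.bracket x y) a := by
  refine sub_eq_zero.1 (C.linear_induction (C.lieTot Λ x ∘ₗ C.lieTot Λ y -
    C.lieTot Λ y ∘ₗ C.lieTot Λ x - C.lieTot Λ (Λ.bracket x y)) (fun n a h => ?_) a)
  simp only [LinearMap.sub_apply, LinearMap.comp_apply] at h ⊢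
  refine C.tot_ext ?_ fun z => ?_
  · simp only [map_sub, ev0_lieTot, Λ.anchor_bracket, sub_self]
  · have hz := h z
    have hj : Λ.bracket (Λ.bracket x y) z =
        Λ.bracket x (Λ.bracket y z) - Λ.bracket y (Λ.bracket x z) := by
      have := Λ.jacobi x y z
      rw [Λ.skew _ z, Λ.skew x z, map_neg, sub_neg_eq_add]
      exact (eq_neg_of_add_eq_zero_left this).symm
    simp only [map_sub, tot_lieTot, hj, tot_sub, LinearMap.sub_apply] at hz ⊢
    refine Eq.trans ?_ hz
    abel

/-- By `lieTot_comm`, the commutator `[L_x, d]` anticommutes with every contraction, and its values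
have no scalar part. -/
theorem lieTot_diffTot (x : Γ) (a : ⨁ n, 𝔄 n) :
    C.lieTot Λ x (C.diffTot Λ a) = C.diffTot Λ (C.lieTot Λ x a) := by
  refine sub_eq_zero.1 (C.linear_induction (C.lieTot Λ x ∘ₗ C.diffTot Λ -
    C.diffTot Λ ∘ₗ C.lieTot Λ x) (fun n a h => ?_) a)
  simp only [LinearMap.sub_apply, LinearMap.comp_apply] at h ⊢
  refine C.tot_ext ?_ fun y => ?_
  · simp only [map_sub, ev0_lieTot, ev0_diffTot, map_zero, sub_self]
  · have hc := C.lieTot_comm Λ x y (DirectSum.lof ℝ ℕ 𝔄 n a)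
    simp only [map_sub, tot_lieTot, tot_diffTot, ← hc]
    refine Eq.trans ?_ (neg_eq_zero.2 (h y))
    abel

/-- Since `L_y` commutes with `d`, the operator `d²` commutes with `ι_y`, so it vanishes by
induction on the degree. -/
theorem diffTot_diffTot (a : ⨁ n, 𝔄 n) : C.diffTot Λ (C.diffTot Λ a) = 0 := by
  refine C.linear_induction (C.diffTot Λ ∘ₗ C.diffTot Λ) (fun n a h => ?_) a
  simp only [LinearMap.comp_apply] at h ⊢
  refine C.tot_ext (C.ev0_diffTot Λ _) fun y => ?_
  simp only [map_sub, tot_diffTot, lieTot_diffTot, h y]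
  abel

variable {C} {mul : ∀ p q, 𝔄 p →ₗ[ℝ] 𝔄 q →ₗ[ℝ] 𝔄 (p + q)}

/-- A bilinear map `μ` and linear maps `T`, `S`, `U` combine to `T (a b) - (S a) b - a' (U b)`. -/
noncomputable def derivDefect (mul : ∀ p q, 𝔄 p →ₗ[ℝ] 𝔄 q →ₗ[ℝ] 𝔄 (p + q))
    (T σ : (⨁ n, 𝔄 n) →ₗ[ℝ] ⨁ n, 𝔄 n) : (⨁ n, 𝔄 n) →ₗ[ℝ] (⨁ n, 𝔄 n) →ₗ[ℝ] ⨁ n, 𝔄 n :=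
  LinearMap.mk₂ ℝ (fun a b => T (totalMul mul a b) - totalMul mul (T a) b -
      totalMul mul (σ a) (T b))
    (fun a a' b => by simp only [map_add, LinearMap.add_apply]; abel)
    (fun c a b => by simp only [map_smul, LinearMap.smul_apply, smul_sub])
    (fun a b b' => by simp only [map_add]; abel)
    (fun c a b => by simp only [map_smul, smul_sub])

theorem derivDefect_apply (T σ : (⨁ n, 𝔄 n) →ₗ[ℝ] ⨁ n, 𝔄 n) (a b : ⨁ n, 𝔄 n) :
    derivDefect mul T σ a b = T (totalMul mul a b) - totalMul mul (T a) b -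
      totalMul mul (σ a) (T b) := rfl

/-- The Leibniz defect of `L_x`, contracted with y, is the sum of the defects with one argument
contracted; the terms with `ι_[x,y]` cancel because `ι_[x,y]` is itself an antiderivation. -/
theorem IsWedge.lieTot_mul (hC : C.IsWedge mul) (x : Γ) (a b : ⨁ n, 𝔄 n) :
    C.lieTot Λ x (totalMul mul a b) =
      totalMul mul (C.lieTot Λ x a) b + totalMul mul a (C.lieTot Λ x b) := by
  have h0 := C.bilinear_induction (derivDefect mul (C.lieTot Λ x) LinearMap.id)
    (fun p q a b h1 h2 => ?_) a b
  · rw [derivDefect_apply, sub_sub, sub_eq_zero] at h0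
    exact h0
  · simp only [derivDefect_apply, LinearMap.id_apply] at h1 h2 ⊢
    refine C.tot_ext ?_ fun y => ?_
    · simp only [map_sub, ev0_lieTot, hC.ev0_mul, Derivation.leibniz, smul_eq_mul]
      ring
    · have e1 := h1 y
      -- The factor (-1)^p is the sign with which a contraction passes `a` to reach `b`.
      have e2 := congrArg (fun z => (-1 : ℝ) ^ p • z) (h2 y)
      simp only [map_sub, tot_lieTot, hC.tot_mul, map_add, LinearMap.sub_apply, gradInv_lieTot,
        gradInv_lof, map_smul, LinearMap.smul_apply, smul_sub, smul_zero] at e1 e2 ⊢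
      refine Eq.trans ?_ ((congrArg₂ (· + ·) e1 e2).trans (add_zero _))
      abel

/-- Once `L_y` is known to be a derivation, contracting the Leibniz defect of `d` gives minus the
sum of the defects with one argument contracted. -/
theorem IsWedge.diffTot_mul (hC : C.IsWedge mul) (a b : ⨁ n, 𝔄 n) :
    C.diffTot Λ (totalMul mul a b) =
      totalMul mul (C.diffTot Λ a) b + totalMul mul (gradInv 𝔄 a) (C.diffTot Λ b) := by
  have h0 := C.bilinear_induction (derivDefect mul (C.diffTot Λ) (gradInv 𝔄))
    (fun p q a b h1 h2 => ?_) a b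
  · rw [derivDefect_apply, sub_sub, sub_eq_zero] at h0
    exact h0
  · simp only [derivDefect_apply] at h1 h2 ⊢
    refine C.tot_ext ?_ fun y => ?_
    · simp only [map_sub, ev0_diffTot, hC.ev0_mul]
      ring
    · have e1 := h1 y
      have e2 := congrArg (fun z => (-1 : ℝ) ^ p • z) (h2 y)
      have e3 : ∀ a : ⨁ n, 𝔄 n, gradInv 𝔄 (C.tot y a) = - C.tot y (gradInv 𝔄 a) := fun a => by
        rw [tot_gradInv, neg_neg]
      have e4 : (-1 : ℝ) ^ p * (-1 : ℝ) ^ p = 1 := by rw [← mul_pow]; simp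
      simp only [map_sub, tot_diffTot, hC.tot_mul, map_add, LinearMap.sub_apply, gradInv_diffTot,
        gradInv_lof, map_smul, LinearMap.smul_apply, smul_sub, smul_zero, map_neg,
        LinearMap.neg_apply, e3, hC.lieTot_mul, smul_add, smul_smul, e4, one_smul] at e1 e2 ⊢
      refine Eq.trans ?_ (neg_eq_zero.2 ((congrArg₂ (· + ·) e1 e2).trans (add_zero _)))
      abel

end Contraction
end HomLie

/-! ### From a square-zero derivation to a Lie–Rinehart structure. -/

namespace HomLie

variable {R Γ : Type*} [CommRing R] [Algebra ℝ R] [AddCommGroup Γ] [Module ℝ Γ] [Module R Γ]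
  [IsScalarTower ℝ R Γ] {𝔄 : ℕ → Type*} [∀ n, AddCommGroup (𝔄 n)]
  [∀ n, Module ℝ (𝔄 n)] [∀ n, Module R (𝔄 n)] [∀ n, IsScalarTower ℝ R (𝔄 n)]

/-- A derivation of degree one and square zero of the graded algebra of forms. -/
structure DGDerivation (mul : ∀ p q, 𝔄 p →ₗ[ℝ] 𝔄 q →ₗ[ℝ] 𝔄 (p + q)) where
  /-- the derivation -/
  D : (⨁ n, 𝔄 n) →ₗ[ℝ] ⨁ n, 𝔄 n
  degree_one : ∀ n (a : 𝔄 n), ∃ b : 𝔄 (n + 1),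
    D (DirectSum.lof ℝ ℕ 𝔄 n a) = DirectSum.lof ℝ ℕ 𝔄 (n + 1) b
  leibniz : ∀ a b, D (totalMul mul a b) = totalMul mul (D a) b + totalMul mul (gradInv 𝔄 a) (D b)
  sq_zero : ∀ a, D (D a) = 0

namespace Contraction

variable (C : Contraction R Γ 𝔄)

/-- The differential of a Lie–Rinehart structure. -/
noncomputable def toDG {C : Contraction R Γ 𝔄} {mul : ∀ p q, 𝔄 p →ₗ[ℝ] 𝔄 q →ₗ[ℝ] 𝔄 (p + q)}
    (hC : C.IsWedge mul) (Λ : LieRinehart R Γ) : DGDerivation mul where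
  D := C.diffTot Λ
  degree_one := C.diffTot_degree_one Λ
  leibniz := hC.diffTot_mul Λ
  sq_zero := C.diffTot_diffTot Λ

/-- The value of a one-form. -/
noncomputable def pair (x : Γ) : 𝔄 1 →ₗ[R] R := C.e0.toLinearMap ∘ₗ C.ι 0 x

theorem ev0_tot_lof_one (x : Γ) (θ : 𝔄 1) :
    C.ev0 (C.tot x (DirectSum.lof ℝ ℕ 𝔄 1 θ)) = C.pair x θ := by
  rw [tot_lof_succ, ev0_lof_zero]; rfl

theorem pair_add (x y : Γ) (θ : 𝔄 1) : C.pair (x + y) θ = C.pair x θ + C.pair y θ := by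
  simp [pair]

theorem pair_smul (f : R) (x : Γ) (θ : 𝔄 1) : C.pair (f • x) θ = f * C.pair x θ := by
  simp [pair]

/-- `χ` times the identity of `Γ` has a finite dual basis. -/
def IsCutoff (χ : R) : Prop :=
  ∃ (k : ℕ) (θ : Fin k → 𝔄 1) (e : Fin k → Γ), ∀ x, ∑ i, C.pair x (θ i) • e i = χ • x

/-- `Γ` is reflexive and locally finitely generated projective. -/
structure IsReflexive : Prop where
  exists_pair : ∀ Φ : 𝔄 1 →ₗ[R] R, ∃ x, ∀ θ, Φ θ = C.pair x θ
  eq_zero_of_pair : ∀ x, (∀ θ, C.pair x θ = 0) → x = 0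
  eq_zero_of_cutoff : ∀ f : R, (∀ χ, C.IsCutoff χ → χ * f = 0) → f = 0

variable {C}

theorem IsReflexive.eq_of_pair (hR : C.IsReflexive) {x y : Γ} (h : ∀ θ, C.pair x θ = C.pair y θ) :
    x = y := by
  refine sub_eq_zero.1 (hR.eq_zero_of_pair _ fun θ => ?_)
  have := C.pair_add (x - y) y θ
  rw [sub_add_cancel, h] at this
  exact (right_eq_add.1 this)

/-- The definition lets cutoffs detect zero only in `R`; iterated contraction commutes with
multiplication by a cutoff and carries this to every degree. -/
theorem IsReflexive.eq_zero_of_smul (hR : C.IsReflexive) {a : ⨁ n, 𝔄 n}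
    (h : ∀ χ, C.IsCutoff χ → χ • a = 0) : a = 0 := by
  refine sub_eq_zero.1 ?_
  have key : ∀ n (a : 𝔄 n), (∀ χ, C.IsCutoff χ → χ • a = 0) → a = 0 := by
    intro n
    induction n with
    | zero =>
      intro a h
      refine C.e0.injective ((hR.eq_zero_of_cutoff _ fun χ hχ => ?_).trans (map_zero _).symm)
      rw [← smul_eq_mul, ← map_smul, h χ hχ, map_zero]
    | succ n ih =>
      intro a h
      refine C.ext n a fun x => ih _ fun χ hχ => ?_
      rw [← map_smul, h χ hχ, map_zero]
  rw [sub_zero]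
  refine DFinsupp.ext fun n => key n (a n) fun χ hχ => ?_
  have := congrArg (fun b => b n) (h χ hχ)
  exact this

/-- Euler's identity for a form of degree `n`. -/
theorem IsWedge.sum_mul_tot {mul : ∀ p q, 𝔄 p →ₗ[ℝ] 𝔄 q →ₗ[ℝ] 𝔄 (p + q)} (hC : C.IsWedge mul)
    {χ : R} {k : ℕ} {θ : Fin k → 𝔄 1} {e : Fin k → Γ}
    (h : ∀ x, ∑ i, C.pair x (θ i) • e i = χ • x) (n : ℕ) (a : 𝔄 n) :
    ∑ i, totalMul mul (DirectSum.lof ℝ ℕ 𝔄 1 (θ i)) (C.tot (e i) (DirectSum.lof ℝ ℕ 𝔄 n a)) =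
      (n : ℝ) • χ • DirectSum.lof ℝ ℕ 𝔄 n a := by
  induction n with
  | zero => simp
  | succ n ih =>
    refine sub_eq_zero.1 (C.tot_ext ?_ fun x => ?_)
    · have h0 : ∀ i, C.ev0 (DirectSum.lof ℝ ℕ 𝔄 1 (θ i)) = 0 := fun i => ev0_lof_succ C 0 _
      simp only [map_sub, map_sum, hC.ev0_mul, h0, zero_mul, Finset.sum_const_zero, map_smul,
        C.ev0_smul, ev0_lof_succ, mul_zero, smul_zero, sub_zero]
    -- Contracting with x, the terms where x meets `θ i` add up to `χ • ι_x a` by the dual basis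
    -- property, and the others are the case of degree n. Thus the factor grows from n to n + 1.
    · have h1 : ∀ i, C.tot x (totalMul mul (DirectSum.lof ℝ ℕ 𝔄 1 (θ i))
          (C.tot (e i) (DirectSum.lof ℝ ℕ 𝔄 (n + 1) a))) =
          C.pair x (θ i) • C.tot (e i) (DirectSum.lof ℝ ℕ 𝔄 (n + 1) a) +
          totalMul mul (DirectSum.lof ℝ ℕ 𝔄 1 (θ i))
            (C.tot (e i) (DirectSum.lof ℝ ℕ 𝔄 n (C.ι n x a))) := fun i => by
        rw [hC.tot_mul, tot_lof_succ C x 0, lof_zero_eq_scalar (C := C), hC.scalar_mul,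
          gradInv_lof, pow_one, tot_anticomm, tot_lof_succ C x n]
        simp only [map_neg, LinearMap.neg_apply, neg_smul, one_smul, neg_neg]
        rfl
      have h2 : ∑ i, C.pair x (θ i) • C.tot (e i) (DirectSum.lof ℝ ℕ 𝔄 (n + 1) a) =
          χ • C.tot x (DirectSum.lof ℝ ℕ 𝔄 (n + 1) a) := by
        rw [← tot_smul, ← h x]
        let S : Γ →+ ⨁ n, 𝔄 n := AddMonoidHom.mk'
          (fun z => C.tot z (DirectSum.lof ℝ ℕ 𝔄 (n + 1) a)) fun z w => by rw [tot_add]; rfl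
        have hS : ∀ z, S z = C.tot z (DirectSum.lof ℝ ℕ 𝔄 (n + 1) a) := fun _ => rfl
        rw [← hS, map_sum]
        simp only [hS, tot_smul]
      rw [map_sub, map_sum, Finset.sum_congr rfl fun i _ => h1 i, Finset.sum_add_distrib, h2, ih,
        map_smul, tot_apply_smul, tot_lof_succ]
      push_cast
      rw [add_smul, one_smul]
      abel

end Contraction

open Contraction

namespace DGDerivation

variable {C : Contraction R Γ 𝔄} {mul : ∀ p q, 𝔄 p →ₗ[ℝ] 𝔄 q →ₗ[ℝ] 𝔄 (p + q)}
  (hC : C.IsWedge mul) (hR : C.IsReflexive) (δ : DGDerivation mul)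

theorem gradInv_D (a : ⨁ n, 𝔄 n) : gradInv 𝔄 (δ.D a) = - δ.D (gradInv 𝔄 a) :=
  gradInv_raise δ.degree_one a

theorem D_smul (hC : C.IsWedge mul) (δ : DGDerivation mul) (f : R) (a : ⨁ n, 𝔄 n) :
    δ.D (f • a) = totalMul mul (δ.D (C.scalar f)) a + f • δ.D a := by
  rw [← hC.scalar_mul, δ.leibniz, gradInv_scalar, hC.scalar_mul]

theorem scalar_add (f g : R) : C.scalar (f + g) = C.scalar f + C.scalar g := by
  simp [Contraction.scalar]

theorem scalar_smul (c : ℝ) (f : R) : C.scalar (c • f) = c • C.scalar f := by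
  rw [Contraction.scalar, ← algebraMap_smul R c f, map_smul, algebraMap_smul, map_smul]; rfl

theorem scalar_mul_scalar (f g : R) : C.scalar (f * g) = f • C.scalar g := by
  rw [Contraction.scalar, ← smul_eq_mul, map_smul, lof_smul]; rfl

theorem tot_D_scalar (δ : DGDerivation mul) (x : Γ) (f : R) :
    C.tot x (δ.D (C.scalar f)) = C.scalar (C.ev0 (C.tot x (δ.D (C.scalar f)))) := by
  obtain ⟨b, hb⟩ := δ.degree_one 0 (C.e0.symm f)
  rw [Contraction.scalar, hb, tot_lof_succ, lof_zero_eq_scalar (C := C), ev0_scalar]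

/-- The derivation `f ↦ (D f)(x)`. -/
noncomputable def anchorDer (x : Γ) : Derivation ℝ R R :=
  Derivation.mk'
    { toFun := fun f => C.ev0 (C.tot x (δ.D (C.scalar f)))
      map_add' := fun f g => by simp only [scalar_add, map_add]
      map_smul' := fun c f => by simp only [scalar_smul, map_smul, RingHom.id_apply] }
    (fun f g => by
      change C.ev0 (C.tot x (δ.D (C.scalar (f * g)))) =
        f * C.ev0 (C.tot x (δ.D (C.scalar g))) + g * C.ev0 (C.tot x (δ.D (C.scalar f)))
      rw [scalar_mul_scalar, δ.D_smul hC, map_add, hC.mul_scalar, tot_apply_smul, tot_apply_smul,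
        map_add, C.ev0_smul, C.ev0_smul, add_comm])

/-- The anchor of a derivation. -/
noncomputable def anchor : Γ →ₗ[R] Derivation ℝ R R where
  toFun := δ.anchorDer hC
  map_add' x y := Derivation.ext fun f => by
    change C.ev0 (C.tot (x + y) _) = C.ev0 (C.tot x _) + C.ev0 (C.tot y _)
    rw [tot_add, LinearMap.add_apply, map_add]
  map_smul' g x := Derivation.ext fun f => by
    change C.ev0 (C.tot (g • x) _) = g * C.ev0 (C.tot x _)
    rw [tot_smul, C.ev0_smul]

theorem anchor_apply (x : Γ) (f : R) :
    δ.anchor hC x f = C.ev0 (C.tot x (δ.D (C.scalar f))) := rfl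

theorem scalar_anchor (x : Γ) (f : R) :
    C.scalar (δ.anchor hC x f) = C.tot x (δ.D (C.scalar f)) :=
  (tot_D_scalar δ x f).symm

/-- The functional on one-forms that the bracket represents. -/
noncomputable def bracketFunctional (x y : Γ) : 𝔄 1 →ₗ[R] R where
  toFun θ := δ.anchor hC x (C.pair y θ) - δ.anchor hC y (C.pair x θ) -
    C.ev0 (C.tot y (C.tot x (δ.D (DirectSum.lof ℝ ℕ 𝔄 1 θ))))
  map_add' θ η := by simp only [map_add]; ring
  -- The derivatives of `f` produced by the first two terms are cancelled by the value of `Df ∧ θ`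
  -- on (x, y).
  map_smul' f θ := by
    simp only [map_smul, lof_smul, δ.D_smul hC, map_add, hC.tot_mul, δ.gradInv_D, gradInv_scalar,
      map_neg, LinearMap.neg_apply, tot_lof_succ C _ 0, lof_zero_eq_scalar (C := C),
      hC.mul_scalar, tot_apply_smul, C.ev0_smul, smul_eq_mul, Derivation.leibniz,
      ← δ.scalar_anchor hC, hC.scalar_mul, RingHom.id_apply, ev0_scalar]
    simp only [Contraction.pair, LinearMap.comp_apply, LinearEquiv.coe_coe]
    ring

/-- The bracket of a derivation. -/
noncomputable def bracketFun (x y : Γ) : Γ := (hR.exists_pair (δ.bracketFunctional hC x y)).choose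

theorem pair_bracketFun (x y : Γ) (θ : 𝔄 1) : C.pair (δ.bracketFun hC hR x y) θ =
    δ.anchor hC x (C.pair y θ) - δ.anchor hC y (C.pair x θ) -
      C.ev0 (C.tot y (C.tot x (δ.D (DirectSum.lof ℝ ℕ 𝔄 1 θ)))) :=
  ((hR.exists_pair (δ.bracketFunctional hC x y)).choose_spec θ).symm

theorem pair_real_smul (c : ℝ) (x : Γ) (θ : 𝔄 1) : C.pair (c • x) θ = c • C.pair x θ := by
  rw [← algebraMap_smul R c x, pair_smul, Algebra.smul_def]

/-- The bracket of a derivation, as a bilinear map. -/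
noncomputable def bracket : Γ →ₗ[ℝ] Γ →ₗ[ℝ] Γ :=
  LinearMap.mk₂ ℝ (δ.bracketFun hC hR)
    (fun x x' y => hR.eq_of_pair fun θ => by
      simp only [pair_bracketFun, pair_add, map_add, Derivation.add_apply, tot_add,
        LinearMap.add_apply]
      ring)
    (fun c x y => hR.eq_of_pair fun θ => by
      simp only [pair_bracketFun, pair_real_smul, ← algebraMap_smul R c x, map_smul,
        Derivation.smul_apply, tot_smul, tot_apply_smul, C.ev0_smul, pair_smul, smul_eq_mul,
        Derivation.leibniz, Derivation.map_algebraMap, Algebra.smul_def]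
      ring)
    (fun x y y' => hR.eq_of_pair fun θ => by
      simp only [pair_bracketFun, pair_add, map_add, Derivation.add_apply, tot_add,
        LinearMap.add_apply]
      ring)
    (fun c x y => hR.eq_of_pair fun θ => by
      simp only [pair_bracketFun, pair_real_smul, ← algebraMap_smul R c y, map_smul,
        Derivation.smul_apply, tot_smul, C.ev0_smul, pair_smul, smul_eq_mul,
        Derivation.leibniz, Derivation.map_algebraMap, Algebra.smul_def]
      ring)

theorem pair_bracket (x y : Γ) (θ : 𝔄 1) : C.pair (δ.bracket hC hR x y) θ =
    δ.anchor hC x (C.pair y θ) - δ.anchor hC y (C.pair x θ) -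
      C.ev0 (C.tot y (C.tot x (δ.D (DirectSum.lof ℝ ℕ 𝔄 1 θ)))) :=
  δ.pair_bracketFun hC hR x y θ

/-- The Lie derivative of a derivation, by Cartan's formula. -/
noncomputable def lie (C : Contraction R Γ 𝔄) (x : Γ) : (⨁ n, 𝔄 n) →ₗ[ℝ] ⨁ n, 𝔄 n :=
  C.tot x ∘ₗ δ.D + δ.D ∘ₗ C.tot x

theorem lie_apply (x : Γ) (a : ⨁ n, 𝔄 n) : δ.lie C x a = C.tot x (δ.D a) + δ.D (C.tot x a) := rfl

/-- The graded commutator of two odd derivations is an even derivation. -/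
theorem lie_mul (hC : C.IsWedge mul) (δ : DGDerivation mul) (x : Γ) (a b : ⨁ n, 𝔄 n) :
    δ.lie C x (totalMul mul a b) =
      totalMul mul (δ.lie C x a) b + totalMul mul a (δ.lie C x b) := by
  simp only [lie_apply, δ.leibniz, hC.tot_mul, map_add, gradInv_D, LinearMap.add_apply, map_neg,
    LinearMap.neg_apply, C.tot_gradInv, gradInv_gradInv]
  abel

theorem gradInv_lie (x : Γ) (a : ⨁ n, 𝔄 n) :
    gradInv 𝔄 (δ.lie C x a) = δ.lie C x (gradInv 𝔄 a) := by
  have h : ∀ a, gradInv 𝔄 (C.tot x a) = - C.tot x (gradInv 𝔄 a) := fun a => by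
    rw [C.tot_gradInv, neg_neg]
  simp only [lie_apply, map_add, h, gradInv_D, map_neg, neg_neg]

theorem lie_scalar (x : Γ) (f : R) : δ.lie C x (C.scalar f) = C.scalar (δ.anchor hC x f) := by
  rw [lie_apply, tot_scalar, map_zero, add_zero, scalar_anchor]

theorem lie_lof (C : Contraction R Γ 𝔄) (δ : DGDerivation mul) (x : Γ) (n : ℕ) (a : 𝔄 n) :
    ∃ b : 𝔄 n, δ.lie C x (DirectSum.lof ℝ ℕ 𝔄 n a) = DirectSum.lof ℝ ℕ 𝔄 n b := by
  obtain ⟨b, hb⟩ := δ.degree_one n a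
  rw [lie_apply, hb, tot_lof_succ]
  cases n with
  | zero => exact ⟨C.ι 0 x b, by simp⟩
  | succ n =>
    obtain ⟨c, hc⟩ := δ.degree_one n (C.ι n x a)
    exact ⟨C.ι (n + 1) x b + c, by rw [tot_lof_succ, hc, map_add]⟩

/-- The failure of `[L_x, ι_y] = ι_{[x, y]}`. -/
noncomputable def defect (x y : Γ) : (⨁ n, 𝔄 n) →ₗ[ℝ] ⨁ n, 𝔄 n :=
  δ.lie C x ∘ₗ C.tot y - C.tot y ∘ₗ δ.lie C x - C.tot (δ.bracket hC hR x y)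

theorem defect_apply (x y : Γ) (a : ⨁ n, 𝔄 n) : δ.defect hC hR x y a =
    δ.lie C x (C.tot y a) - C.tot y (δ.lie C x a) - C.tot (δ.bracket hC hR x y) a := rfl

/-- The commutator of an even derivation with an odd one is odd, and the contraction subtracted from
it is odd too. -/
theorem defect_mul (x y : Γ) (a b : ⨁ n, 𝔄 n) : δ.defect hC hR x y (totalMul mul a b) =
    totalMul mul (δ.defect hC hR x y a) b +
      totalMul mul (gradInv 𝔄 a) (δ.defect hC hR x y b) := by
  simp only [defect_apply, δ.lie_mul hC, hC.tot_mul, map_add, map_sub, LinearMap.sub_apply,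
    gradInv_lie]
  abel

theorem defect_zero (x y : Γ) (a : 𝔄 0) :
    δ.defect hC hR x y (DirectSum.lof ℝ ℕ 𝔄 0 a) = 0 := by
  rw [lof_zero_eq_scalar (C := C)]
  simp only [defect_apply, tot_scalar, δ.lie_scalar hC, map_zero, sub_zero]

/-- On one-forms the claim unwinds to the Koszul formula by which the bracket was defined. -/
theorem defect_one (x y : Γ) (θ : 𝔄 1) :
    δ.defect hC hR x y (DirectSum.lof ℝ ℕ 𝔄 1 θ) = 0 := by
  have h1 : ∀ z, C.tot z (DirectSum.lof ℝ ℕ 𝔄 1 θ) = C.scalar (C.pair z θ) := fun z => by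
    rw [tot_lof_succ C z 0, lof_zero_eq_scalar (C := C)]; rfl
  have h2 : C.tot y (C.tot x (δ.D (DirectSum.lof ℝ ℕ 𝔄 1 θ))) =
      C.scalar (C.ev0 (C.tot y (C.tot x (δ.D (DirectSum.lof ℝ ℕ 𝔄 1 θ))))) := by
    obtain ⟨b, hb⟩ := δ.degree_one 1 θ
    rw [hb, tot_lof_succ C _ 1, tot_lof_succ C _ 0, lof_zero_eq_scalar (C := C), ev0_scalar]
  have h3 : ∀ f g : R, C.scalar (f - g) = C.scalar f - C.scalar g := fun f g => by
    rw [eq_sub_iff_add_eq, ← scalar_add, sub_add_cancel]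
  rw [defect_apply, h1, h1, pair_bracket, δ.lie_scalar hC, lie_apply, h1, map_add,
    ← δ.scalar_anchor hC, h3, h3, ← h2]
  abel

/-- Functions and one-forms generate only locally, so the argument is multiplied by a cutoff χ.
Euler's identity writes (n+1)χa as a sum of products `θ_i ∧ ι_{e_i} a`, on which the antiderivation
vanishes by the case of one-forms and by induction. Hence χ kills the defect of `a`, for every
cutoff χ. -/
theorem defect_eq_zero (x y : Γ) (a : ⨁ n, 𝔄 n) : δ.defect hC hR x y a = 0 := by
  have key : ∀ n (a : 𝔄 n), δ.defect hC hR x y (DirectSum.lof ℝ ℕ 𝔄 n a) = 0 := by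
    intro n
    induction n with
    | zero => exact δ.defect_zero hC hR x y
    | succ n ih =>
      intro a
      refine hR.eq_zero_of_smul fun χ hχ => ?_
      obtain ⟨k, θ, e, h⟩ := hχ
      have h1 := congrArg (δ.defect hC hR x y) (hC.sum_mul_tot h (n + 1) a)
      have h2 : ∀ i, δ.defect hC hR x y (totalMul mul (DirectSum.lof ℝ ℕ 𝔄 1 (θ i))
          (C.tot (e i) (DirectSum.lof ℝ ℕ 𝔄 (n + 1) a))) = 0 := fun i => by
        rw [defect_mul, defect_one, map_zero, LinearMap.zero_apply, zero_add, tot_lof_succ, ih,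
          map_zero]
      rw [map_sum, Finset.sum_eq_zero fun i _ => h2 i, map_smul, ← hC.scalar_mul, defect_mul,
        gradInv_scalar, hC.scalar_mul, Contraction.scalar, defect_zero, map_zero,
        LinearMap.zero_apply, zero_add] at h1
      exact (smul_eq_zero.1 h1.symm).resolve_left (by positivity)
  exact linearMap_ext_lof (T := 0) key a

theorem tot_bracket (x y : Γ) (a : ⨁ n, 𝔄 n) :
    C.tot (δ.bracket hC hR x y) a = δ.lie C x (C.tot y a) - C.tot y (δ.lie C x a) := by
  have h := δ.defect_eq_zero hC hR x y a
  rw [defect_apply, sub_eq_zero] at h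
  exact h.symm

theorem lie_D (x : Γ) (a : ⨁ n, 𝔄 n) : δ.lie C x (δ.D a) = δ.D (δ.lie C x a) := by
  simp only [lie_apply, map_add, δ.sq_zero, map_zero, add_zero, zero_add]

/-- Insert `ι_[x,y] = [L_x, ι_y]` into `L_[x,y] = [ι_[x,y], D]` and use that `L_x` commutes with
`D`. -/
theorem lie_bracket (x y : Γ) (a : ⨁ n, 𝔄 n) : δ.lie C (δ.bracket hC hR x y) a =
    δ.lie C x (δ.lie C y a) - δ.lie C y (δ.lie C x a) := by
  rw [lie_apply, tot_bracket, tot_bracket, δ.lie_apply y, δ.lie_apply y]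
  simp only [map_add, map_sub, lie_D]
  abel

theorem eq_of_tot (hR : C.IsReflexive) {x y : Γ} (h : ∀ a, C.tot x a = C.tot y a) : x = y :=
  hR.eq_of_pair fun θ => by rw [← ev0_tot_lof_one, h, ev0_tot_lof_one]

theorem bracket_skew (x y : Γ) : δ.bracket hC hR x y = - δ.bracket hC hR y x :=
  hR.eq_of_pair fun θ => by
    have h : C.pair (-δ.bracket hC hR y x) θ = - C.pair (δ.bracket hC hR y x) θ := by
      simpa using C.pair_smul (-1) (δ.bracket hC hR y x) θ
    rw [h, pair_bracket, pair_bracket, C.tot_anticomm, map_neg]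
    ring

/-- The Lie–Rinehart structure of a derivation. -/
noncomputable def toLieRinehart : LieRinehart R Γ where
  bracket := δ.bracket hC hR
  anchor := δ.anchor hC
  skew := δ.bracket_skew hC hR
  -- An element of `Γ` is determined by its contraction operator. Under contraction the identity
  -- becomes a consequence of `ι_[x,y] = [L_x, ι_y]` and `L_[x,y] = [L_x, L_y]`.
  jacobi x y z := eq_of_tot hR fun a => by
    rw [δ.bracket_skew hC hR z x, δ.bracket_skew hC hR z (δ.bracket hC hR x y), map_neg, tot_add,
      tot_add, tot_neg, tot_neg, tot_zero]
    simp only [LinearMap.add_apply, LinearMap.neg_apply, tot_bracket, lie_bracket, map_sub,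
      LinearMap.zero_apply]
    abel
  leibniz x y f := hR.eq_of_pair fun θ => by
    simp only [pair_bracket, pair_add, pair_smul, map_smul, Derivation.leibniz, tot_smul,
      C.ev0_smul, smul_eq_mul, Derivation.smul_apply]
    ring
  anchor_bracket x y f := by
    have h := congrArg C.ev0 (δ.lie_bracket hC hR x y (C.scalar f))
    simpa only [δ.lie_scalar hC, map_sub, ev0_scalar] using h

/-- Both operators act on scalars through the anchor and have commutator `ι_[x,y]` with `ι_y`;
induction on the degree then leaves no freedom. -/
theorem lieTot_toLieRinehart (x : Γ) (a : ⨁ n, 𝔄 n) :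
    C.lieTot (δ.toLieRinehart hC hR) x a = δ.lie C x a := by
  refine sub_eq_zero.1 (C.linear_induction (C.lieTot (δ.toLieRinehart hC hR) x - δ.lie C x)
    (fun n a h => ?_) a)
  simp only [LinearMap.sub_apply] at h ⊢
  refine C.tot_ext ?_ fun y => ?_
  · rw [map_sub, ev0_lieTot, sub_eq_zero]
    cases n with
    | zero =>
      rw [lof_zero_eq_scalar (C := C), δ.lie_scalar hC, ev0_scalar, ev0_scalar]; rfl
    | succ n =>
      obtain ⟨b, hb⟩ := δ.lie_lof C x (n + 1) a
      rw [hb, ev0_lof_succ, ev0_lof_succ, map_zero]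
  · have h1 := δ.tot_bracket hC hR x y (DirectSum.lof ℝ ℕ 𝔄 n a)
    rw [map_sub, tot_lieTot]
    change _ - C.tot (δ.bracket hC hR x y) _ - _ = 0
    rw [h1]
    refine Eq.trans ?_ (h y)
    abel

/-- By the previous lemma both differentials satisfy `ι_y d = L_y - d ι_y` with the same `L_y`, and
neither has values with a scalar part. -/
theorem toDG_toLieRinehart : toDG hC (δ.toLieRinehart hC hR) = δ := by
  have h : C.diffTot (δ.toLieRinehart hC hR) = δ.D := by
    refine LinearMap.ext fun a => ?_
    refine sub_eq_zero.1 (C.linear_induction (C.diffTot (δ.toLieRinehart hC hR) - δ.D)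
      (fun n a h => ?_) a)
    simp only [LinearMap.sub_apply] at h ⊢
    refine C.tot_ext ?_ fun y => ?_
    · rw [map_sub, ev0_diffTot, C.ev0_raise δ.degree_one, sub_zero]
    · rw [map_sub, tot_diffTot, lieTot_toLieRinehart, lie_apply]
      refine Eq.trans ?_ (neg_eq_zero.2 (h y))
      abel
  cases δ
  simp only [toDG] at h ⊢
  congr

theorem _root_.HomLie.LieRinehart.ext' {Λ Λ' : LieRinehart R Γ}
    (h1 : ∀ x y, Λ.bracket x y = Λ'.bracket x y) (h2 : ∀ x f, Λ.anchor x f = Λ'.anchor x f) :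
    Λ = Λ' := by
  have e1 : Λ.bracket = Λ'.bracket := LinearMap.ext fun x => LinearMap.ext fun y => h1 x y
  have e2 : Λ.anchor = Λ'.anchor := LinearMap.ext fun x => Derivation.ext fun f => h2 x f
  cases Λ; cases Λ'
  simp only at e1 e2
  subst e1 e2
  rfl

/-- The anchor is read off from `d` on functions. Evaluating Cartan's formula for `dθ` twice then
recovers the pairing of the bracket with each one-form, which determines it by reflexivity. -/
theorem toLieRinehart_toDG (Λ : LieRinehart R Γ) : (toDG hC Λ).toLieRinehart hC hR = Λ := by
  have ha : ∀ x f, (toDG hC Λ).anchor hC x f = Λ.anchor x f := fun x f => by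
    rw [anchor_apply]
    change C.ev0 (C.tot x (C.diffTot Λ (C.scalar f))) = _
    rw [tot_diffTot, tot_scalar, map_zero, sub_zero, ev0_lieTot, ev0_scalar]
  refine LieRinehart.ext' (fun x y => hR.eq_of_pair fun θ => ?_) ha
  refine (pair_bracket hC hR _ x y θ).trans ?_
  rw [ha, ha]
  change _ - _ - C.ev0 (C.tot y (C.tot x (C.diffTot Λ _))) = _
  rw [tot_diffTot, map_sub, tot_lieTot, tot_diffTot, C.tot_lof_succ x 0, tot_lof_zero, map_zero,
    sub_zero]
  simp only [map_sub, ev0_lieTot, ev0_tot_lof_one, ev0_lof_zero]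
  simp only [Contraction.pair, LinearMap.comp_apply, LinearEquiv.coe_coe]
  ring

end DGDerivation
end HomLie

/-! ### Automorphisms of the calculus, invariance, and twisted differentials. -/

namespace HomLie

variable {R Γ : Type*} [CommRing R] [Algebra ℝ R] [AddCommGroup Γ] [Module ℝ Γ] [Module R Γ]
  [IsScalarTower ℝ R Γ] {𝔄 : ℕ → Type*} [∀ n, AddCommGroup (𝔄 n)]
  [∀ n, Module ℝ (𝔄 n)] [∀ n, Module R (𝔄 n)] [∀ n, IsScalarTower ℝ R (𝔄 n)]

open Contraction DGDerivation

/-- An automorphism of the contraction calculus `C`. -/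
structure ContractionAut (C : Contraction R Γ 𝔄) where
  /-- the automorphism of scalars -/
  σ : R ≃ₐ[ℝ] R
  /-- the automorphism of vectors -/
  α : Γ ≃ₗ[ℝ] Γ
  /-- the automorphism of forms -/
  hat : ∀ n, 𝔄 n ≃ₗ[ℝ] 𝔄 n
  e0_hat : ∀ a, C.e0 (hat 0 a) = σ (C.e0 a)
  hat_ι : ∀ n x a, hat n (C.ι n x a) = C.ι n (α x) (hat (n + 1) a)

namespace ContractionAut

variable {C : Contraction R Γ 𝔄} (τ : ContractionAut C)
  {mul : ∀ p q, 𝔄 p →ₗ[ℝ] 𝔄 q →ₗ[ℝ] 𝔄 (p + q)} {one : 𝔄 0}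

/-- The action on all forms. -/
noncomputable def tot : (⨁ n, 𝔄 n) →ₗ[ℝ] ⨁ n, 𝔄 n :=
  DirectSum.lmap fun n => (τ.hat n).toLinearMap

/-- The inverse of the action on all forms. -/
noncomputable def totInv : (⨁ n, 𝔄 n) →ₗ[ℝ] ⨁ n, 𝔄 n :=
  DirectSum.lmap fun n => (τ.hat n).symm.toLinearMap

@[simp]
theorem tot_lof (n : ℕ) (a : 𝔄 n) :
    τ.tot (DirectSum.lof ℝ ℕ 𝔄 n a) = DirectSum.lof ℝ ℕ 𝔄 n (τ.hat n a) := by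
  simp [tot]

@[simp]
theorem totInv_lof (n : ℕ) (a : 𝔄 n) :
    τ.totInv (DirectSum.lof ℝ ℕ 𝔄 n a) = DirectSum.lof ℝ ℕ 𝔄 n ((τ.hat n).symm a) := by
  simp [totInv]

@[simp]
theorem totInv_tot (a : ⨁ n, 𝔄 n) : τ.totInv (τ.tot a) = a :=
  linearMap_ext_lof (S := τ.totInv ∘ₗ τ.tot) (T := LinearMap.id) (fun n a => by simp) a

@[simp]
theorem tot_totInv (a : ⨁ n, 𝔄 n) : τ.tot (τ.totInv a) = a :=
  linearMap_ext_lof (S := τ.tot ∘ₗ τ.totInv) (T := LinearMap.id) (fun n a => by simp) a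

theorem tot_injective : Function.Injective τ.tot := fun a b h => by
  rw [← τ.totInv_tot a, h, totInv_tot]

theorem tot_contract (x : Γ) (a : ⨁ n, 𝔄 n) : τ.tot (C.tot x a) = C.tot (τ.α x) (τ.tot a) := by
  refine linearMap_ext_lof (S := τ.tot ∘ₗ C.tot x) (T := C.tot (τ.α x) ∘ₗ τ.tot) (fun n a => ?_) a
  cases n with
  | zero => simp
  | succ n => simp [τ.hat_ι]

theorem contract_tot (x : Γ) (a : ⨁ n, 𝔄 n) :
    C.tot x (τ.tot a) = τ.tot (C.tot (τ.α.symm x) a) := by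
  rw [tot_contract, LinearEquiv.apply_symm_apply]

theorem ev0_tot (a : ⨁ n, 𝔄 n) : C.ev0 (τ.tot a) = τ.σ (C.ev0 a) := by
  refine linearMap_ext_lof (S := C.ev0 ∘ₗ τ.tot) (T := τ.σ.toLinearMap ∘ₗ C.ev0) (fun n a => ?_) a
  cases n with
  | zero => simp [τ.e0_hat]
  | succ n => simp

theorem tot_scalar (f : R) : τ.tot (C.scalar f) = C.scalar (τ.σ f) := by
  rw [Contraction.scalar, tot_lof, lof_zero_eq_scalar (C := C), e0_hat,
    LinearEquiv.apply_symm_apply]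

theorem tot_gradInv (a : ⨁ n, 𝔄 n) : τ.tot (gradInv 𝔄 a) = gradInv 𝔄 (τ.tot a) :=
  linearMap_ext_lof (S := τ.tot ∘ₗ gradInv 𝔄) (T := gradInv 𝔄 ∘ₗ τ.tot) (fun n a => by simp) a

/-- Contraction with x passes through the automorphism as contraction with `α⁻¹x`, so the
multiplicativity defect is controlled by the defects with one argument contracted. -/
theorem tot_mul (hC : C.IsWedge mul) (a b : ⨁ n, 𝔄 n) :
    τ.tot (totalMul mul a b) = totalMul mul (τ.tot a) (τ.tot b) := by
  let T : (⨁ n, 𝔄 n) →ₗ[ℝ] (⨁ n, 𝔄 n) →ₗ[ℝ] ⨁ n, 𝔄 n :=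
    LinearMap.mk₂ ℝ (fun a b => τ.tot (totalMul mul a b) - totalMul mul (τ.tot a) (τ.tot b))
    (fun a a' b => by simp only [map_add, LinearMap.add_apply]; abel)
    (fun c a b => by simp only [map_smul, LinearMap.smul_apply, smul_sub])
    (fun a b b' => by simp only [map_add]; abel)
    (fun c a b => by simp only [map_smul, smul_sub])
  have e : ∀ a b, T a b = τ.tot (totalMul mul a b) - totalMul mul (τ.tot a) (τ.tot b) :=
    fun _ _ => rfl
  refine sub_eq_zero.1 ((e a b).symm.trans (C.bilinear_induction T (fun p q a b h1 h2 => ?_) a b))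
  simp only [e] at h1 h2 ⊢
  refine C.tot_ext ?_ fun x => ?_
  · simp only [map_sub, ev0_tot, hC.ev0_mul, map_mul, sub_self]
  · have e1 := h1 (τ.α.symm x)
    have e2 := congrArg (fun z => (-1 : ℝ) ^ p • z) (h2 (τ.α.symm x))
    simp only [map_sub, contract_tot, hC.tot_mul, map_add, ← tot_gradInv, gradInv_lof,
      map_smul, LinearMap.smul_apply, smul_sub, smul_zero] at e1 e2 ⊢
    refine Eq.trans ?_ ((congrArg₂ (· + ·) e1 e2).trans (add_zero _))
    abel

theorem totInv_mul (hC : C.IsWedge mul) (a b : ⨁ n, 𝔄 n) :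
    τ.totInv (totalMul mul a b) = totalMul mul (τ.totInv a) (τ.totInv b) :=
  τ.tot_injective (by simp only [tot_mul τ hC, tot_totInv])

theorem isGradedEndomorphism (hC : C.IsWedge mul) (h1 : C.e0 one = 1) :
    IsGradedEndomorphism mul one fun n => (τ.hat n).toLinearMap where
  map_mul := τ.tot_mul hC
  map_one := C.e0.injective (by
    rw [LinearEquiv.coe_coe, e0_hat, h1, map_one])

/-- The automorphism preserves the bracket and the anchor. -/
structure Preserves (Λ : LieRinehart R Γ) : Prop where
  bracket : ∀ x y, τ.α (Λ.bracket x y) = Λ.bracket (τ.α x) (τ.α y)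
  anchor : ∀ x f, Λ.anchor (τ.α x) (τ.σ f) = τ.σ (Λ.anchor x f)

variable {τ}

/-- Both composites obey the Cartan recursion along vectors of the form `α y`, and these exhaust
`Γ`. -/
theorem Preserves.tot_lieTot {Λ : LieRinehart R Γ} (h : τ.Preserves Λ) (x : Γ) (a : ⨁ n, 𝔄 n) :
    τ.tot (C.lieTot Λ x a) = C.lieTot Λ (τ.α x) (τ.tot a) := by
  refine sub_eq_zero.1 (C.linear_induction (τ.tot ∘ₗ C.lieTot Λ x -
    C.lieTot Λ (τ.α x) ∘ₗ τ.tot) (fun n a ha => ?_) a)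
  simp only [LinearMap.sub_apply, LinearMap.comp_apply] at ha ⊢
  refine C.tot_ext ?_ fun y => ?_
  · simp only [map_sub, ev0_tot, ev0_lieTot, h.anchor, sub_self]
  · obtain ⟨y, rfl⟩ := τ.α.surjective y
    simp only [map_sub, ← tot_contract, C.tot_lieTot, ← h.bracket]
    refine Eq.trans ?_ (ha y)
    abel

theorem Preserves.tot_diffTot {Λ : LieRinehart R Γ} (h : τ.Preserves Λ) (a : ⨁ n, 𝔄 n) :
    C.diffTot Λ (τ.tot a) = τ.tot (C.diffTot Λ a) := by
  refine sub_eq_zero.1 (C.linear_induction (C.diffTot Λ ∘ₗ τ.tot -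
    τ.tot ∘ₗ C.diffTot Λ) (fun n a ha => ?_) a)
  simp only [LinearMap.sub_apply, LinearMap.comp_apply] at ha ⊢
  refine C.tot_ext ?_ fun y => ?_
  · simp only [map_sub, ev0_tot, ev0_diffTot, map_zero, sub_self]
  · obtain ⟨y, rfl⟩ := τ.α.surjective y
    simp only [map_sub, ← tot_contract, C.tot_diffTot, h.tot_lieTot]
    refine Eq.trans ?_ (neg_eq_zero.2 (ha y))
    abel

/-- Anchor and bracket are expressed through contractions and `D` alone, and the automorphism
transports both. -/
theorem preserves_toLieRinehart (hC : C.IsWedge mul) (hR : C.IsReflexive) (δ : DGDerivation mul)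
    (h : ∀ a, δ.D (τ.tot a) = τ.tot (δ.D a)) : τ.Preserves (δ.toLieRinehart hC hR) where
  bracket x y := DGDerivation.eq_of_tot hR fun a => by
    obtain ⟨a, rfl⟩ : ∃ b, τ.tot b = a := ⟨_, τ.tot_totInv a⟩
    rw [← tot_contract]
    change τ.tot (C.tot (δ.bracket hC hR x y) a) =
      C.tot (δ.bracket hC hR (τ.α x) (τ.α y)) (τ.tot a)
    simp only [tot_bracket, lie_apply, ← tot_contract, h, map_add, map_sub]
  anchor x f := by
    change δ.anchor hC (τ.α x) (τ.σ f) = τ.σ (δ.anchor hC x f)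
    rw [anchor_apply, anchor_apply, ← tot_scalar, h, ← tot_contract, ev0_tot]

variable (τ)

/-- Invariant Lie–Rinehart structures are invariant derivations. -/
noncomputable def lieRinehartEquiv (hC : C.IsWedge mul) (hR : C.IsReflexive) :
    {Λ : LieRinehart R Γ // τ.Preserves Λ} ≃
      {δ : DGDerivation mul // ∀ a, δ.D (τ.tot a) = τ.tot (δ.D a)} where
  toFun Λ := ⟨toDG hC Λ.1, Λ.2.tot_diffTot⟩
  invFun δ := ⟨δ.1.toLieRinehart hC hR, preserves_toLieRinehart hC hR δ.1 δ.2⟩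
  left_inv Λ := Subtype.ext (toLieRinehart_toDG hC hR Λ.1)
  right_inv δ := Subtype.ext (toDG_toLieRinehart hC hR δ.1)

theorem _root_.HomLie.TwistedDGCA.ext' {σ σ' : ∀ n, 𝔄 n →ₗ[ℝ] 𝔄 n} {d d' : TwistedDGCA mul one σ σ'}
    (h : d.d = d'.d) : d = d' := by
  cases d; cases d'
  simp only at h
  subst h
  rfl

theorem _root_.HomLie.DGDerivation.ext' {δ δ' : DGDerivation mul} (h : δ.D = δ'.D) : δ = δ' := by
  cases δ; cases δ'
  simp only at h
  subst h
  rfl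

/-- Twisted differentials are invariant derivations. -/
noncomputable def twistedEquiv (hC : C.IsWedge mul) (h1 : C.e0 one = 1) :
    {δ : DGDerivation mul // ∀ a, δ.D (τ.tot a) = τ.tot (δ.D a)} ≃
      TwistedDGCA mul one (fun n => (τ.hat n).toLinearMap) (fun n => (τ.hat n).toLinearMap) where
  toFun δ :=
    { isGradedCommAlgebra := hC.isGradedCommAlgebra h1
      isEndomorphism_left := τ.isGradedEndomorphism hC h1
      isEndomorphism_right := τ.isGradedEndomorphism hC h1
      -- Applying the algebra endomorphism `α̂` to the ordinary Leibniz rule of `D` twists exactly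
      -- the undifferentiated factors. Since `D` commutes with `α̂`, the square is `α̂²D² = 0`.
      d := τ.tot ∘ₗ δ.1.D
      degree_one := fun n a => by
        obtain ⟨b, hb⟩ := δ.1.degree_one n a
        exact ⟨τ.hat _ b, by rw [LinearMap.comp_apply, hb, tot_lof]⟩
      sq_zero := LinearMap.ext fun a => by
        simp only [LinearMap.comp_apply, δ.2, δ.1.sq_zero, map_zero, LinearMap.zero_apply]
      comm_left := LinearMap.ext fun a => congrArg τ.tot (δ.2 a)
      comm_right := LinearMap.ext fun a => congrArg τ.tot (δ.2 a)
      leibniz := fun p a b => by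
        change _ = totalMul mul _ (τ.tot b) + _ • totalMul mul (τ.tot _) _
        simp only [LinearMap.comp_apply, δ.1.leibniz, map_add, τ.tot_mul hC, gradInv_lof,
          map_smul, LinearMap.smul_apply] }
  invFun d :=
    have hd : ∀ a, d.d (τ.tot a) = τ.tot (d.d a) := fun a => LinearMap.congr_fun d.comm_left a
    have hd' : ∀ a, d.d (τ.totInv a) = τ.totInv (d.d a) := fun a => τ.tot_injective (by
      rw [← hd, tot_totInv, tot_totInv])
    ⟨{  D := τ.totInv ∘ₗ d.d
        degree_one := fun n a => by
          obtain ⟨b, hb⟩ := d.degree_one n a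
          exact ⟨(τ.hat _).symm b, by rw [LinearMap.comp_apply, hb, totInv_lof]⟩
        leibniz := fun a b => by
          refine linearMap_ext_lof (S := (τ.totInv ∘ₗ d.d) ∘ₗ (totalMul mul).flip b)
            (T := (totalMul mul).flip b ∘ₗ (τ.totInv ∘ₗ d.d) +
              (totalMul mul).flip (τ.totInv (d.d b)) ∘ₗ gradInv 𝔄) (fun p a => ?_) a
          have h := d.leibniz p a b
          change _ = totalMul mul _ (τ.tot b) + _ • totalMul mul (τ.tot _) _ at h
          simp only [LinearMap.comp_apply, LinearMap.flip_apply, LinearMap.add_apply, h, map_add,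
            map_smul, τ.totInv_mul hC, totInv_tot, gradInv_lof]
        sq_zero := fun a => by
          have h : d.d (d.d a) = 0 := LinearMap.congr_fun d.sq_zero a
          simp only [LinearMap.comp_apply, hd', h, map_zero] },
      fun a => by simp only [LinearMap.comp_apply, hd, totInv_tot, tot_totInv]⟩
  left_inv δ := Subtype.ext (DGDerivation.ext' (LinearMap.ext fun a => τ.totInv_tot _))
  right_inv d := TwistedDGCA.ext' (LinearMap.ext fun a => τ.tot_totInv _)

end ContractionAut
end HomLie

/-! ### The Chevalley–Eilenberg formula. -/

namespace HomLie

variable {R Γ : Type*} [CommRing R] [Algebra ℝ R] [AddCommGroup Γ] [Module ℝ Γ] [Module R Γ]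
  [IsScalarTower ℝ R Γ] {𝔄 : ℕ → Type*} [∀ n, AddCommGroup (𝔄 n)]
  [∀ n, Module ℝ (𝔄 n)] [∀ n, Module R (𝔄 n)] [∀ n, IsScalarTower ℝ R (𝔄 n)]

namespace Contraction

variable (C : Contraction R Γ 𝔄) (Λ : LieRinehart R Γ)

/-- The value of a form, by iterated contraction. -/
def eval : ∀ n, 𝔄 n → (Fin n → Γ) → R
  | 0, ξ, _ => C.e0 ξ
  | n + 1, ξ, x => eval n (C.ι n (x 0) ξ) fun i => x i.succ

theorem eval_succ (n : ℕ) (ξ : 𝔄 (n + 1)) (x : Fin (n + 1) → Γ) :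
    C.eval (n + 1) ξ x = C.eval n (C.ι n (x 0) ξ) fun i => x i.succ := rfl

theorem eval_cons (n : ℕ) (ξ : 𝔄 (n + 1)) (y : Γ) (x : Fin n → Γ) :
    C.eval (n + 1) ξ (Fin.cons y x) = C.eval n (C.ι n y ξ) x := rfl

theorem eval_add (n : ℕ) (ξ η : 𝔄 n) (x : Fin n → Γ) :
    C.eval n (ξ + η) x = C.eval n ξ x + C.eval n η x := by
  induction n with
  | zero => simp [eval]
  | succ n ih => simp only [eval_succ, map_add, ih]

theorem eval_sub (n : ℕ) (ξ η : 𝔄 n) (x : Fin n → Γ) :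
    C.eval n (ξ - η) x = C.eval n ξ x - C.eval n η x := by
  rw [eq_sub_iff_add_eq, ← eval_add, sub_add_cancel]

theorem eval_cons_cons (n : ℕ) (ξ : 𝔄 (n + 2)) (y z : Γ) (x : Fin n → Γ) :
    C.eval (n + 1) (C.ι (n + 1) y ξ) (Fin.cons z x) =
      - C.eval (n + 1) (C.ι (n + 1) z ξ) (Fin.cons y x) := by
  have h := C.ι_ι n (y + z) ξ
  simp only [map_add, LinearMap.add_apply, C.ι_ι, zero_add, add_zero] at h
  rw [eq_neg_iff_add_eq_zero, eval_cons, eval_cons, ← eval_add, h]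
  have h0 := C.eval_add n 0 0 x
  rw [add_zero] at h0
  exact left_eq_add.1 h0

/-- The usual derivation formula has the bracket in slot j; moving it to the front gives the sign
(-1)^j. In the induction, anticommutation of contractions carries the bracket past the argument `y
0`. -/
theorem eval_lie (x : Γ) (n : ℕ) (ξ : 𝔄 (n + 1)) (y : Fin (n + 1) → Γ) :
    C.eval (n + 1) (C.lie Λ x (n + 1) ξ) y = Λ.anchor x (C.eval (n + 1) ξ y) -
      ∑ j : Fin (n + 1), (-1 : ℝ) ^ (j : ℕ) • C.eval (n + 1) ξ
        (Fin.cons (Λ.bracket x (y j)) fun l => y (j.succAbove l)) := by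
  induction n with
  | zero =>
    simp only [eval_succ, ι_lie, eval_sub]
    simp [eval, e0_lie]
  | succ n ih =>
    rw [eval_succ, ι_lie, eval_sub, ih, Fin.sum_univ_succ (n := n + 1)]
    have h : ∀ j : Fin (n + 1), C.eval (n + 1) (C.ι (n + 1) (y 0) ξ)
        (Fin.cons (Λ.bracket x (y j.succ)) fun l => y (j.succAbove l).succ) =
        - C.eval (n + 2) ξ (Fin.cons (Λ.bracket x (y j.succ)) fun l => y (j.succ.succAbove l)) := by
      intro j
      have e : (fun l => y (j.succ.succAbove l)) = Fin.cons (y 0) fun l => y (j.succAbove l).succ := by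
        funext l
        refine Fin.cases ?_ (fun l => ?_) l <;> simp
      rw [e, eval_cons_cons]
      rfl
    have e0 : C.eval (n + 1 + 1) ξ y = C.eval (n + 1) (C.ι (n + 1) (y 0) ξ) fun i => y i.succ := rfl
    simp only [h, eval_cons, Fin.succAbove_zero, Fin.val_zero, pow_zero, one_smul, smul_neg,
      Finset.sum_neg_distrib, Fin.val_succ, pow_succ, mul_neg, mul_one, neg_smul, e0]
    ring

theorem eval_diff_zero (ξ : 𝔄 0) (x : Fin 1 → Γ) :
    C.eval 1 (C.diff Λ 0 ξ) x = Λ.anchor (x 0) (C.eval 0 ξ Fin.elim0) := by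
  rw [eval_succ, ι_diff_zero]
  exact C.e0_lie Λ _ _

/-- The Chevalley–Eilenberg formula. -/
theorem eval_diff_succ (n : ℕ) (ξ : 𝔄 (n + 1)) (x : Fin (n + 2) → Γ) :
    C.eval (n + 2) (C.diff Λ (n + 1) ξ) x =
      ∑ i : Fin (n + 2), (-1 : ℝ) ^ (i : ℕ) •
        Λ.anchor (x i) (C.eval (n + 1) ξ fun l => x (i.succAbove l)) +
      ∑ j : Fin (n + 2), ∑ i : Fin (n + 1), if i.castSucc < j then
        (-1 : ℝ) ^ ((i : ℕ) + (j : ℕ)) •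
          C.eval (n + 1) ξ (Fin.cons (Λ.bracket (x i.castSucc) (x j))
            fun l => x (j.succAbove (i.succAbove l)))
        else 0 := by
  induction n with
  | zero =>
    have e : C.eval 1 ξ (fun l => x (Fin.succAbove 1 l)) = C.eval 0 (C.ι 0 (x 0) ξ) Fin.elim0 := rfl
    rw [eval_succ, ι_diff_succ, eval_sub, eval_lie, eval_diff_zero]
    simp only [Fin.sum_univ_succ, Fin.sum_univ_zero]
    simp [e]
    ring
  | succ n ih =>
    -- In `ι_{x₀} dξ = L_{x₀} ξ - d ι_{x₀} ξ`, the first term contributes the anchor of `x₀` and its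
    -- brackets; the second, by induction, everything else.
    rw [eval_succ, ι_diff_succ, eval_sub, eval_lie, ih, Fin.sum_univ_succ (n := n + 2),
      Fin.sum_univ_succ (n := n + 2)]
    have h1 : ∀ i : Fin (n + 2), C.eval (n + 2) ξ (fun l => x (i.succ.succAbove l)) =
        C.eval (n + 1) (C.ι (n + 1) (x 0) ξ) fun l => x (i.succAbove l).succ := by
      intro i
      rw [eval_succ]
      simp
    have h2 : ∀ (j : Fin (n + 2)) (i : Fin (n + 1)), C.eval (n + 2) ξ
        (Fin.cons (Λ.bracket (x i.castSucc.succ) (x j.succ))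
          fun l => x (j.succ.succAbove (i.succ.succAbove l))) =
        - C.eval (n + 1) (C.ι (n + 1) (x 0) ξ) (Fin.cons (Λ.bracket (x i.castSucc.succ) (x j.succ))
          fun l => x (j.succAbove (i.succAbove l)).succ) := by
      intro j i
      have e : (fun l => x (j.succ.succAbove (i.succ.succAbove l))) =
          Fin.cons (x 0) fun l => x (j.succAbove (i.succAbove l)).succ := by
        funext l
        refine Fin.cases ?_ (fun l => ?_) l <;> simp
      rw [e, eval_cons_cons, neg_neg, eval_cons]
    -- Among the pairs whose larger index is `j.succ`, the pair with i = 0 comes from `L_{x₀}`. The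
    -- remaining ones come from the differential of `ι_{x₀} ξ`, both indices shifted by one, so the
    -- sign (-1)^(i+j) is unchanged.
    have h3 : ∀ j : Fin (n + 2), (∑ i : Fin (n + 2), if i.castSucc < j.succ then
        (-1 : ℝ) ^ ((i : ℕ) + (j.succ : ℕ)) •
          C.eval (n + 2) ξ (Fin.cons (Λ.bracket (x i.castSucc) (x j.succ))
            fun l => x (j.succ.succAbove (i.succAbove l)))
        else 0) = - ((-1 : ℝ) ^ (j : ℕ) • C.eval (n + 2) ξ
          (Fin.cons (Λ.bracket (x 0) (x j.succ)) fun l => x (j.succAbove l).succ)) -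
          ∑ i : Fin (n + 1), if i.castSucc < j then
        (-1 : ℝ) ^ ((i : ℕ) + (j : ℕ)) •
          C.eval (n + 1) (C.ι (n + 1) (x 0) ξ)
            (Fin.cons (Λ.bracket (x i.castSucc.succ) (x j.succ))
            fun l => x (j.succAbove (i.succAbove l)).succ)
        else 0 := by
      intro j
      rw [Fin.sum_univ_succ, sub_eq_add_neg, ← Finset.sum_neg_distrib]
      congr 1
      · rw [if_pos (by simp [Fin.lt_def])]
        simp [pow_succ]
      · refine Finset.sum_congr rfl fun i _ => ?_
        rw [← Fin.succ_castSucc, h2]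
        simp only [Fin.succ_lt_succ_iff]
        split_ifs
        · simp only [Fin.val_succ, smul_neg]
          rw [show (i : ℕ) + 1 + ((j : ℕ) + 1) = i + j + 2 by ring, pow_add]
          simp
        · simp
    have h4 : (∑ i : Fin (n + 2), if i.castSucc < (0 : Fin (n + 3)) then
        (-1 : ℝ) ^ ((i : ℕ) + ((0 : Fin (n + 3)) : ℕ)) •
          C.eval (n + 2) ξ (Fin.cons (Λ.bracket (x i.castSucc) (x 0))
            fun l => x ((0 : Fin (n + 3)).succAbove (i.succAbove l)))
        else 0) = 0 := Finset.sum_eq_zero fun i _ => if_neg (by simp)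
    rw [h4, Finset.sum_congr (s₁ := (Finset.univ : Finset (Fin (n + 1 + 1)))) rfl fun j _ => h3 j]
    simp only [h1, Finset.sum_sub_distrib, Finset.sum_neg_distrib, Fin.succAbove_zero,
      Fin.val_zero, pow_zero, one_smul, Fin.val_succ, pow_succ, mul_neg, mul_one, neg_smul]
    ring

end Contraction
end HomLie

/-! ### Sections as a module, fibrewise maps, and contraction of forms with sections. -/

namespace HomLie

section SectionModule

variable {E : Type*} [NormedAddCommGroup E] [NormedSpace ℝ E]
  {M : Type*} [TopologicalSpace M] [ChartedSpace E M]
  {F : Type*} [NormedAddCommGroup F] [NormedSpace ℝ F]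
  {A : M → Type*} [∀ m, AddCommGroup (A m)] [∀ m, Module ℝ (A m)] [∀ m, TopologicalSpace (A m)]
  [TopologicalSpace (TotalSpace F A)] [FiberBundle F A] [VectorBundle ℝ F A]

/-- Sections form a module over the smooth functions. -/
noncomputable instance : Module (Fn E M) (Cₛ^∞⟮𝓘(ℝ, E); F, A⟯) where
  smul f X := ⟨fun m => f m • X m, f.contMDiff.smul_section X.contMDiff⟩
  one_smul X := ContMDiffSection.ext fun m => one_smul ℝ (X m)
  mul_smul f g X := ContMDiffSection.ext fun m => mul_smul (f m) (g m) (X m)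
  smul_zero f := ContMDiffSection.ext fun m => smul_zero (f m)
  smul_add f X Y := ContMDiffSection.ext fun m => smul_add (f m) (X m) (Y m)
  add_smul f g X := ContMDiffSection.ext fun m => add_smul (f m) (g m) (X m)
  zero_smul X := ContMDiffSection.ext fun m => zero_smul ℝ (X m)

theorem section_smul_apply (f : Fn E M) (X : Cₛ^∞⟮𝓘(ℝ, E); F, A⟯) (m : M) :
    (f • X) m = f m • X m := rfl

theorem fmul_eq_smul (f : Fn E M) (X : Sec E F A) : fmul f X = f • X := rfl

instance : IsScalarTower ℝ (Fn E M) (Cₛ^∞⟮𝓘(ℝ, E); F, A⟯) where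
  smul_assoc c f X := ContMDiffSection.ext fun m => smul_assoc c (f m) (X m)

end SectionModule

/-- In a basis the map is a polynomial in the coordinates. It upgrades forms constructed
algebraically on a fibre to continuous ones. -/
theorem alternatingMap_continuous {V : Type*} [AddCommGroup V] [Module ℝ V] [TopologicalSpace V]
    [T2Space V] [IsTopologicalAddGroup V] [ContinuousSMul ℝ V] [FiniteDimensional ℝ V] {n : ℕ}
    (f : V [⋀^Fin n]→ₗ[ℝ] ℝ) : Continuous f := by
  let b := Module.finBasis ℝ V
  have key : ∀ v : Fin n → V, f v = ∑ r : Fin n → Fin (Module.finrank ℝ V),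
      (∏ i, b.coord (r i) (v i)) * f (fun i => b (r i)) := by
    intro v
    have hv : v = fun i => ∑ j, b.coord j (v i) • b j := funext fun i => (b.sum_repr (v i)).symm
    conv_lhs => rw [hv]
    refine (f.toMultilinearMap.map_sum (fun i j => b.coord j (v i) • b j)).trans ?_
    exact Finset.sum_congr rfl fun r _ => f.toMultilinearMap.map_smul_univ _ _
  rw [show (f : (Fin n → V) → ℝ) = _ from funext key]
  refine continuous_finsetSum _ fun r _ => Continuous.mul (continuous_finsetProd _ fun i _ => ?_)
    continuous_const
  exact (LinearMap.continuous_of_finiteDimensional (b.coord (r i))).comp (continuous_apply i)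

section AltUncurry

variable {V : Type*} [AddCommGroup V] [Module ℝ V] {n : ℕ}

/-- An alternating family of alternating forms, as an alternating form. -/
def altUncurry (T : V →ₗ[ℝ] V [⋀^Fin n]→ₗ[ℝ] ℝ)
    (h : ∀ v (w : Fin n → V) j, w j = v → T v w = 0) : V [⋀^Fin (n + 1)]→ₗ[ℝ] ℝ :=
  { LinearMap.uncurryLeft (M := fun _ : Fin (n + 1) => V)
      ({ toFun := fun v => (T v).toMultilinearMap
         map_add' := fun v w => by rw [map_add]; rfl
         map_smul' := fun c v => by rw [map_smul]; rfl } :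
        V →ₗ[ℝ] MultilinearMap ℝ (fun _ : Fin n => V) ℝ) with
    map_eq_zero_of_eq' := by
      intro v i j hv hij
      change T (v 0) (fun l => v l.succ) = 0
      induction i using Fin.cases with
      | zero =>
        induction j using Fin.cases with
        | zero => exact absurd rfl hij
        | succ j => exact h _ _ j hv.symm
      | succ i =>
        induction j using Fin.cases with
        | zero => exact h _ _ i hv
        | succ j => exact (T (v 0)).map_eq_zero_of_eq _ hv fun e => hij (congrArg _ e) }

/-- Moving slot j of `T v` to the front changes only the sign, and there the hypothesis applies. -/
theorem alternating_of_curryLeft {T : V →ₗ[ℝ] V [⋀^Fin (n + 1)]→ₗ[ℝ] ℝ}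
    (h : ∀ v, (T v).curryLeft v = 0) (v : V) (w : Fin (n + 1) → V) (j : Fin (n + 1))
    (hj : w j = v) : T v w = 0 := by
  have e := (T v).map_insertNth j v (j.removeNth w)
  have hw : j.insertNth v (j.removeNth w) = w := by rw [← hj]; simp
  rw [hw] at e
  rw [e]
  have := congrArg (fun f => f (j.removeNth w)) (h v)
  simp only [AlternatingMap.curryLeft_apply_apply, AlternatingMap.zero_apply] at this
  rw [this, smul_zero]

end AltUncurry

variable {E : Type*} [NormedAddCommGroup E] [NormedSpace ℝ E]
  {M : Type*} [TopologicalSpace M] [ChartedSpace E M]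
  {F : Type*} [NormedAddCommGroup F] [NormedSpace ℝ F]
  {A : M → Type*} [∀ m, AddCommGroup (A m)] [∀ m, Module ℝ (A m)] [∀ m, TopologicalSpace (A m)]
  [TopologicalSpace (TotalSpace F A)] [FiberBundle F A] [VectorBundle ℝ F A]
  [FiniteDimensional ℝ E] [FiniteDimensional ℝ F] [T2Space M] [IsManifold 𝓘(ℝ, E) ∞ M]
  [ContMDiffVectorBundle ∞ F A 𝓘(ℝ, E)]

section Fibre

variable {N W : Type*} [AddCommGroup N] [Module (Fn E M) N] [AddCommGroup W] [Module ℝ W]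

/-- Tensoriality: by `exists_decomp` the section is a sum of products `fᵢ Yᵢ` with `fᵢ m = 0`, and
`C^∞(M)`-linearity pulls these values out. The map `e` plays the role of evaluation at m. -/
theorem apply_eq_zero_of_section (t : Sec E F A →ₗ[Fn E M] N) (m : M) (e : N →+ W)
    (he : ∀ (f : Fn E M) n, e (f • n) = f m • e n) {X : Sec E F A} (hX : X m = 0) :
    e (t X) = 0 := by
  obtain ⟨k, f, Y, hf, rfl⟩ := exists_decomp m X hX
  simp only [fmul_eq_smul, map_sum, map_smul, he, hf, zero_smul, Finset.sum_const_zero]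

theorem apply_congr_of_section (t : Sec E F A →ₗ[Fn E M] N) (m : M) (e : N →+ W)
    (he : ∀ (f : Fn E M) n, e (f • n) = f m • e n) {X Y : Sec E F A} (hX : X m = Y m) :
    e (t X) = e (t Y) := by
  refine sub_eq_zero.1 ?_
  rw [← map_sub, ← map_sub]
  refine apply_eq_zero_of_section t m e he ?_
  change X m - Y m = 0
  rw [hX, sub_self]

/-- The map on fibres induced by a `C^∞(M)`-linear map on sections. -/
noncomputable def fibre (t : Sec E F A →ₗ[Fn E M] N) (m : M) (e : N →+ W)
    (he : ∀ (f : Fn E M) n, e (f • n) = f m • e n) : A m →ₗ[ℝ] W where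
  toFun v := e (t (exists_sec_through (E := E) (F := F) m v).choose)
  map_add' v w := by
    rw [← map_add, ← map_add]
    refine apply_congr_of_section t m e he ?_
    simp only [ContMDiffSection.coe_add, Pi.add_apply, (exists_sec_through (E := E) (F := F) m _).choose_spec]
  map_smul' c v := by
    let c' : Fn E M := ⟨fun _ => c, contMDiff_const⟩
    have h : c • e (t (exists_sec_through (E := E) (F := F) m v).choose) =
        e (t (c' • (exists_sec_through (E := E) (F := F) m v).choose)) := by
      rw [map_smul, he]; rfl
    rw [RingHom.id_apply, h]
    refine apply_congr_of_section t m e he ?_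
    rw [section_smul_apply]
    simp only [c', ContMDiffMap.coeFn_mk, (exists_sec_through (E := E) (F := F) m _).choose_spec]

theorem fibre_apply (t : Sec E F A →ₗ[Fn E M] N) (m : M) (e : N →+ W)
    (he : ∀ (f : Fn E M) n, e (f • n) = f m • e n) (X : Sec E F A) :
    fibre t m e he (X m) = e (t X) :=
  apply_congr_of_section t m e he (exists_sec_through (E := E) (F := F) m (X m)).choose_spec

end Fibre

section Forms

theorem cons_section_apply {n : ℕ} (X : Sec E F A) (Y : Fin n → Sec E F A) (m : M) :
    (fun i => (Fin.cons X Y : Fin (n + 1) → Sec E F A) i m) =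
      Matrix.vecCons (X m) fun i => Y i m := by
  funext i
  refine Fin.cases rfl (fun i => rfl) i

/-- Contraction of a continuous alternating form. -/
def altContract {V : Type*} [AddCommGroup V] [Module ℝ V] [TopologicalSpace V] {n : ℕ}
    (a : V [⋀^Fin (n + 1)]→L[ℝ] ℝ) (v : V) : V [⋀^Fin n]→L[ℝ] ℝ :=
  { a.toAlternatingMap.curryLeft v with
    cont := a.cont.comp (Continuous.matrixVecCons continuous_const continuous_id) }

/-- Contraction of a form with a section. -/
noncomputable def contractFun {n : ℕ} (X : Sec E F A) (ξ : Form E F A (n + 1)) : Form E F A n :=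
  ⟨fun m => altContract (V := A m) (ξ m) (X m), form_smooth _ fun Y =>
    (ev ξ (Fin.cons X Y)).contMDiff.congr fun m =>
      congrArg (ξ m) (cons_section_apply X Y m).symm⟩

theorem ev_contractFun {n : ℕ} (X : Sec E F A) (ξ : Form E F A (n + 1)) (Y : Fin n → Sec E F A) :
    ev (contractFun X ξ) Y = ev ξ (Fin.cons X Y) := by
  ext m
  exact congrArg (ξ m) (cons_section_apply X Y m).symm

theorem ev_add {n : ℕ} (ξ η : Form E F A n) (Y : Fin n → Sec E F A) :
    ev (ξ + η) Y = ev ξ Y + ev η Y := rfl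

theorem ev_smul {n : ℕ} (f : Fn E M) (ξ : Form E F A n) (Y : Fin n → Sec E F A) :
    ev (f • ξ) Y = f * ev ξ Y := rfl

/-- Contraction of forms with sections, as a bilinear map. -/
noncomputable def contract (n : ℕ) : Sec E F A →ₗ[Fn E M] Form E F A (n + 1) →ₗ[Fn E M] Form E F A n :=
  LinearMap.mk₂ (Fn E M) contractFun
    (fun X X' ξ => form_ext fun Y => by
      ext m
      rw [ev_add, ev_contractFun, ev_contractFun, ev_contractFun]
      change ξ m _ = ξ m _ + ξ m _
      simp only [cons_section_apply]
      exact (ξ m).toMultilinearMap.cons_add (fun i => Y i m) (X m) (X' m))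
    (fun f X ξ => form_ext fun Y => by
      ext m
      rw [ev_smul, ev_contractFun, ev_contractFun]
      change ξ m _ = f m * ξ m _
      simp only [cons_section_apply]
      exact (ξ m).toMultilinearMap.cons_smul (fun i => Y i m) (f m) (X m))
    (fun X ξ η => rfl)
    (fun f X ξ => rfl)

theorem ev_contract {n : ℕ} (X : Sec E F A) (ξ : Form E F A (n + 1)) (Y : Fin n → Sec E F A) :
    ev (contract n X ξ) Y = ev ξ (Fin.cons X Y) := ev_contractFun X ξ Y

end Forms

end HomLie

/-! ### Forms on a vector bundle as a contraction calculus with its wedge product. -/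

namespace HomLie

section Criterion

variable {R Γ : Type*} [CommRing R] [Algebra ℝ R] [AddCommGroup Γ] [Module R Γ] [Module ℝ Γ]
  [IsScalarTower ℝ R Γ] {𝔄 : ℕ → Type*} [∀ n, AddCommGroup (𝔄 n)] [∀ n, Module R (𝔄 n)]
  [∀ n, Module ℝ (𝔄 n)] [∀ n, IsScalarTower ℝ R (𝔄 n)] {C : Contraction R Γ 𝔄}
  {mul : ∀ p q, 𝔄 p →ₗ[ℝ] 𝔄 q →ₗ[ℝ] 𝔄 (p + q)}

/-- The degrees p + (q + 1) and p + 1 + q are equal but not by definition; inside the direct sum the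
mismatch disappears. -/
theorem lof_eq_of_heq {n n' : ℕ} (h : n = n') {a : 𝔄 n} {b : 𝔄 n'} (he : HEq a b) :
    DirectSum.lof ℝ ℕ 𝔄 n a = DirectSum.lof ℝ ℕ 𝔄 n' b := by
  subst h
  rw [eq_of_heq he]

/-- A graded product is a wedge product once it is compatible with contractions degree by degree. -/
theorem Contraction.IsWedge.of_contraction
    (h01 : ∀ x q (a : 𝔄 0) (b : 𝔄 (q + 1)),
      C.ι (0 + q) x (mul 0 (q + 1) a b) = mul 0 q a (C.ι q x b))
    (h10 : ∀ x p (a : 𝔄 (p + 1)) (b : 𝔄 0),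
      C.ι (p + 0) x (mul (p + 1) 0 a b) = mul p 0 (C.ι p x a) b)
    (h11 : ∀ x p q (a : 𝔄 (p + 1)) (b : 𝔄 (q + 1)), ∃ c : 𝔄 (p + 1 + q),
      HEq c (mul p (q + 1) (C.ι p x a) b) ∧ C.ι (p + 1 + q) x (mul (p + 1) (q + 1) a b) =
        c + (-1 : ℝ) ^ (p + 1) • mul (p + 1) q a (C.ι q x b))
    (h00 : ∀ a b, C.e0 (mul 0 0 a b) = C.e0 a * C.e0 b) : C.IsWedge mul where
  tot_lof_mul x p q a b := by
    refine (congrArg _ (totalMul_lof mul p q a b)).trans ?_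
    cases p with
    | zero =>
      rw [tot_lof_zero, map_zero, LinearMap.zero_apply, pow_zero, one_smul]
      refine Eq.trans ?_ (zero_add _).symm
      cases q with
      | zero => exact (C.tot_lof_zero x _).trans (by rw [tot_lof_zero, map_zero])
      | succ q =>
        refine (C.tot_lof_succ x (0 + q) _).trans ?_
        rw [tot_lof_succ, totalMul_lof, ← h01]
    | succ p =>
      rw [tot_lof_succ, totalMul_lof]
      cases q with
      | zero =>
        refine (C.tot_lof_succ x (p + 0) _).trans ?_
        rw [tot_lof_zero, map_zero, smul_zero, ← h10]
        exact (add_zero _).symm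
      | succ q =>
        refine (C.tot_lof_succ x (p + 1 + q) _).trans ?_
        obtain ⟨c, hc, e⟩ := h11 x p q a b
        refine (congrArg _ e).trans ?_
        rw [map_add, map_smul, lof_eq_of_heq (by omega) hc, tot_lof_succ, totalMul_lof]
  e0_mul := h00

end Criterion

variable {E : Type*} [NormedAddCommGroup E] [NormedSpace ℝ E]
  {M : Type*} [TopologicalSpace M] [ChartedSpace E M]
  {F : Type*} [NormedAddCommGroup F] [NormedSpace ℝ F]
  {A : M → Type*} [∀ m, AddCommGroup (A m)] [∀ m, Module ℝ (A m)] [∀ m, TopologicalSpace (A m)]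
  [TopologicalSpace (TotalSpace F A)] [FiberBundle F A] [VectorBundle ℝ F A]
  [FiniteDimensional ℝ E] [FiniteDimensional ℝ F] [T2Space M] [IsManifold 𝓘(ℝ, E) ∞ M]
  [ContMDiffVectorBundle ∞ F A 𝓘(ℝ, E)]

section FormContraction

/-- Evaluation of forms at a point, as alternating forms on the fibre. -/
noncomputable def formAt (n : ℕ) (m : M) : Form E F A n →+ A m [⋀^Fin n]→ₗ[ℝ] ℝ where
  toFun ξ := (ξ m).toAlternatingMap
  map_zero' := rfl
  map_add' _ _ := rfl

theorem formAt_smul {n : ℕ} (m : M) (f : Fn E M) (ξ : Form E F A n) :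
    formAt n m (f • ξ) = f m • formAt n m ξ := rfl

/-- The `C^∞(M)`-linear family descends to each fibre and is uncurried there. By `form_smooth`,
smoothness is tested on sections, where the values are those of the smooth form `t (X 0)`. -/
theorem exists_form_of_fibre {n : ℕ} (t : Sec E F A →ₗ[Fn E M] Form E F A n)
    (h : ∀ m v (w : Fin n → A m) j, w j = v →
      fibre t m (formAt n m) (formAt_smul m) v w = 0) :
    ∃ ξ : Form E F A (n + 1), ∀ X, contract n X ξ = t X := by
  have h2 (m : M) : T2Space (A m) := FiberBundle.t2Space F A m
  have h3 (m : M) : FiniteDimensional ℝ (A m) := VectorBundle.finiteDimensional ℝ F A m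
  have h4 (m : M) : IsTopologicalAddGroup (A m) :=
    (VectorBundle.continuousLinearEquivAt ℝ F A m).toContinuousAddEquiv.isTopologicalAddGroup
  have h5 (m : M) : ContinuousSMul ℝ (A m) :=
    (VectorBundle.continuousLinearEquivAt ℝ F A m).continuousSMul
  let η : ∀ m : M, A m [⋀^Fin (n + 1)]→L[ℝ] Bundle.Trivial M ℝ m := fun m =>
    { altUncurry (fibre t m (formAt n m) (formAt_smul m)) (h m) with
      cont := alternatingMap_continuous _ }
  have hη : ∀ (m : M) (X : Fin (n + 1) → Sec E F A), (η m fun i => X i m) =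
      ev (t (X 0)) (fun i => X i.succ) m := fun m X =>
    (congrArg (fun f : A m [⋀^Fin n]→ₗ[ℝ] ℝ => f fun i => X i.succ m)
      (fibre_apply t m (formAt n m) (formAt_smul m) (X 0))).trans rfl
  refine ⟨⟨η, form_smooth η fun X => ?_⟩, fun X => form_ext fun Y => ?_⟩
  · exact (ev (t (X 0)) fun i => X i.succ).contMDiff.congr fun m => hη m X
  · rw [ev_contract]
    ext m
    exact hη m _

variable (E F A) in
/-- Differential forms on the bundle `A` form a contraction calculus. -/
noncomputable def formContraction : Contraction (Fn E M) (Sec E F A) (Form E F A) where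
  ι := contract
  e0 :=
    { toFun := fun ξ => ev ξ Fin.elim0
      map_add' := fun _ _ => rfl
      map_smul' := fun _ _ => rfl
      invFun := ofFn E F A
      left_inv := fun ξ => form_ext fun X => by
        ext m
        change ξ m _ = ξ m _
        exact congrArg (ξ m) (Subsingleton.elim _ _)
      right_inv := fun f => rfl }
  ι_ι n X ξ := form_ext fun Y => by
    rw [ev_contract, ev_contract]
    ext m
    exact (ξ m).map_eq_zero_of_eq _ (i := 0) (j := 1) rfl (by simp)
  ext n ξ h := form_ext fun X => by
    have := ev_contract (X 0) ξ (fun i => X i.succ)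
    rw [h (X 0)] at this
    have hX : (Fin.cons (X 0) fun i => X i.succ) = X := Fin.cons_self_tail X
    rw [hX] at this
    exact this.symm
  exists_zero t := exists_form_of_fibre t fun m v w j => j.elim0
  exists_succ n t h := exists_form_of_fibre t fun m v w j hj => by
    -- The hypothesis concerns sections; it passes to fibres because every vector extends to a
    -- global section.
    refine alternating_of_curryLeft (fun v => ?_) v w j hj
    obtain ⟨X, rfl⟩ := exists_sec_through (E := E) (F := F) m v
    rw [fibre_apply]
    ext u
    choose Y hY using fun i => exists_sec_through (E := E) (F := F) m (u i)
    have hu : u = fun i => Y i m := funext fun i => (hY i).symm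
    have := DFunLike.congr_fun (congrArg (fun ξ => ev ξ Y) (h X)) m
    simp only [ev_contract] at this
    rw [hu]
    refine Eq.trans ?_ this
    exact (congrArg (t X m) (cons_section_apply X Y m)).symm

theorem formContraction_eval {n : ℕ} (ξ : Form E F A n) (X : Fin n → Sec E F A) :
    (formContraction E F A).eval n ξ X = ev ξ X := by
  induction n with
  | zero =>
    change ev ξ _ = _
    rw [Subsingleton.elim X Fin.elim0]
  | succ n ih =>
    rw [Contraction.eval_succ, ih]
    change ev (contract n (X 0) ξ) _ = _
    rw [ev_contract]
    congr 1
    exact Fin.cons_self_tail X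

theorem formContraction_e0 (ξ : Form E F A 0) : (formContraction E F A).e0 ξ = ev ξ Fin.elim0 := rfl

theorem formContraction_pair (X : Sec E F A) (θ : Form E F A 1) :
    (formContraction E F A).pair X θ = ev θ ![X] :=
  formContraction_eval (n := 1) θ ![X]

end FormContraction

section WedgeForm

theorem exists_cast {n n' : ℕ} (h : n = n') (ξ : Form E F A n) : ∃ η : Form E F A n',
    HEq η ξ ∧ ∀ X : Fin n' → Sec E F A, ev η X = ev ξ (X ∘ Fin.cast h) := by
  subst h
  exact ⟨ξ, HEq.rfl, fun X => rfl⟩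

theorem ev_wedge {p q : ℕ} (ξ : Form E F A p) (η : Form E F A q) (X : Fin (p + q) → Sec E F A)
    (m : M) : ev (wedge p q ξ η) X m =
      altWedgeAux (formAt p m ξ) (formAt q m η) fun i => X i m := rfl

theorem ev_contract_apply {n : ℕ} (X : Sec E F A) (ξ : Form E F A (n + 1)) (Y : Fin n → Sec E F A)
    (m : M) : ev (contract n X ξ) Y m = formAt (n + 1) m ξ (Matrix.vecCons (X m) fun i => Y i m) := by
  rw [ev_contract]
  exact congrArg (ξ m) (cons_section_apply X Y m)

theorem formAt_contract {n : ℕ} (X : Sec E F A) (ξ : Form E F A (n + 1)) (m : M) :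
    formAt n m (contract n X ξ) = (formAt (n + 1) m ξ).curryLeft (X m) := rfl

theorem contract_wedge_zero_succ {q : ℕ} (X : Sec E F A) (ξ : Form E F A 0)
    (η : Form E F A (q + 1)) :
    contract (0 + q) X (wedge 0 (q + 1) ξ η) = wedge 0 q ξ (contract q X η) := by
  refine form_ext fun Y => ?_
  ext m
  rw [ev_wedge, formAt_contract]
  refine (ev_contract_apply (n := 0 + q) X _ Y m).trans ?_
  exact altWedgeAux_cons_zero_succ (q := q) (n := 0 + q) rfl rfl (formAt 0 m ξ)
    (formAt (q + 1) m η) (X m) (fun i => Y i m)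

theorem contract_wedge_succ_zero {p : ℕ} (X : Sec E F A) (ξ : Form E F A (p + 1))
    (η : Form E F A 0) :
    contract (p + 0) X (wedge (p + 1) 0 ξ η) = wedge p 0 (contract p X ξ) η := by
  refine form_ext fun Y => ?_
  ext m
  rw [ev_wedge, formAt_contract]
  refine (ev_contract_apply (n := p + 0) X _ Y m).trans ?_
  exact altWedgeAux_cons_succ_zero (p := p) (n := p + 0) rfl rfl (formAt (p + 1) m ξ)
    (formAt 0 m η) (X m) (fun i => Y i m)

theorem ev_contract_wedge_succ_succ {p q : ℕ} (X : Sec E F A) (ξ : Form E F A (p + 1))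
    (η : Form E F A (q + 1)) (h : p + (q + 1) = p + 1 + q) (Y : Fin (p + 1 + q) → Sec E F A) :
    ev (contract (p + 1 + q) X (wedge (p + 1) (q + 1) ξ η)) Y =
      ev (wedge p (q + 1) (contract p X ξ) η) (Y ∘ Fin.cast h) +
        (-1 : ℝ) ^ (p + 1) • ev (wedge (p + 1) q ξ (contract q X η)) Y := by
  ext m
  refine (ev_contract_apply (n := p + 1 + q) X _ Y m).trans ?_
  exact altWedgeAux_cons_succ_succ (p := p) (q := q) (n := p + 1 + q) rfl h rfl
    (formAt (p + 1) m ξ) (formAt (q + 1) m η) (X m) (fun i => Y i m)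

/-- Each condition is the fibrewise contraction identity for `altWedgeAux`, sorted by whether the
factors have degree zero. -/
theorem wedge_isWedge : (formContraction E F A).IsWedge wedge := by
  refine Contraction.IsWedge.of_contraction
    (fun X q ξ η => contract_wedge_zero_succ X ξ η) (fun X p ξ η => contract_wedge_succ_zero X ξ η)
    (fun X p q ξ η => ?_) fun ξ η => ?_
  · have h : p + (q + 1) = p + 1 + q := by omega
    -- The form ζ is the first product reindexed to degree p + 1 + q, where it can be added to the
    -- second.
    obtain ⟨ζ, hζ, hζ'⟩ := exists_cast h (wedge p (q + 1) (contract p X ξ) η)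
    refine ⟨ζ, hζ, form_ext fun Y => ?_⟩
    rw [ev_add, hζ']
    exact ev_contract_wedge_succ_succ X ξ η h Y
  · ext m
    change ev (wedge 0 0 ξ η) _ m = _
    rw [ev_wedge]
    refine (altWedgeAux_zero_zero _ _ _).trans ?_
    change ξ m _ * η m _ = ξ m _ * η m _
    congr 2 <;> exact Subsingleton.elim _ _

end WedgeForm

end HomLie

/-! ### Dual frames and reflexivity of the module of sections. -/

namespace HomLie

section Pairing

variable {R Γ : Type*} [CommRing R] [Algebra ℝ R] [AddCommGroup Γ] [Module ℝ Γ] [Module R Γ]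
  [IsScalarTower ℝ R Γ] {𝔄 : ℕ → Type*} [∀ n, AddCommGroup (𝔄 n)] [∀ n, Module ℝ (𝔄 n)]
  [∀ n, Module R (𝔄 n)] [∀ n, IsScalarTower ℝ R (𝔄 n)] {C : Contraction R Γ 𝔄}

theorem Contraction.pair_sum_smul {k : ℕ} (f : Fin k → R) (e : Fin k → Γ) (η : 𝔄 1) :
    C.pair (∑ i, f i • e i) η = ∑ i, f i * C.pair (e i) η := by
  simp [pair]

/-- Transposition: pairing the dual basis identity for vectors with `η` shows that the same data
form a dual basis, up to χ, of the one-forms. -/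
theorem Contraction.smul_eq_sum_pair {χ : R} {k : ℕ} {θ : Fin k → 𝔄 1} {e : Fin k → Γ}
    (h : ∀ x, ∑ i, C.pair x (θ i) • e i = χ • x) (η : 𝔄 1) :
    χ • η = ∑ i, C.pair (e i) η • θ i := by
  refine sub_eq_zero.1 (C.ext 0 _ fun x => C.e0.injective ?_)
  have h1 := congrArg (fun z => C.pair z η) (h x)
  simp only [pair_sum_smul, pair_smul] at h1
  change C.pair x _ = _
  rw [map_zero, map_sub, map_smul, map_sum, smul_eq_mul, ← h1, sub_eq_zero]
  refine Finset.sum_congr rfl fun i _ => ?_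
  rw [map_smul, smul_eq_mul, mul_comm]

end Pairing

variable {E : Type*} [NormedAddCommGroup E] [NormedSpace ℝ E]
  {M : Type*} [TopologicalSpace M] [ChartedSpace E M]
  {F : Type*} [NormedAddCommGroup F] [NormedSpace ℝ F]
  {A : M → Type*} [∀ m, AddCommGroup (A m)] [∀ m, Module ℝ (A m)] [∀ m, TopologicalSpace (A m)]
  [TopologicalSpace (TotalSpace F A)] [FiberBundle F A] [VectorBundle ℝ F A]
  [FiniteDimensional ℝ E] [FiniteDimensional ℝ F] [T2Space M] [IsManifold 𝓘(ℝ, E) ∞ M]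
  [ContMDiffVectorBundle ∞ F A 𝓘(ℝ, E)]

section Reflexive

/-- A linear functional on sections is the pairing with a form of degree one. -/
theorem exists_form_pair (t : Sec E F A →ₗ[Fn E M] Fn E M) :
    ∃ θ : Form E F A 1, ∀ X, (formContraction E F A).pair X θ = t X := by
  obtain ⟨θ, hθ⟩ := (formContraction E F A).exists_zero
    ((formContraction E F A).e0.symm.toLinearMap ∘ₗ t)
  refine ⟨θ, fun X => ?_⟩
  change (formContraction E F A).e0 ((formContraction E F A).ι 0 X θ) = _
  rw [hθ]
  exact LinearEquiv.apply_symm_apply _ _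

/-- A local frame and its coefficient functions become global after multiplication by a bump
function. -/
theorem exists_dualFrame (m : M) : ∃ (k : ℕ) (ψ : Fn E M) (θ : Fin k → Form E F A 1)
    (e : Fin k → Sec E F A), (∀ᶠ x in 𝓝 m, ψ x = 1) ∧
      ∀ X, ∑ i, (formContraction E F A).pair X (θ i) • e i = ψ • X := by
  let b := Module.finBasis ℝ F
  let e := trivializationAt F A m
  have hm : m ∈ e.baseSet := FiberBundle.mem_baseSet_trivializationAt' (F := F) (E := A) m
  obtain ⟨ψ, -, hψ⟩ := (SmoothBumpFunction.nhds_basis_tsupport (I := 𝓘(ℝ, E)) m).mem_iff.1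
    (e.open_baseSet.mem_nhds hm)
  have hsupp : ∀ x, x ∉ e.baseSet → ψ x = 0 := fun x hx => by
    by_contra h0
    exact hx (hψ (subset_tsupport _ h0))
  let Y : Fin (Module.finrank ℝ F) → Sec E F A := fun i => ⟨fun x => ψ x • e.localFrame b i x,
    ContMDiffOn.smul_section_of_tsupport ψ.contMDiff.contMDiffOn e.open_baseSet hψ
      (Trivialization.contMDiffOn_localFrame_baseSet (I := 𝓘(ℝ, E)) ∞ _ b i)⟩
  let t : Fin (Module.finrank ℝ F) → Sec E F A →ₗ[Fn E M] Fn E M := fun i =>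
    { toFun := fun X => ⟨fun x => ψ x • e.localFrameCoeff 𝓘(ℝ, E) b i x (X x), by
        refine contMDiff_of_tsupport fun x hx => ?_
        have hx' : x ∈ e.baseSet := hψ (closure_mono (fun y hy => ?_) hx)
        · exact ψ.contMDiff.contMDiffAt.smul
            (contMDiffAt_localFrameCoeff b hx' (X.contMDiff x) i)
        · intro h
          apply hy
          simp [h]⟩
      map_add' := fun X X' => by
        ext x
        change ψ x • e.localFrameCoeff 𝓘(ℝ, E) b i x (X x + X' x) = _
        rw [map_add, smul_add]
        rfl
      map_smul' := fun f X => by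
        ext x
        change ψ x • e.localFrameCoeff 𝓘(ℝ, E) b i x (f x • X x) = _
        rw [map_smul, smul_comm]
        rfl }
  choose θ hθ using fun i => exists_form_pair (t i)
  -- Frame and coframe each carry one factor of the bump function, so the resulting cutoff is its
  -- square, still equal to one near m.
  refine ⟨_, ⟨fun x => ψ x * ψ x, ψ.contMDiff.mul ψ.contMDiff⟩, θ, Y, ?_, fun X => ?_⟩
  · filter_upwards [ψ.eventuallyEq_one] with x hx
    change ψ x * ψ x = 1
    rw [hx]
    simp
  · ext x
    rw [← ContMDiffSection.coeAddHom_apply, map_sum, Finset.sum_apply]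
    simp only [hθ]
    change ∑ i, (ψ x • e.localFrameCoeff 𝓘(ℝ, E) b i x (X x)) •
      (ψ x • e.localFrame b i x) = (ψ x * ψ x) • X x
    by_cases hx : x ∈ e.baseSet
    · conv_rhs => rw [e.eq_sum_localFrameCoeff_smul (I := 𝓘(ℝ, E)) (s := fun x => X x) (b := b) hx,
        Finset.smul_sum]
      refine Finset.sum_congr rfl fun i _ => ?_
      simp only [smul_smul, smul_eq_mul]
      congr 1
      ring
    · simp [hsupp x hx]

theorem section_sum_apply {k : ℕ} (f : Fin k → Fn E M) (e : Fin k → Sec E F A) (m : M) :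
    (∑ i, f i • e i : Sec E F A) m = ∑ i, f i m • e i m := by
  rw [← ContMDiffSection.coeAddHom_apply, map_sum, Finset.sum_apply]
  rfl

/-- Forms of degree one separate the points of the fibres. -/
theorem section_apply_eq_of_pair {X Y : Sec E F A} {m : M}
    (h : ∀ θ, (formContraction E F A).pair X θ m = (formContraction E F A).pair Y θ m) :
    X m = Y m := by
  obtain ⟨k, ψ, θ, e, hψ, he⟩ := exists_dualFrame (E := E) (F := F) (A := A) m
  have key : ∀ Z : Sec E F A, Z m = ∑ i, (formContraction E F A).pair Z (θ i) m • e i m := by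
    intro Z
    rw [← section_sum_apply, he, section_smul_apply, hψ.self_of_nhds, one_smul]
  rw [key X, key Y]
  simp only [h]

/-- A functional Φ on one-forms is represented near m by `∑ Φ(θᵢ) eᵢ`, whose pairing with η is `ψ
Φ(η)`. Representatives agree wherever their cutoffs equal one, because one-forms separate points of
the fibres, so they glue without a partition of unity. -/
theorem formContraction_isReflexive : (formContraction E F A).IsReflexive where
  eq_zero_of_pair X h := ContMDiffSection.ext fun m =>
    section_apply_eq_of_pair (Y := 0) fun θ => by rw [h]; simp [Contraction.pair]
  eq_zero_of_cutoff f h := by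
    ext m
    obtain ⟨k, ψ, θ, e, hψ, he⟩ := exists_dualFrame (E := E) (F := F) (A := A) m
    have := DFunLike.congr_fun (h ψ ⟨k, θ, e, he⟩) m
    change ψ m * f m = 0 at this
    rwa [hψ.self_of_nhds, one_mul] at this
  exists_pair Φ := by
    choose k ψ θ e hψ he using exists_dualFrame (E := E) (F := F) (A := A)
    have hdual : ∀ m η, ψ m • η = ∑ i, (formContraction E F A).pair (e m i) η • θ m i := by
      intro m η
      exact Contraction.smul_eq_sum_pair (he m) η
    let X : M → Sec E F A := fun m => ∑ i, Φ (θ m i) • e m i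
    have hX : ∀ m η, (formContraction E F A).pair (X m) η = ψ m * Φ η := by
      intro m η
      rw [← smul_eq_mul, ← map_smul, hdual, map_sum, Contraction.pair_sum_smul]
      simp only [map_smul, smul_eq_mul, mul_comm]
    have hloc : ∀ m x, ψ m x = 1 → X x x = X m x := fun m x hx =>
      section_apply_eq_of_pair fun η => by
        rw [hX, hX]
        change ψ x x * _ = ψ m x * _
        rw [hx, (hψ x).self_of_nhds]
    -- At x the representative chosen for x itself is used; near m this coincides with the single
    -- smooth section `X m`.
    refine ⟨⟨fun x => X x x, fun m => ?_⟩, fun η => ?_⟩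
    · refine ((X m).contMDiff m).congr_of_eventuallyEq ?_
      filter_upwards [hψ m] with x hx
      rw [hloc m x hx]
    · ext m
      have h1 := DFunLike.congr_fun (hX m η) m
      change _ = ψ m m * Φ η m at h1
      rw [(hψ m).self_of_nhds, one_mul] at h1
      rw [← h1, formContraction_pair, formContraction_pair]
      change η m _ = η m _
      congr 1
      funext i
      fin_cases i
      rfl

end Reflexive

end HomLie

/-! ### Hadamard's lemma. -/

namespace HomLie

section Hadamard

open MeasureTheory Set

variable {E : Type*} [NormedAddCommGroup E] [NormedSpace ℝ E]

/-- The integral is the value at 0 of the convolution of the indicator of [0,1] with a compactly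
supported function depending smoothly on u, so smooth dependence on u is that of convolutions with
parameters. -/
theorem contDiff_integral_lineMap {G : Type*} [NormedAddCommGroup G] [NormedSpace ℝ G]
    {H : E → G} (hH : ContDiff ℝ ∞ H) (u₀ : E) :
    ContDiff ℝ ∞ fun u => ∫ t in Icc (0 : ℝ) 1, H (u₀ + t • (u - u₀)) := by
  -- At 0 the convolution evaluates its second factor at -t, hence the minus sign in `g`. The bump
  -- is 1 on [-1,1], which contains every such -t, and vanishes outside radius 2.
  let β : ContDiffBump (0 : ℝ) := ⟨1, 2, one_pos, one_lt_two⟩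
  let g : E → ℝ → G := fun u s => β s • H (u₀ - s • (u - u₀))
  have hf : LocallyIntegrable ((Icc (0 : ℝ) 1).indicator fun _ => (1 : ℝ)) volume :=
    (integrable_indicator_iff measurableSet_Icc).2
      (integrableOn_const (by simp)) |>.locallyIntegrable
  have hg : ContDiff ℝ ∞ ↿g := by
    refine ContDiff.smul (β.contDiff.comp contDiff_snd) (hH.comp ?_)
    exact contDiff_const.sub (contDiff_snd.smul (contDiff_fst.sub contDiff_const))
  have h := contDiffOn_convolution_right_with_param (n := ⊤) (μ := volume)
    (ContinuousLinearMap.lsmul ℝ ℝ) isOpen_univ (isCompact_closedBall (0 : ℝ) 2)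
    (g := g) (fun u s _ hs => by
      have : β s = 0 := β.zero_of_le_dist (by simpa using (not_le.1 (by simpa using hs)).le)
      simp [g, this]) hf hg.contDiffOn
  rw [univ_prod_univ, contDiffOn_univ] at h
  have h2 := h.comp (contDiff_id.prodMk (contDiff_const (c := (0 : ℝ))))
  convert h2 using 1
  funext u
  rw [← integral_indicator measurableSet_Icc]
  refine integral_congr_ae (Eventually.of_forall fun t => ?_)
  by_cases ht : t ∈ Icc (0 : ℝ) 1
  · have : β (-t) = 1 := β.one_of_mem_closedBall (by
      simp only [Metric.mem_closedBall, dist_zero_right, norm_neg, Real.norm_eq_abs]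
      exact abs_le.2 ⟨by linarith [ht.1], ht.2⟩)
    simp [ht, g, this]
  · simp [ht]

/-- Hadamard's lemma. -/
theorem exists_contDiff_sub_eq {f : E → ℝ} (hf : ContDiff ℝ ∞ f) (u₀ : E) :
    ∃ G : E → (E →L[ℝ] ℝ), ContDiff ℝ ∞ G ∧ ∀ u, f u - f u₀ = G u (u - u₀) := by
  have hf' : ContDiff ℝ ∞ (fderiv ℝ f) := hf.fderiv_right (by simp)
  refine ⟨_, contDiff_integral_lineMap hf' u₀, fun u => ?_⟩
  have hc : Continuous fun t : ℝ => fderiv ℝ f (u₀ + t • (u - u₀)) :=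
    hf'.continuous.comp (by fun_prop)
  rw [ContinuousLinearMap.integral_apply (hc.integrableOn_Icc), integral_Icc_eq_integral_Ioc,
    ← intervalIntegral.integral_of_le zero_le_one,
    intervalIntegral.integral_eq_sub_of_hasDerivAt (f := fun t : ℝ => f (u₀ + t • (u - u₀)))]
  · simp
  · intro t _
    have h1 : HasDerivAt (fun t : ℝ => u₀ + t • (u - u₀)) (u - u₀) t := by
      simpa using ((hasDerivAt_id t).smul_const (u - u₀)).const_add u₀
    exact ((hf.differentiable (by simp)).differentiableAt.hasFDerivAt).comp_hasDerivAt t h1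
  · exact (hc.clm_apply continuous_const).intervalIntegrable _ _

end Hadamard

end HomLie

/-! ### Derivations at a point are tangent vectors. -/

namespace HomLie

section PointDerivation

variable {E : Type*} [NormedAddCommGroup E] [NormedSpace ℝ E]
  {M : Type*} [TopologicalSpace M] [ChartedSpace E M]

/-- `D` is a derivation at the point `x`. -/
def IsDerivAt (x : M) (D : Fn E M →ₗ[ℝ] ℝ) : Prop :=
  ∀ f g, D (f * g) = f x * D g + g x * D f

namespace IsDerivAt

variable {x : M} {D : Fn E M →ₗ[ℝ] ℝ}

theorem apply_one (h : IsDerivAt x D) : D 1 = 0 := by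
  have := h 1 1
  rw [mul_one] at this
  change D 1 = 1 * D 1 + 1 * D 1 at this
  linarith

theorem apply_const_smul_one (h : IsDerivAt x D) (c : ℝ) : D (c • 1) = 0 := by
  rw [map_smul, h.apply_one, smul_zero]

variable [FiniteDimensional ℝ E] [T2Space M] [IsManifold 𝓘(ℝ, E) ∞ M]

/-- Locality: a bump function supported where f vanishes has product zero with f, and the Leibniz
rule at x leaves `D f`. -/
theorem apply_eq_zero (h : IsDerivAt x D) {f : Fn E M} (hf : ∀ᶠ y in 𝓝 x, f y = 0) : D f = 0 := by
  obtain ⟨ψ, -, hψ⟩ := (SmoothBumpFunction.nhds_basis_tsupport (I := 𝓘(ℝ, E)) x).mem_iff.1 hf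
  let χ : Fn E M := ⟨ψ, ψ.contMDiff⟩
  have h0 : χ * f = 0 := by
    ext y
    change ψ y * f y = 0
    by_cases hy : ψ y = 0
    · rw [hy, zero_mul]
    · have : f y = 0 := hψ (subset_tsupport _ hy)
      rw [this, mul_zero]
  have h1 := h χ f
  have h2 : χ x = 1 := ψ.eq_one
  rw [h0, map_zero, h2, hf.self_of_nhds, zero_mul, one_mul, add_zero] at h1
  exact h1.symm

theorem apply_congr (h : IsDerivAt x D) {f g : Fn E M} (hf : ∀ᶠ y in 𝓝 x, f y = g y) :
    D f = D g := by
  rw [← sub_eq_zero, ← map_sub]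
  exact h.apply_eq_zero (hf.mono fun y hy => sub_eq_zero.2 hy)

end IsDerivAt

variable [FiniteDimensional ℝ E] [T2Space M] [IsManifold 𝓘(ℝ, E) ∞ M]

/-- Differentiation along a tangent vector. -/
noncomputable def tangentDeriv (x : M) : TangentSpace 𝓘(ℝ, E) x →ₗ[ℝ] Fn E M →ₗ[ℝ] ℝ :=
  LinearMap.mk₂ ℝ (fun v f => (mfderiv 𝓘(ℝ, E) 𝓘(ℝ, ℝ) f x v : ℝ))
    (fun v w f => map_add _ v w) (fun c v f => map_smul _ c v)
    (fun v f g => by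
      change mfderiv _ _ (⇑f + ⇑g) _ _ = _
      rw [mfderiv_add (f.contMDiff.mdifferentiableAt (by simp))
        (g.contMDiff.mdifferentiableAt (by simp))]; rfl)
    (fun c v f => by
      change mfderiv _ _ (c • ⇑f) _ _ = _
      rw [const_smul_mfderiv (f.contMDiff.mdifferentiableAt (by simp))]; rfl)

theorem tangentDeriv_isDerivAt (x : M) (v : TangentSpace 𝓘(ℝ, E) x) :
    IsDerivAt x (tangentDeriv x v) := fun f g => by
  have := ((f.contMDiff.mdifferentiableAt (x := x) (by simp)).hasMFDerivAt.mul
    (g.contMDiff.mdifferentiableAt (x := x) (by simp)).hasMFDerivAt).mfderiv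
  exact congrArg (fun L : E →L[ℝ] ℝ => L v) this

section Chart

variable {p : M} (ψ : SmoothBumpFunction 𝓘(ℝ, E) p)

/-- A function on the model space, cut off and transported to the manifold by a chart. -/
noncomputable def chartFn (h : E → ℝ) (hh : ContDiff ℝ ∞ h) : Fn E M :=
  ⟨fun y => ψ y • h (extChartAt 𝓘(ℝ, E) p y), ψ.contMDiff_smul
    (hh.contMDiff.comp_contMDiffOn contMDiffOn_extChartAt)⟩

theorem chartFn_eventuallyEq {x : M} (hx : ψ =ᶠ[𝓝 x] 1) (h : E → ℝ) (hh : ContDiff ℝ ∞ h) :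
    chartFn ψ h hh =ᶠ[𝓝 x] h ∘ extChartAt 𝓘(ℝ, E) p := by
  filter_upwards [hx] with y hy
  change ψ y • h (extChartAt 𝓘(ℝ, E) p y) = _
  rw [hy]
  exact one_smul ℝ _

/-- Inside the chart target this is a product of smooth functions. Any other point lies outside the
closed support ball of the bump, so the product is zero nearby. -/
theorem contDiff_bump_mul_comp_symm (f : Fn E M) :
    ContDiff ℝ ∞ fun u => ψ.toContDiffBump u * f ((extChartAt 𝓘(ℝ, E) p).symm u) := by
  rw [contDiff_iff_contDiffAt]
  intro u
  by_cases hu : u ∈ (extChartAt 𝓘(ℝ, E) p).target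
  · refine ψ.toContDiffBump.contDiffAt.mul ?_
    rw [← contMDiffAt_iff_contDiffAt]
    exact f.contMDiff.contMDiffAt.comp u ((contMDiffOn_extChartAt_symm p).contMDiffAt
      ((isOpen_extChartAt_target p).mem_nhds hu))
  · have h1 : u ∉ Metric.closedBall (extChartAt 𝓘(ℝ, E) p p) ψ.rOut := fun h =>
      hu (ψ.closedBall_subset ⟨h, by simp⟩)
    have h2 : (Metric.closedBall (extChartAt 𝓘(ℝ, E) p p) ψ.rOut)ᶜ ∈ 𝓝 u :=
      Metric.isClosed_closedBall.isOpen_compl.mem_nhds h1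
    refine (contDiffAt_const (c := (0 : ℝ))).congr_of_eventuallyEq ?_
    filter_upwards [h2] with w hw
    rw [ψ.toContDiffBump.zero_of_le_dist (not_le.1 fun h => hw h).le, zero_mul]

/-- Hadamard's lemma is applied on the whole model space to the cut-off function, and the cut-off is
invisible near x. The point x need not be the centre p of the chart; this uniformity gives
smoothness of the anchor later. -/
theorem eventually_sub_eq {x : M} (hx : ψ =ᶠ[𝓝 x] 1) (hs : x ∈ (chartAt E p).source) (f : Fn E M) :
    ∃ G : E → (E →L[ℝ] ℝ), ContDiff ℝ ∞ G ∧ ∀ᶠ y in 𝓝 x, f y - f x =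
      G (extChartAt 𝓘(ℝ, E) p y) (extChartAt 𝓘(ℝ, E) p y - extChartAt 𝓘(ℝ, E) p x) := by
  obtain ⟨G, hG, h⟩ := exists_contDiff_sub_eq (contDiff_bump_mul_comp_symm ψ f)
    (extChartAt 𝓘(ℝ, E) p x)
  have key : ∀ᶠ y in 𝓝 x, ψ.toContDiffBump (extChartAt 𝓘(ℝ, E) p y) *
      f ((extChartAt 𝓘(ℝ, E) p).symm (extChartAt 𝓘(ℝ, E) p y)) = f y := by
    filter_upwards [hx, (chartAt E p).open_source.mem_nhds hs] with y hy hys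
    have : ψ y = ψ.toContDiffBump (extChartAt 𝓘(ℝ, E) p y) := ψ.eqOn_source hys
    rw [← this, hy, (extChartAt 𝓘(ℝ, E) p).left_inv (by simpa using hys)]
    exact one_mul _
  refine ⟨G, hG, ?_⟩
  filter_upwards [key] with y hy
  rw [← h, hy, key.self_of_nhds]

variable {ι : Type*} [Fintype ι] (b : Module.Basis ι ℝ E)

/-- A coordinate function of a chart, cut off. -/
noncomputable def chartCoord (i : ι) : Fn E M :=
  chartFn ψ (b.coord i).toContinuousLinearMap (ContinuousLinearMap.contDiff _)

/-- A derivation at a point is determined by its values on the coordinate functions. -/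
theorem exists_eq_sum_chartCoord {x : M} (hx : ψ =ᶠ[𝓝 x] 1) (hs : x ∈ (chartAt E p).source)
    (f : Fn E M) : ∃ c : ι → ℝ, ∀ D : Fn E M →ₗ[ℝ] ℝ, IsDerivAt x D →
      D f = ∑ i, c i * D (chartCoord ψ b i) := by
  obtain ⟨G, hG, h⟩ := eventually_sub_eq ψ hx hs f
  let g : ι → Fn E M := fun i => chartFn ψ (fun u => G u (b i)) (hG.clm_apply contDiff_const)
  -- The coefficients depend on f and x but not on D, so derivations that agree on the coordinates
  -- agree on f.
  refine ⟨fun i => g i x, fun D hD => ?_⟩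
  have h1 : D f = D (f x • 1 + ∑ i, g i * (chartCoord ψ b i - chartCoord ψ b i x • 1)) := by
    refine hD.apply_congr ?_
    have e1 : ∀ᶠ y in 𝓝 x, ∀ i, g i y = G (extChartAt 𝓘(ℝ, E) p y) (b i) :=
      eventually_all.2 fun i => chartFn_eventuallyEq ψ hx _ _
    have e2 : ∀ᶠ y in 𝓝 x, ∀ i, chartCoord ψ b i y = b.coord i (extChartAt 𝓘(ℝ, E) p y) :=
      eventually_all.2 fun i => chartFn_eventuallyEq ψ hx _ _
    filter_upwards [h, e1, e2] with y hy hy1 hy2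
    have hsum : (f x • (1 : Fn E M) +
        ∑ i, g i * (chartCoord ψ b i - chartCoord ψ b i x • 1) : Fn E M) y =
        f x + ∑ i, g i y * (chartCoord ψ b i y - chartCoord ψ b i x) := by
      have h3 : ∀ k : ι → Fn E M, (∑ i, k i : Fn E M) y = ∑ i, k i y := fun k =>
        map_sum ((Pi.evalAddMonoidHom (fun _ : M => ℝ) y).comp
          (ContMDiffMap.coeFnAddMonoidHom : Fn E M →+ M → ℝ)) k Finset.univ
      change f x * 1 + (∑ i, g i * (chartCoord ψ b i - chartCoord ψ b i x • 1) : Fn E M) y = _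
      rw [h3, mul_one]
      congr 1
      refine Finset.sum_congr rfl fun i _ => ?_
      change g i y * (chartCoord ψ b i y - chartCoord ψ b i x * 1) = _
      rw [mul_one]
    rw [hsum, ← sub_eq_iff_eq_add', hy]
    conv_lhs => rw [← b.sum_repr (extChartAt 𝓘(ℝ, E) p y - extChartAt 𝓘(ℝ, E) p x)]
    rw [map_sum]
    refine Finset.sum_congr rfl fun i _ => ?_
    rw [hy1, hy2, e2.self_of_nhds, map_smul, ← map_sub, smul_eq_mul, mul_comm]
    rfl
  rw [h1, map_add, hD.apply_const_smul_one, zero_add, map_sum]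
  refine Finset.sum_congr rfl fun i _ => ?_
  rw [hD, map_sub, hD.apply_const_smul_one, sub_zero]
  have : (chartCoord ψ b i - chartCoord ψ b i x • 1 : Fn E M) x = 0 := by
    change chartCoord ψ b i x - chartCoord ψ b i x * 1 = 0
    ring
  rw [this, zero_mul, add_zero]

theorem tangentDeriv_chartCoord {x : M} (hx : ψ =ᶠ[𝓝 x] 1) (hs : x ∈ (chartAt E p).source)
    (v : TangentSpace 𝓘(ℝ, E) x) (i : ι) : tangentDeriv x v (chartCoord ψ b i) =
      b.coord i ((trivializationAt E (TangentSpace 𝓘(ℝ, E)) p).continuousLinearMapAt ℝ x v) := by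
  have h1 : (chartCoord ψ b i : M → ℝ) =ᶠ[𝓝 x]
    (b.coord i).toContinuousLinearMap ∘ extChartAt 𝓘(ℝ, E) p := chartFn_eventuallyEq ψ hx _ _
  refine (congrArg (fun L : E →L[ℝ] ℝ => L v) h1.mfderiv_eq).trans ?_
  refine (congrArg (fun L : E →L[ℝ] ℝ => L v) (mfderiv_comp x
    (ContinuousLinearMap.mdifferentiableAt _) (mdifferentiableAt_extChartAt hs))).trans ?_
  rw [TangentBundle.continuousLinearMapAt_trivializationAt hs, ContinuousLinearMap.mfderiv_eq]
  rfl

/-- Both derivations take the same values on the coordinate functions. The explicit vector,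
available at every x near p, is what `tangentOf_section_contMDiffAt` uses. -/
theorem eq_tangentDeriv {x : M} (hx : ψ =ᶠ[𝓝 x] 1) (hs : x ∈ (chartAt E p).source)
    {D : Fn E M →ₗ[ℝ] ℝ} (hD : IsDerivAt x D) :
    D = tangentDeriv x ((trivializationAt E (TangentSpace 𝓘(ℝ, E)) p).symmL ℝ x
      (∑ i, D (chartCoord ψ b i) • b i)) := by
  ext f
  obtain ⟨c, hc⟩ := exists_eq_sum_chartCoord ψ b hx hs f
  rw [hc D hD, hc _ (tangentDeriv_isDerivAt x _)]
  refine Finset.sum_congr rfl fun i _ => ?_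
  rw [tangentDeriv_chartCoord ψ b hx hs, Trivialization.continuousLinearMapAt_symmL]
  · rw [Module.Basis.coord_apply, Module.Basis.repr_sum_self]
  · simpa using hs

end Chart

theorem tangentDeriv_injective (x : M) : Function.Injective (tangentDeriv (E := E) x) := by
  rw [← LinearMap.ker_eq_bot, LinearMap.ker_eq_bot']
  intro v hv
  obtain ⟨ψ⟩ : Nonempty (SmoothBumpFunction 𝓘(ℝ, E) x) := inferInstance
  let b := Module.finBasis ℝ E
  have hs : x ∈ (trivializationAt E (TangentSpace 𝓘(ℝ, E)) x).baseSet :=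
    FiberBundle.mem_baseSet_trivializationAt' x
  have : (trivializationAt E (TangentSpace 𝓘(ℝ, E)) x).continuousLinearMapAt ℝ x v = 0 := by
    refine b.ext_elem_iff.2 fun i => ?_
    have := tangentDeriv_chartCoord ψ b ψ.eventuallyEq_one (mem_chart_source E x) v i
    rw [hv] at this
    rw [map_zero]
    exact this.symm
  rw [← Trivialization.symmL_continuousLinearMapAt (R := ℝ) _ hs v, this, map_zero]

theorem exists_tangentDeriv {x : M} {D : Fn E M →ₗ[ℝ] ℝ} (hD : IsDerivAt x D) :
    ∃ v, tangentDeriv x v = D := by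
  obtain ⟨ψ⟩ : Nonempty (SmoothBumpFunction 𝓘(ℝ, E) x) := inferInstance
  exact ⟨_, (eq_tangentDeriv ψ (Module.finBasis ℝ E) ψ.eventuallyEq_one
    (mem_chart_source E x) hD).symm⟩

end PointDerivation

end HomLie

/-! ### Smooth bundle maps from linear families of derivations. -/

namespace HomLie

variable {E : Type*} [NormedAddCommGroup E] [NormedSpace ℝ E]
  {M : Type*} [TopologicalSpace M] [ChartedSpace E M]
  {F : Type*} [NormedAddCommGroup F] [NormedSpace ℝ F]
  {A : M → Type*} [∀ m, AddCommGroup (A m)] [∀ m, Module ℝ (A m)] [∀ m, TopologicalSpace (A m)]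
  [TopologicalSpace (TotalSpace F A)] [FiberBundle F A] [VectorBundle ℝ F A]
  [FiniteDimensional ℝ E] [FiniteDimensional ℝ F] [T2Space M] [IsManifold 𝓘(ℝ, E) ∞ M]
  [ContMDiffVectorBundle ∞ F A 𝓘(ℝ, E)]

section TangentOf

variable (a : Sec E F A →ₗ[Fn E M] Derivation ℝ (Fn E M) (Fn E M))

/-- A derivation of the smooth functions, evaluated at a point. -/
noncomputable def derivationAt (x : M) : Derivation ℝ (Fn E M) (Fn E M) →+ (Fn E M →ₗ[ℝ] ℝ) where
  toFun D :=
    { toFun := fun f => D f x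
      map_add' := fun f g => by rw [map_add]; rfl
      map_smul' := fun c f => congrArg (fun g : Fn E M => g x) (D.toLinearMap.map_smul c f) }
  map_zero' := rfl
  map_add' _ _ := rfl

theorem derivationAt_isDerivAt (x : M) (D : Derivation ℝ (Fn E M) (Fn E M)) :
    IsDerivAt x (derivationAt x D) := fun f g => by
  change D (f * g) x = f x * D g x + g x * D f x
  rw [D.leibniz]
  rfl

theorem derivationAt_smul (x : M) (f : Fn E M) (D : Derivation ℝ (Fn E M) (Fn E M)) :
    derivationAt x (f • D) = f x • derivationAt x D := rfl

/-- The derivation at `x` given by a vector of the fibre at `x`. -/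
noncomputable def fibreDeriv (x : M) : A x →ₗ[ℝ] Fn E M →ₗ[ℝ] ℝ :=
  fibre a x (derivationAt x) (derivationAt_smul x)

theorem fibreDeriv_apply (x : M) (X : Sec E F A) : fibreDeriv a x (X x) = derivationAt x (a X) :=
  fibre_apply a x _ _ X

theorem fibreDeriv_mem (x : M) (v : A x) :
    fibreDeriv a x v ∈ LinearMap.range (tangentDeriv (E := E) x) := by
  obtain ⟨X, rfl⟩ := exists_sec_through (E := E) (F := F) x v
  rw [fibreDeriv_apply]
  exact exists_tangentDeriv (derivationAt_isDerivAt x _)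

/-- The bundle map to the tangent bundle induced by a `C^∞(M)`-linear map from sections to
derivations. -/
noncomputable def tangentOf (x : M) : A x →ₗ[ℝ] TangentSpace 𝓘(ℝ, E) x :=
  (LinearEquiv.ofInjective _ (tangentDeriv_injective x)).symm.toLinearMap ∘ₗ
    (fibreDeriv a x).codRestrict _ (fibreDeriv_mem a x)

theorem tangentDeriv_tangentOf (x : M) (v : A x) :
    tangentDeriv x (tangentOf a x v) = fibreDeriv a x v :=
  congrArg Subtype.val ((LinearEquiv.ofInjective _ (tangentDeriv_injective x)).apply_symm_apply
    ((fibreDeriv a x).codRestrict _ (fibreDeriv_mem a x) v))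

theorem tangentOf_apply (x : M) (X : Sec E F A) (f : Fn E M) :
    tangentDeriv x (tangentOf a x (X x)) f = a X f x := by
  rw [tangentDeriv_tangentOf, fibreDeriv_apply]
  rfl

/-- In the trivialization around q, the components of the vector field are the smooth functions `a X
(chartCoord ψ b i)`. -/
theorem tangentOf_section_contMDiffAt (X : Sec E F A) (q : M) :
    ContMDiffAt 𝓘(ℝ, E) 𝓘(ℝ, E) ∞ (fun y => (trivializationAt E (TangentSpace 𝓘(ℝ, E)) q
      ⟨y, tangentOf a y (X y)⟩).2) q := by
  obtain ⟨ψ⟩ : Nonempty (SmoothBumpFunction 𝓘(ℝ, E) q) := inferInstance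
  let b := Module.finBasis ℝ E
  have h : ContMDiffAt 𝓘(ℝ, E) 𝓘(ℝ, E) ∞ (fun y => ∑ i, a X (chartCoord ψ b i) y • b i) q :=
    ContMDiffAt.sum fun i _ => (a X (chartCoord ψ b i)).contMDiff.contMDiffAt.smul
      contMDiffAt_const
  refine h.congr_of_eventuallyEq ?_
  filter_upwards [ψ.eventuallyEq_one.eventuallyEq_nhds,
    (chartAt E q).open_source.mem_nhds (mem_chart_source E q)] with y hy hs
  have hs' : y ∈ (trivializationAt E (TangentSpace 𝓘(ℝ, E)) q).baseSet := by simpa using hs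
  have h1 : tangentOf a y (X y) = (trivializationAt E (TangentSpace 𝓘(ℝ, E)) q).symmL ℝ y
      (∑ i, a X (chartCoord ψ b i) y • b i) := by
    apply tangentDeriv_injective y
    rw [tangentDeriv_tangentOf, fibreDeriv_apply]
    exact eq_tangentDeriv ψ b hy hs (derivationAt_isDerivAt y (a X))
  rw [← Trivialization.continuousLinearMapAt_apply_of_mem (R := ℝ) _ hs', h1,
    Trivialization.continuousLinearMapAt_symmL _ hs']

theorem eq_sum_coord_smul_symmL (e : Trivialization F (π F A)) [e.IsLinear ℝ] {ι : Type*} [Fintype ι]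
    (b : Module.Basis ι ℝ F) {y : M} (hy : y ∈ e.baseSet) (v : A y) :
    v = ∑ i, b.coord i (e ⟨y, v⟩).2 • e.symmL ℝ y (b i) := by
  have e0 := e.symmL_continuousLinearMapAt (R := ℝ) hy v
  rw [Trivialization.continuousLinearMapAt_apply_of_mem _ _ hy] at e0
  conv_lhs => rw [← e0]
  conv_lhs => rw [← b.sum_repr (e ⟨y, v⟩).2]
  rw [map_sum]
  exact Finset.sum_congr rfl fun i _ => map_smul _ _ _

/-- The bundle map `tangentOf`, pulled back along `φ`. -/
noncomputable def anchorOf (φ : C^∞⟮𝓘(ℝ, E), M; 𝓘(ℝ, E), M⟯) : Anchor F A φ where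
  toFun m := tangentOf a (φ m)
  smooth := by
    intro p₀
    let q := φ p₀.1
    let e := trivializationAt F A q
    let e' := trivializationAt E (TangentSpace 𝓘(ℝ, E) : M → Type _) q
    have hp : ContMDiffAt (𝓘(ℝ, E).prod 𝓘(ℝ, F)) 𝓘(ℝ, E) ∞
        (fun p : TotalSpace F (φ *ᵖ A) => p.1) p₀ := contMDiffAt_proj (φ *ᵖ A)
    have hφ : ContMDiffAt (𝓘(ℝ, E).prod 𝓘(ℝ, F)) 𝓘(ℝ, E) ∞
        (fun p : TotalSpace F (φ *ᵖ A) => φ p.1) p₀ := (φ.contMDiff _).comp p₀ hp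
    rw [contMDiffAt_totalSpace]
    refine ⟨hp, ?_⟩
    change ContMDiffAt _ _ _ (fun p : TotalSpace F (φ *ᵖ A) =>
      (e' ⟨φ p.1, tangentOf a (φ p.1) p.2⟩).2) p₀
    have hfib : ContMDiffAt (𝓘(ℝ, E).prod 𝓘(ℝ, F)) 𝓘(ℝ, F) ∞
        (fun p : TotalSpace F (φ *ᵖ A) => (e ⟨φ p.1, p.2⟩).2) p₀ :=
      (contMDiffAt_totalSpace.1 (contMDiffAt_id (x := p₀))).2
    have hq : q ∈ e.baseSet := FiberBundle.mem_baseSet_trivializationAt' (F := F) (E := A) q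
    have hq' : q ∈ e'.baseSet := FiberBundle.mem_baseSet_trivializationAt' q
    let b := Module.finBasis ℝ F
    choose f X hf hX using fun i => exists_sec (E := E) (F := F) q (e.localFrame b i) _
      e.open_baseSet hq (Trivialization.contMDiffOn_localFrame_baseSet (I := 𝓘(ℝ, E)) ∞ _ b i)
    -- By fibrewise linearity, near the base point the map is a sum of fibre coordinates times the
    -- images of frame sections; both factors are smooth on the total space.
    have h : ContMDiffAt (𝓘(ℝ, E).prod 𝓘(ℝ, F)) 𝓘(ℝ, E) ∞ (fun p : TotalSpace F (φ *ᵖ A) =>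
        ∑ i, (b.coord i).toContinuousLinearMap (e ⟨φ p.1, p.2⟩).2 •
          (e' ⟨φ p.1, tangentOf a (φ p.1) (X i (φ p.1))⟩).2) p₀ := by
      refine ContMDiffAt.sum fun i _ => ?_
      have h1 : ContMDiffAt (𝓘(ℝ, E).prod 𝓘(ℝ, F)) 𝓘(ℝ, ℝ) ∞ (fun p : TotalSpace F (φ *ᵖ A) =>
          (b.coord i).toContinuousLinearMap (e ⟨φ p.1, p.2⟩).2) p₀ :=
        (ContinuousLinearMap.contMDiff _).contMDiffAt.comp p₀ hfib
      have h2 : ContMDiffAt (𝓘(ℝ, E).prod 𝓘(ℝ, F)) 𝓘(ℝ, E) ∞ (fun p : TotalSpace F (φ *ᵖ A) =>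
          (e' ⟨φ p.1, tangentOf a (φ p.1) (X i (φ p.1))⟩).2) p₀ :=
        ContMDiffAt.comp (g := fun y => (e' ⟨y, tangentOf a y (X i y)⟩).2) p₀
          (tangentOf_section_contMDiffAt a (X i) q) hφ
      exact h1.smul h2
    refine h.congr_of_eventuallyEq ?_
    have hev : ∀ᶠ y in 𝓝 q, (∀ i, f i y = 1) ∧ y ∈ e.baseSet ∧ y ∈ e'.baseSet :=
      (eventually_all.2 hf).and (Filter.Eventually.and (e.open_baseSet.mem_nhds hq)
        (e'.open_baseSet.mem_nhds hq'))
    filter_upwards [hφ.continuousAt.eventually hev] with p hp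
    obtain ⟨h1, h2, h3⟩ := hp
    have hv : (p.2 : A (φ p.1)) = ∑ i, (b.coord i) (e ⟨φ p.1, p.2⟩).2 • X i (φ p.1) := by
      refine (eq_sum_coord_smul_symmL e b h2 p.2).trans (Finset.sum_congr rfl fun i _ => ?_)
      rw [hX, h1, one_smul, Trivialization.localFrame_apply_of_mem_baseSet _ _ h2]
      congr 1
      exact Trivialization.symmL_apply (R := ℝ) _ h2 _
    have hL := congrArg (fun v => e'.continuousLinearMapAt ℝ (φ p.1) (tangentOf a (φ p.1) v)) hv
    simp only [map_sum, map_smul] at hL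
    rw [Trivialization.continuousLinearMapAt_apply_of_mem _ _ h3] at hL
    refine hL.trans (Finset.sum_congr rfl fun i _ => ?_)
    rw [Trivialization.continuousLinearMapAt_apply_of_mem _ _ h3]
    rfl

end TangentOf

end HomLie

/-! ### Untwisting hom-Lie algebroids. -/

namespace HomLie

variable {E : Type*} [NormedAddCommGroup E] [NormedSpace ℝ E]
  {M : Type*} [TopologicalSpace M] [ChartedSpace E M]
  {F : Type*} [NormedAddCommGroup F] [NormedSpace ℝ F]
  {A : M → Type*} [∀ m, AddCommGroup (A m)] [∀ m, Module ℝ (A m)] [∀ m, TopologicalSpace (A m)]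
  [TopologicalSpace (TotalSpace F A)] [FiberBundle F A] [VectorBundle ℝ F A]
  [FiniteDimensional ℝ E] [FiniteDimensional ℝ F] [T2Space M] [IsManifold 𝓘(ℝ, E) ∞ M]
  [ContMDiffVectorBundle ∞ F A 𝓘(ℝ, E)]

section AnchorDerivation

theorem Anchor.deriv_apply {φ : C^∞⟮𝓘(ℝ, E), M; 𝓘(ℝ, E), M⟯} (ρ : Anchor F A φ) (X : Sec E F A)
    (f : Fn E M) (m : M) : ρ.deriv X f m = tangentDeriv (φ m) (ρ.toFun m (X (φ m))) f := rfl

/-- Every fibre vector extends to a section, and tangent vectors are separated by differentiation of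
functions. -/
theorem Anchor.ext_deriv {φ : C^∞⟮𝓘(ℝ, E), M; 𝓘(ℝ, E), M⟯} {ρ ρ' : Anchor F A φ}
    (h : ∀ X f, ρ.deriv X f = ρ'.deriv X f) : ρ = ρ' := by
  have h1 : ρ.toFun = ρ'.toFun := by
    funext m
    refine LinearMap.ext fun v => ?_
    obtain ⟨X, rfl⟩ := exists_sec_through (E := E) (F := F) (φ m) v
    refine tangentDeriv_injective (φ m) (LinearMap.ext fun f => ?_)
    exact DFunLike.congr_fun (h X f) m
  cases ρ; cases ρ'
  simp only at h1
  subst h1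
  rfl

theorem anchorOf_deriv (a : Sec E F A →ₗ[Fn E M] Derivation ℝ (Fn E M) (Fn E M))
    (φ : C^∞⟮𝓘(ℝ, E), M; 𝓘(ℝ, E), M⟯) (X : Sec E F A) (f : Fn E M) :
    (anchorOf a φ).deriv X f = pull φ (a X f) := by
  ext m
  exact tangentOf_apply a (φ m) X f

theorem Anchor.deriv_mul {φ : C^∞⟮𝓘(ℝ, E), M; 𝓘(ℝ, E), M⟯} (ρ : Anchor F A φ) (X : Sec E F A)
    (f g : Fn E M) : ρ.deriv X (f * g) = pull φ f * ρ.deriv X g + pull φ g * ρ.deriv X f := by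
  ext m
  exact tangentDeriv_isDerivAt (φ m) _ f g

theorem Anchor.deriv_smul {φ : C^∞⟮𝓘(ℝ, E), M; 𝓘(ℝ, E), M⟯} (ρ : Anchor F A φ) (X : Sec E F A)
    (f g : Fn E M) : ρ.deriv (f • X) g = pull φ f * ρ.deriv X g := by
  ext m
  rw [Anchor.deriv_apply, section_smul_apply, map_smul, map_smul]
  rfl

variable (φ : M ≃ₘ^∞⟮𝓘(ℝ, E), 𝓘(ℝ, E)⟯ M)

/-- The pullback of functions along a diffeomorphism. -/
noncomputable def pullEquiv : Fn E M ≃ₐ[ℝ] Fn E M :=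
  AlgEquiv.ofLinearEquiv
    (LinearEquiv.ofLinearMap (pull (φ : C^∞⟮𝓘(ℝ, E), M; 𝓘(ℝ, E), M⟯))
      (pull (φ.symm : C^∞⟮𝓘(ℝ, E), M; 𝓘(ℝ, E), M⟯))
      (LinearMap.ext fun f => ContMDiffMap.ext fun m => congrArg f (φ.symm_apply_apply m))
      (LinearMap.ext fun f => ContMDiffMap.ext fun m => congrArg f (φ.apply_symm_apply m)))
    rfl fun _ _ => rfl

theorem pullEquiv_apply (f : Fn E M) :
    pullEquiv φ f = pull (φ : C^∞⟮𝓘(ℝ, E), M; 𝓘(ℝ, E), M⟯) f := rfl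

/-- The derivations given by a bundle map `φ^!A → φ^!TM`. -/
noncomputable def Anchor.derivation (ρ : Anchor F A (φ : C^∞⟮𝓘(ℝ, E), M; 𝓘(ℝ, E), M⟯)) :
    Sec E F A →ₗ[Fn E M] Derivation ℝ (Fn E M) (Fn E M) where
  -- The operator `ρ(X)` obeys a Leibniz rule twisted by `φ*`; composing with `(φ*)⁻¹` makes it an
  -- ordinary derivation.
  toFun X := Derivation.mk' ((pullEquiv φ).symm.toLinearMap ∘ₗ ρ.deriv X) fun f g => by
    apply (pullEquiv φ).injective
    simp only [LinearMap.comp_apply, AlgEquiv.toLinearMap_apply, smul_eq_mul, map_add, map_mul,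
      AlgEquiv.apply_symm_apply]
    exact ρ.deriv_mul X f g
  map_add' X Y := by
    ext1 f
    exact congrArg (pullEquiv φ).symm (LinearMap.congr_fun (map_add ρ.deriv X Y) f) |>.trans
      (map_add _ _ _)
  map_smul' f X := by
    ext1 g
    apply (pullEquiv φ).injective
    refine ((pullEquiv φ).apply_symm_apply _).trans ((ρ.deriv_smul X f g).trans ?_)
    change _ = pullEquiv φ (f * _)
    rw [map_mul]
    exact congrArg _ ((pullEquiv φ).apply_symm_apply _).symm

theorem Anchor.pullEquiv_derivation (ρ : Anchor F A (φ : C^∞⟮𝓘(ℝ, E), M; 𝓘(ℝ, E), M⟯))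
    (X : Sec E F A) (f : Fn E M) : pullEquiv φ (ρ.derivation φ X f) = ρ.deriv X f :=
  (pullEquiv φ).apply_symm_apply _

end AnchorDerivation

section HomBundleAut

variable {φ : M ≃ₘ^∞⟮𝓘(ℝ, E), 𝓘(ℝ, E)⟯ M} {α : Sec E F A ≃ₗ[ℝ] Sec E F A}
  (hα : IsHomBundle (φ : C^∞⟮𝓘(ℝ, E), M; 𝓘(ℝ, E), M⟯) (α : Sec E F A →ₗ[ℝ] Sec E F A))

theorem ev_hat {n : ℕ} (ξ : Form E F A n) (X : Fin n → Sec E F A) :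
    ev (hat hα n ξ) X = pullEquiv φ (ev ξ fun i => α.symm (X i)) := ev_hatMap hα ξ X

/-- The automorphism of the calculus of forms of a regular hom-bundle. -/
noncomputable def homBundleAut : ContractionAut (formContraction E F A) where
  σ := pullEquiv φ
  α := α
  hat := hat hα
  e0_hat ξ := by
    rw [formContraction_e0, formContraction_e0, ev_hat]
    congr 2
    exact Subsingleton.elim _ _
  hat_ι n X ξ := form_ext fun Y => by
    change ev (hat hα n (contract n X ξ)) Y = ev (contract n (α X) (hat hα (n + 1) ξ)) Y
    rw [ev_hat, ev_contract, ev_contract, ev_hat]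
    congr 2
    funext i
    refine Fin.cases ?_ (fun i => rfl) i
    exact (α.symm_apply_apply X).symm

theorem apply_smul_section
    (h : IsHomBundle (φ : C^∞⟮𝓘(ℝ, E), M; 𝓘(ℝ, E), M⟯) (α : Sec E F A →ₗ[ℝ] Sec E F A))
    (f : Fn E M) (X : Sec E F A) : 
    α (f • X) = pullEquiv φ f • α X := h f X

/-- The untwisted Lie–Rinehart structure of a hom-Lie algebroid. -/
noncomputable def HomLieAlgebroid.untwist
    (𝒜 : HomLieAlgebroid (φ : C^∞⟮𝓘(ℝ, E), M; 𝓘(ℝ, E), M⟯) (α : Sec E F A →ₗ[ℝ] Sec E F A)) :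
    {Λ : LieRinehart (Fn E M) (Sec E F A) // (homBundleAut hα).Preserves Λ} :=
  have hb : ∀ X Y, α (𝒜.bracket X Y) = 𝒜.bracket (α X) (α Y) := 𝒜.isHomLieAlgebra.map_bracket
  have hb' : ∀ X Y, 𝒜.bracket (α X) Y = α (𝒜.bracket X (α.symm Y)) := fun X Y => by
    rw [hb, LinearEquiv.apply_symm_apply]
  have ha : ∀ X f, 𝒜.anchor.derivation φ (α X) (pullEquiv φ f) =
      pullEquiv φ (𝒜.anchor.derivation φ X f) := fun X f => (pullEquiv φ).injective (by
    rw [Anchor.pullEquiv_derivation, Anchor.pullEquiv_derivation]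
    exact LinearMap.congr_fun (𝒜.isHomLieRep.comm X) f)
  ⟨{  bracket := 𝒜.bracket.compr₂ α.symm.toLinearMap
      anchor := 𝒜.anchor.derivation φ
      skew := fun X Y =>
        (congrArg α.symm (𝒜.isHomLieAlgebra.skew X Y)).trans (map_neg _ _)
      jacobi := fun X Y Z => by
        -- For the untwisted bracket α⁻¹[·,·], two applications of α turn the double bracket of X,
        -- Y, Z into `[αX,[Y,Z]]`, so Jacobi becomes hom-Jacobi.
        apply α.injective
        apply α.injective
        have h := 𝒜.isHomLieAlgebra.jacobi X Y Z
        simp only [LinearEquiv.coe_coe, hb'] at h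
        simp only [LinearMap.compr₂_apply, LinearEquiv.coe_coe, map_add, map_zero,
          LinearEquiv.apply_symm_apply]
        exact h
      leibniz := fun X Y f => by
        apply α.injective
        simp only [LinearMap.compr₂_apply, LinearEquiv.coe_coe, map_add, apply_smul_section hα,
          LinearEquiv.apply_symm_apply, Anchor.pullEquiv_derivation]
        exact 𝒜.leibniz X Y f
      anchor_bracket := fun X Y f => by
        -- Likewise, two applications of `φ*` turn compatibility of the untwisted anchor with
        -- brackets into the representation identity of ρ.
        apply (pullEquiv φ).injective
        apply (pullEquiv φ).injective
        have h := LinearMap.congr_fun (𝒜.isHomLieRep.map_bracket X Y) f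
        simp only [LinearMap.comp_apply, LinearMap.sub_apply, ← Anchor.pullEquiv_derivation φ,
          LinearEquiv.coe_coe, ha] at h
        rw [← ha, LinearMap.compr₂_apply]
        simp only [LinearEquiv.coe_coe, LinearEquiv.apply_symm_apply, map_sub]
        exact h },
    { bracket := fun X Y => (α.apply_symm_apply _).trans
        ((α.symm_apply_apply _).symm.trans (congrArg α.symm (hb X Y)))
      anchor := ha }⟩

/-- The hom-Lie algebroid of an invariant Lie–Rinehart structure. -/
noncomputable def twist
    (Λ : {Λ : LieRinehart (Fn E M) (Sec E F A) // (homBundleAut hα).Preserves Λ}) :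
    HomLieAlgebroid (φ : C^∞⟮𝓘(ℝ, E), M; 𝓘(ℝ, E), M⟯) (α : Sec E F A →ₗ[ℝ] Sec E F A) :=
  have hb : ∀ X Y, α (Λ.1.bracket X Y) = Λ.1.bracket (α X) (α Y) := Λ.2.bracket
  have ha : ∀ X f, Λ.1.anchor (α X) (pullEquiv φ f) = pullEquiv φ (Λ.1.anchor X f) := Λ.2.anchor
  { bracket := Λ.1.bracket.compr₂ α.toLinearMap
    anchor := anchorOf Λ.1.anchor φ
    isHomBundle := hα
    isHomLieAlgebra :=
      { skew := fun X Y => (congrArg α (Λ.1.skew X Y)).trans (map_neg _ _)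
        map_bracket := fun X Y => congrArg α (hb X Y)
        jacobi := fun X Y Z => by
          simp only [LinearMap.compr₂_apply, LinearEquiv.coe_coe, ← hb, ← map_add, Λ.1.jacobi,
            map_zero] }
    leibniz := fun X Y f => by
      rw [anchorOf_deriv]
      simp only [LinearMap.compr₂_apply, LinearEquiv.coe_coe, fmul_eq_smul, Λ.1.leibniz, map_add,
        apply_smul_section hα]
      rfl
    isHomLieRep :=
      { comm := fun X => LinearMap.ext fun f => by
          simp only [LinearMap.comp_apply, anchorOf_deriv, ← pullEquiv_apply, LinearEquiv.coe_coe,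
            ha]
        map_bracket := fun X Y => LinearMap.ext fun f => by
          simp only [LinearMap.comp_apply, LinearMap.sub_apply, anchorOf_deriv, ← pullEquiv_apply,
            LinearMap.compr₂_apply, LinearEquiv.coe_coe, ha, Λ.1.anchor_bracket, map_sub] } }

theorem HomLieAlgebroid.ext' {φ : C^∞⟮𝓘(ℝ, E), M; 𝓘(ℝ, E), M⟯} {α : Sec E F A →ₗ[ℝ] Sec E F A}
    {𝒜 𝒜' : HomLieAlgebroid φ α} (h1 : 𝒜.bracket = 𝒜'.bracket) (h2 : 𝒜.anchor = 𝒜'.anchor) :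
    𝒜 = 𝒜' := by
  cases 𝒜; cases 𝒜'
  simp only at h1 h2
  subst h1 h2
  rfl

/-- Hom-Lie algebroids are invariant Lie–Rinehart structures. -/
noncomputable def untwistEquiv :
    HomLieAlgebroid (φ : C^∞⟮𝓘(ℝ, E), M; 𝓘(ℝ, E), M⟯) (α : Sec E F A →ₗ[ℝ] Sec E F A) ≃
      {Λ : LieRinehart (Fn E M) (Sec E F A) // (homBundleAut hα).Preserves Λ} where
  toFun := HomLieAlgebroid.untwist hα
  invFun := twist hα
  left_inv 𝒜 := HomLieAlgebroid.ext'
    (LinearMap.ext fun _ => LinearMap.ext fun _ => α.apply_symm_apply _)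
    (Anchor.ext_deriv fun X f => (anchorOf_deriv _ _ X f).trans (𝒜.anchor.pullEquiv_derivation φ X f))
  right_inv Λ := Subtype.ext (LieRinehart.ext'
    (fun _ _ => α.symm_apply_apply _)
    (fun X f => (pullEquiv φ).injective
      (((anchorOf Λ.1.anchor _).pullEquiv_derivation φ X f).trans (anchorOf_deriv _ _ X f))))

end HomBundleAut

end HomLie

/-! ### The correspondence and its explicit formulas. -/

namespace HomLie

variable {E : Type*} [NormedAddCommGroup E] [NormedSpace ℝ E]
  {M : Type*} [TopologicalSpace M] [ChartedSpace E M]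
  {F : Type*} [NormedAddCommGroup F] [NormedSpace ℝ F]
  {A : M → Type*} [∀ m, AddCommGroup (A m)] [∀ m, Module ℝ (A m)] [∀ m, TopologicalSpace (A m)]
  [TopologicalSpace (TotalSpace F A)] [FiberBundle F A] [VectorBundle ℝ F A]
  [FiniteDimensional ℝ E] [FiniteDimensional ℝ F] [T2Space M] [IsManifold 𝓘(ℝ, E) ∞ M]
  [ContMDiffVectorBundle ∞ F A 𝓘(ℝ, E)]

section Correspondence

variable {φ : M ≃ₘ^∞⟮𝓘(ℝ, E), 𝓘(ℝ, E)⟯ M} {α : Sec E F A ≃ₗ[ℝ] Sec E F A}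
  (hα : IsHomBundle (φ : C^∞⟮𝓘(ℝ, E), M; 𝓘(ℝ, E), M⟯) (α : Sec E F A →ₗ[ℝ] Sec E F A))

theorem formContraction_e0_one : (formContraction E F A).e0 (ofFn E F A 1) = 1 := rfl

/-- Hom-Lie algebroid structures correspond to twisted differentials on forms. -/
noncomputable def homLieAlgebroidEquiv :
    HomLieAlgebroid (φ : C^∞⟮𝓘(ℝ, E), M; 𝓘(ℝ, E), M⟯) (α : Sec E F A →ₗ[ℝ] Sec E F A) ≃
      TwistedDGCA (𝔄 := Form E F A) wedge (ofFn E F A 1)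
        (fun n => (hat hα n).toLinearMap) (fun n => (hat hα n).toLinearMap) :=
  (untwistEquiv hα).trans
    (((homBundleAut hα).lieRinehartEquiv wedge_isWedge formContraction_isReflexive).trans
      ((homBundleAut hα).twistedEquiv wedge_isWedge formContraction_e0_one))

variable (𝒜 : HomLieAlgebroid (φ : C^∞⟮𝓘(ℝ, E), M; 𝓘(ℝ, E), M⟯)
  (α : Sec E F A →ₗ[ℝ] Sec E F A))

theorem homLieAlgebroidEquiv_d_lof (n : ℕ) (ξ : Form E F A n) :
    (homLieAlgebroidEquiv hα 𝒜).d (DirectSum.lof ℝ ℕ _ n ξ) (n + 1) =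
      hat hα (n + 1) ((formContraction E F A).diff (𝒜.untwist hα).1 n ξ) := by
  have h : (homLieAlgebroidEquiv hα 𝒜).d (DirectSum.lof ℝ ℕ _ n ξ) =
      (homBundleAut hα).tot ((formContraction E F A).diffTot (𝒜.untwist hα).1
        (DirectSum.lof ℝ ℕ _ n ξ)) := rfl
  rw [h, Contraction.diffTot_lof, ContractionAut.tot_lof]
  exact DirectSum.lof_apply ℝ _ _

theorem HomLieAlgebroid.untwist_anchor (X : Sec E F A) (f : Fn E M) :
    pullEquiv φ ((𝒜.untwist hα).1.anchor X f) = 𝒜.anchor.deriv X f :=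
  𝒜.anchor.pullEquiv_derivation φ X f

theorem HomLieAlgebroid.symm_bracket (X Y : Sec E F A) :
    α.symm (𝒜.bracket X Y) = 𝒜.bracket (α.symm X) (α.symm Y) := by
  have h := 𝒜.isHomLieAlgebra.map_bracket (α.symm X) (α.symm Y)
  simp only [LinearEquiv.coe_coe, LinearEquiv.apply_symm_apply] at h
  rw [← h, LinearEquiv.symm_apply_apply]

theorem HomLieAlgebroid.untwist_bracket (X Y : Sec E F A) :
    (𝒜.untwist hα).1.bracket (α.symm X) (α.symm Y) = α.symm (α.symm (𝒜.bracket X Y)) :=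
  congrArg α.symm (𝒜.symm_bracket X Y).symm

/-- Since `d = α̂ ∘ δ`, the value is `φ*` of the ordinary Chevalley–Eilenberg formula at the
`α⁻¹xᵢ`. Applying `φ*` to the untwisted anchor gives ρ, and the untwisted bracket of `α⁻¹xᵢ` and
`α⁻¹xⱼ` is `α⁻²[xᵢ,xⱼ]`. -/
theorem homLieAlgebroidEquiv_apply (n : ℕ) (ξ : Form E F A n) (X : Fin (n + 1) → Sec E F A) :
    ev ((homLieAlgebroidEquiv hα 𝒜).d (DirectSum.lof ℝ ℕ _ n ξ) (n + 1)) X = ceValue 𝒜 n ξ X := by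
  rw [homLieAlgebroidEquiv_d_lof, ev_hat, ← formContraction_eval]
  cases n with
  | zero =>
    rw [Contraction.eval_diff_zero, 𝒜.untwist_anchor hα, formContraction_eval]
    rfl
  | succ n =>
    rw [Contraction.eval_diff_succ]
    simp only [formContraction_eval, map_add, map_sum, map_smul, 𝒜.untwist_anchor hα,
      𝒜.untwist_bracket hα, apply_ite (pullEquiv φ), map_zero, pullEquiv_apply]
    rfl

theorem anchor_deriv_eq (X : Sec E F A) (f : Fn E M) :
    𝒜.anchor.deriv X f = ev ((homLieAlgebroidEquiv hα 𝒜).d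
      (DirectSum.lof ℝ ℕ _ 0 (ofFn E F A f)) 1) ![α X] := by
  rw [homLieAlgebroidEquiv_apply]
  change _ = 𝒜.anchor.deriv (α.symm (α X)) f
  rw [LinearEquiv.symm_apply_apply]

/-- With `ξ = α̂ η`, this is the differential formula for η at `(αX, αY)`, solved for its bracket
term: `φ*(η(α⁻²[αX,αY])) = φ*(η(α⁻¹[X,Y]))`, which is ξ evaluated on `[X,Y]`. -/
theorem ev_bracket_eq (X Y : Sec E F A) (ξ : Form E F A 1) :
    ev ξ ![𝒜.bracket X Y] = 𝒜.anchor.deriv X (ev ((hat hα 1).symm ξ) ![Y]) -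
      𝒜.anchor.deriv Y (ev ((hat hα 1).symm ξ) ![X]) -
      ev ((homLieAlgebroidEquiv hα 𝒜).d (DirectSum.lof ℝ ℕ _ 1 ((hat hα 1).symm ξ)) 2)
        ![α X, α Y] := by
  obtain ⟨η, rfl⟩ := (hat hα 1).surjective ξ
  have h0 : ∀ f : Fin 1 → Sec E F A, f = ![f 0] := fun f => funext fun i => by
    fin_cases i; rfl
  have hb : α.symm (𝒜.bracket (α X) (α Y)) = 𝒜.bracket X Y := by
    rw [𝒜.symm_bracket, LinearEquiv.symm_apply_apply, LinearEquiv.symm_apply_apply]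
  have h1 : ceValue 𝒜 1 η ![α X, α Y] = 𝒜.anchor.deriv X (ev η ![Y]) -
      𝒜.anchor.deriv Y (ev η ![X]) - pullEquiv φ (ev η ![α.symm (𝒜.bracket X Y)]) := by
    rw [ceValue]
    simp only [Fin.sum_univ_succ, Fin.sum_univ_zero]
    rw [h0 (fun l => α.symm _), h0 (fun l => α.symm _), h0 (Fin.cons _ _), h0 (Fin.cons _ _)]
    simp [hb, pullEquiv_apply]
    rw [h0 (Fin.cons _ _), Fin.cons_zero]
    abel
  rw [LinearEquiv.symm_apply_apply, homLieAlgebroidEquiv_apply, h1, ev_hat, sub_sub_cancel]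
  rw [h0 fun i => α.symm _]
  rfl

end Correspondence

end HomLie

theorem mainTheorem5
    {E : Type*} [NormedAddCommGroup E] [NormedSpace ℝ E] [FiniteDimensional ℝ E]
    {M : Type*} [TopologicalSpace M] [T2Space M] [ChartedSpace E M] [IsManifold 𝓘(ℝ, E) ∞ M]
    {F : Type*} [NormedAddCommGroup F] [NormedSpace ℝ F] [FiniteDimensional ℝ F]
    {A : M → Type*} [∀ m, AddCommGroup (A m)] [∀ m, Module ℝ (A m)]
    [∀ m, TopologicalSpace (A m)] [TopologicalSpace (TotalSpace F A)]
    [FiberBundle F A] [VectorBundle ℝ F A] [ContMDiffVectorBundle ∞ F A 𝓘(ℝ, E)]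
    (φ : M ≃ₘ^∞⟮𝓘(ℝ, E), 𝓘(ℝ, E)⟯ M)
    (α : HomLie.Sec E F A ≃ₗ[ℝ] HomLie.Sec E F A)
    (hα : HomLie.IsHomBundle (φ : C^∞⟮𝓘(ℝ, E), M; 𝓘(ℝ, E), M⟯)
      (α : HomLie.Sec E F A →ₗ[ℝ] HomLie.Sec E F A)) :
    ∃ e : HomLie.HomLieAlgebroid (φ : C^∞⟮𝓘(ℝ, E), M; 𝓘(ℝ, E), M⟯)
          (α : HomLie.Sec E F A →ₗ[ℝ] HomLie.Sec E F A) ≃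
        HomLie.TwistedDGCA (𝔄 := HomLie.Form E F A) HomLie.wedge (HomLie.ofFn E F A 1)
          (fun n => (HomLie.hat hα n).toLinearMap) (fun n => (HomLie.hat hα n).toLinearMap),
      (∀ 𝒜 (n : ℕ) (ξ : HomLie.Form E F A n) (x : Fin (n + 1) → HomLie.Sec E F A),
        HomLie.ev ((e 𝒜).d (DirectSum.lof ℝ ℕ _ n ξ) (n + 1)) x = HomLie.ceValue 𝒜 n ξ x) ∧
      (∀ D (x : HomLie.Sec E F A) (f : HomLie.Fn E M),
        (e.symm D).anchor.deriv x f =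
          HomLie.ev (D.d (DirectSum.lof ℝ ℕ _ 0 (HomLie.ofFn E F A f)) 1) ![α x]) ∧
      (∀ D (x y : HomLie.Sec E F A) (ξ : HomLie.Form E F A 1),
        HomLie.ev ξ ![(e.symm D).bracket x y] =
          (e.symm D).anchor.deriv x (HomLie.ev ((HomLie.hat hα 1).symm ξ) ![y]) -
          (e.symm D).anchor.deriv y (HomLie.ev ((HomLie.hat hα 1).symm ξ) ![x]) -
          HomLie.ev (D.d (DirectSum.lof ℝ ℕ _ 1 ((HomLie.hat hα 1).symm ξ)) 2)
            ![α x, α y]) := by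
  refine ⟨HomLie.homLieAlgebroidEquiv hα, HomLie.homLieAlgebroidEquiv_apply hα,
    fun D x f => ?_, fun D x y ξ => ?_⟩
  -- Writing D as the image of some 𝒜 turns the description of the inverse into an identity for 𝒜.
  · obtain ⟨𝒜, rfl⟩ := (HomLie.homLieAlgebroidEquiv hα).surjective D
    rw [Equiv.symm_apply_apply]
    exact HomLie.anchor_deriv_eq hα 𝒜 x f
  · obtain ⟨𝒜, rfl⟩ := (HomLie.homLieAlgebroidEquiv hα).surjective D
    rw [Equiv.symm_apply_apply]
    exact HomLie.ev_bracket_eq hα 𝒜 x y ξ
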